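/- Let $k$ be a field and $H$ a Hopf algebra over $k$ with invertible antipode $S$; write $\Delta h=h_{1}\otimes h_{2}$. A right crossed module (object of $\mathcal M^H_H$) is a vector space $V$ with a right action $\triangleleft$ and a right coaction $v\mapsto v^{(1)}\otimes v^{(2)}\in V\otimes H$ such that $v^{(1)}\triangleleft h_1\otimes v^{(2)}h_2=(v\triangleleft h_2)^{(1)}\otimes h_1(v\triangleleft h_2)^{(2)}$; a left crossed module (object of ${}^H_H\mathcal M$) is a vector space with a left action $\triangleright$ and a left coaction $v\mapsto v^{(1)}\otimes v^{(2)}\in H\otimes V$ such that $h_1v^{(1)}\otimes h_2\triangleright v^{(2)}=(h_1\triangleright v)^{(1)}h_2\otimes (h_1\triangleright v)^{(2)}$. These form monoidal categories with braidings $\Psi(v\otimes w)=w^{(1)}\otimes v\triangleleft w^{(2)}$ and $\Psi(v\otimes w)=v^{(1)}\triangleright w\otimes v^{(2)}$ respectively. Let $B$ be a braided group (Hopf algebra) in $\mathcal M^H_H$ and $\bar C$ a braided group in ${}^H_H\mathcal M$, with braided coproducts $b_1\otimes b_2$, $c_1\otimes c_2$, counits $\epsilon$, and braided antipodes $\underline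 S$, $\bar S$. Assume the compatibility condition $$b^{(1)}\triangleleft c^{(1)}\otimes b^{(2)}\triangleright c^{(2)}=b\otimes c\qquad(b\in B,\ c\in\bar C),$$ and let $\langle\ ,\ \rangle:\bar C\otimes B\to k$ be a braided skew-pairing: a linear map such that for all $h\in H$, $a,b\in B$, $c,d\in\bar C$ $$\langle h\triangleright c,b\rangle=\langle c,b\triangleleft h\rangle,\quad \langle c,ab\rangle=\langle c_2,a\triangleleft b^{(2)}\rangle\langle c_1,b^{(1)}\rangle,\quad \langle cd,b\rangle=\langle c,b_1\rangle\langle d,b_2\rangle,$$ $$\langle c,1\rangle=\epsilon(c),\quad\langle 1,b\rangle=\epsilon(b),\quad \langle\bar Sc,\underline Sb\rangle=\langle c,b\rangle$$ (the last being $\langle\bar Sc,b\rangle=\langle c,\underline S^{-1}b\rangle$ when $\underline S$ is invertible). Let $H\ltimes B$ be the Radford biproduct on $H\otimes B$ with $(h\otimes b)(g\otimes a)=hg_1\otimes(b\triangleleft g_2)a$, $\Delta(h\otimes b)=h_1\otimes b_1{}^{(1)}\otimes h_2b_1{}^{(2)}\otimes b_2$, antipode $S(h\otimes b)=(1\otimes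 \underline S b^{(1)})(S(hb^{(2)})\otimes 1)$, and $\bar C\rtimes H$ the Radford biproduct on $\bar C\otimes H$ with $(c\otimes h)(d\otimes g)=c(h_1\triangleright d)\otimes h_2g$, $\Delta(c\otimes h)=c_1\otimes c_2{}^{(1)}h_1\otimes c_2{}^{(2)}\otimes h_2$, antipode $S(c\otimes h)=(1\otimes S(c^{(1)}h))(\bar S c^{(2)}\otimes1)$, both with the tensor product unit and counit. Then there is a unique Hopf algebra structure on the vector space $\bar C\otimes H\otimes B$ (the double biproduct) such that $H\ltimes B$ and $\bar C\rtimes H$ are sub-Hopf algebras by the canonical inclusions $h\otimes b\mapsto1\otimes h\otimes b$ and $c\otimes h\mapsto c\otimes h\otimes 1$, such that $c\otimes h\otimes b$ is the product $chb$ of $c$, $h$ and $b$ viewed in it, and such that the cross relations $$bc=b_1{}^{(2)}\,c_2\,b_2\,c_3{}^{(1)}\,\langle c_1,b_1{}^{(1)}\rangle\langle\bar S c_3{}^{(2)},b_3\rangle\qquad(b\in B,\ c\in\bar C)$$ hold. -/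

import Mathlib

open scoped TensorProduct

noncomputable section

namespace DoubleBiproduct

/-! ### Tensor bookkeeping -/

section Tensor

variable {k : Type*} [CommSemiring k]
variable {U V W X V' W' : Type*}
  [AddCommMonoid U] [AddCommMonoid V] [AddCommMonoid W] [AddCommMonoid X]
  [AddCommMonoid V'] [AddCommMonoid W']
  [Module k U] [Module k V] [Module k W] [Module k X] [Module k V'] [Module k W']

/-- Apply `f : V ⊗ W → V' ⊗ W'` to the two middle factors:
`(u ⊗ v) ⊗ (w ⊗ x) ↦ ∑ (u ⊗ v') ⊗ (w' ⊗ x)` where `f (v ⊗ w) = ∑ v' ⊗ w'`. -/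
def mid (f : V ⊗[k] W →ₗ[k] V' ⊗[k] W') :
    (U ⊗[k] V) ⊗[k] (W ⊗[k] X) →ₗ[k] (U ⊗[k] V') ⊗[k] (W' ⊗[k] X) :=
  (TensorProduct.assoc k U V' (W' ⊗[k] X)).symm.toLinearMap ∘ₗ
    LinearMap.lTensor U
      ((TensorProduct.assoc k V' W' X).toLinearMap ∘ₗ LinearMap.rTensor X f ∘ₗ
        (TensorProduct.assoc k V W X).symm.toLinearMap) ∘ₗ
    (TensorProduct.assoc k U V (W ⊗[k] X)).toLinearMap

/-- The flip of the two middle factors: `(u ⊗ v) ⊗ (w ⊗ x) ↦ (u ⊗ w) ⊗ (v ⊗ x)`. -/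
abbrev flipMid :
    (U ⊗[k] V) ⊗[k] (W ⊗[k] X) →ₗ[k] (U ⊗[k] W) ⊗[k] (V ⊗[k] X) :=
  (TensorProduct.tensorTensorTensorComm k U V W X).toLinearMap

end Tensor

/-! ### Hopf algebra structures on a fixed vector space -/

section HopfData

variable (k : Type*) [CommSemiring k]

/-- The structure maps (product, unit, coproduct, counit, antipode) of a Hopf algebra
on a given module `V`. -/
@[ext]
structure HopfData (V : Type*) [AddCommMonoid V] [Module k V] where
  mul : V ⊗[k] V →ₗ[k] V
  one : V
  comul : V →ₗ[k] V ⊗[k] V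
  counit : V →ₗ[k] k
  antipode : V →ₗ[k] V

variable {k}
variable {V W : Type*} [AddCommMonoid V] [Module k V] [AddCommMonoid W] [Module k W]

/-- The structure maps satisfy the axioms of a Hopf algebra over `k`. -/
structure HopfData.IsHopf (s : HopfData k V) : Prop where
  mul_assoc : ∀ x y z : V,
    s.mul (s.mul (x ⊗ₜ[k] y) ⊗ₜ[k] z) = s.mul (x ⊗ₜ[k] s.mul (y ⊗ₜ[k] z))
  one_mul : ∀ x : V, s.mul (s.one ⊗ₜ[k] x) = x
  mul_one : ∀ x : V, s.mul (x ⊗ₜ[k] s.one) = x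
  coassoc : ∀ x : V,
    TensorProduct.assoc k V V V (LinearMap.rTensor V s.comul (s.comul x)) =
      LinearMap.lTensor V s.comul (s.comul x)
  counit_comul : ∀ x : V, LinearMap.rTensor V s.counit (s.comul x) = (1 : k) ⊗ₜ[k] x
  comul_counit : ∀ x : V, LinearMap.lTensor V s.counit (s.comul x) = x ⊗ₜ[k] (1 : k)
  comul_one : s.comul s.one = s.one ⊗ₜ[k] s.one
  comul_mul : ∀ x y : V,
    s.comul (s.mul (x ⊗ₜ[k] y)) =
      TensorProduct.map s.mul s.mul (flipMid (s.comul x ⊗ₜ[k] s.comul y))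
  counit_one : s.counit s.one = 1
  counit_mul : ∀ x y : V, s.counit (s.mul (x ⊗ₜ[k] y)) = s.counit x * s.counit y
  antipode_left : ∀ x : V,
    s.mul (LinearMap.rTensor V s.antipode (s.comul x)) = s.counit x • s.one
  antipode_right : ∀ x : V,
    s.mul (LinearMap.lTensor V s.antipode (s.comul x)) = s.counit x • s.one

/-- `i : V → W` exhibits the Hopf algebra `t` on `V` as a sub-Hopf algebra of `s` on `W`:
`t` is a Hopf algebra and `i` is injective and compatible with all structure maps. -/
structure HopfData.IsSubHopf (t : HopfData k V) (s : HopfData k W) (i : V →ₗ[k] W) :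
    Prop where
  isHopf : t.IsHopf
  injective : Function.Injective i
  map_mul : ∀ x y : V, i (t.mul (x ⊗ₜ[k] y)) = s.mul (i x ⊗ₜ[k] i y)
  map_one : i t.one = s.one
  map_comul : ∀ x : V, TensorProduct.map i i (t.comul x) = s.comul (i x)
  map_counit : ∀ x : V, s.counit (i x) = t.counit x
  map_antipode : ∀ x : V, i (t.antipode x) = s.antipode (i x)

end HopfData

section Main

variable (k H : Type*) [Field k] [Ring H] [HopfAlgebra k H]

/-! ### Right crossed modules -/

/-- A right crossed module over `H` (an object of `𝓜^H_H`): a right action `v ⊗ h ↦ v ◁ h` and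
a right coaction `v ↦ v⁽¹⁾ ⊗ v⁽²⁾ ∈ V ⊗ H` such that
`v⁽¹⁾ ◁ h₁ ⊗ v⁽²⁾ h₂ = (v ◁ h₂)⁽¹⁾ ⊗ h₁ (v ◁ h₂)⁽²⁾`. -/
structure RightCrossedModule (V : Type*) [AddCommGroup V] [Module k V] where
  act : V ⊗[k] H →ₗ[k] V
  coact : V →ₗ[k] V ⊗[k] H
  act_one : ∀ v : V, act (v ⊗ₜ[k] (1 : H)) = v
  act_mul : ∀ (v : V) (g h : H),
    act (v ⊗ₜ[k] (g * h)) = act (act (v ⊗ₜ[k] g) ⊗ₜ[k] h)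
  coact_counit : ∀ v : V,
    LinearMap.lTensor V (Coalgebra.counit (R := k) (A := H)) (coact v) = v ⊗ₜ[k] (1 : k)
  coact_coassoc : ∀ v : V,
    TensorProduct.assoc k V H H (LinearMap.rTensor H coact (coact v)) =
      LinearMap.lTensor V (Coalgebra.comul (R := k) (A := H)) (coact v)
  crossed : ∀ (v : V) (h : H),
    TensorProduct.map act (LinearMap.mul' k H)
        (flipMid (coact v ⊗ₜ[k] Coalgebra.comul (R := k) h)) =
      LinearMap.lTensor V (LinearMap.mul' k H)
        (TensorProduct.leftComm k H V H
          (LinearMap.lTensor H (coact ∘ₗ act)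
            (TensorProduct.leftComm k V H H (v ⊗ₜ[k] Coalgebra.comul (R := k) h))))

variable {k H}

/-- `f : V → W` intertwines the right actions `aV`, `aW` and the right coactions `cV`, `cW`. -/
def RightIntertwines {V W : Type*} [AddCommGroup V] [Module k V] [AddCommGroup W] [Module k W]
    (aV : V ⊗[k] H →ₗ[k] V) (cV : V →ₗ[k] V ⊗[k] H)
    (aW : W ⊗[k] H →ₗ[k] W) (cW : W →ₗ[k] W ⊗[k] H) (f : V →ₗ[k] W) : Prop :=
  f ∘ₗ aV = aW ∘ₗ LinearMap.rTensor H f ∧ cW ∘ₗ f = LinearMap.rTensor H f ∘ₗ cV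

variable (k H) in
/-- The trivial right action on the unit object `k`: `r ◁ h = r ε(h)`. -/
def rightUnitAct : k ⊗[k] H →ₗ[k] k :=
  Coalgebra.counit (R := k) (A := H) ∘ₗ (TensorProduct.lid k H).toLinearMap

variable (k H) in
/-- The trivial right coaction on the unit object `k`: `r ↦ r ⊗ 1`. -/
def rightUnitCoact : k →ₗ[k] k ⊗[k] H :=
  (TensorProduct.mk k k H).flip 1

section RightOps

variable {V W : Type*} [AddCommGroup V] [Module k V] [AddCommGroup W] [Module k W]
variable (𝓥 : RightCrossedModule k H V) (𝓦 : RightCrossedModule k H W)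

/-- The right action on a tensor product: `(v ⊗ w) ◁ h = v ◁ h₁ ⊗ w ◁ h₂`. -/
def rightTensorAct : (V ⊗[k] W) ⊗[k] H →ₗ[k] V ⊗[k] W :=
  TensorProduct.map 𝓥.act 𝓦.act ∘ₗ flipMid ∘ₗ
    LinearMap.lTensor (V ⊗[k] W) (Coalgebra.comul (R := k) (A := H))

/-- The right coaction on a tensor product: `v ⊗ w ↦ (v⁽¹⁾ ⊗ w⁽¹⁾) ⊗ v⁽²⁾ w⁽²⁾`. -/
def rightTensorCoact : V ⊗[k] W →ₗ[k] (V ⊗[k] W) ⊗[k] H :=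
  LinearMap.lTensor (V ⊗[k] W) (LinearMap.mul' k H) ∘ₗ flipMid ∘ₗ
    TensorProduct.map 𝓥.coact 𝓦.coact

/-- The braiding of `𝓜^H_H`: `Ψ(v ⊗ w) = w⁽¹⁾ ⊗ v ◁ w⁽²⁾`. -/
def rightBraiding : V ⊗[k] W →ₗ[k] W ⊗[k] V :=
  LinearMap.lTensor W 𝓥.act ∘ₗ (TensorProduct.leftComm k V W H).toLinearMap ∘ₗ
    LinearMap.lTensor V 𝓦.coact

/-- Moving `H` to the left past a right `H`-module in a cross product: `v ⊗ h ↦ h₁ ⊗ v ◁ h₂`. -/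
def rightSwap : V ⊗[k] H →ₗ[k] H ⊗[k] V :=
  LinearMap.lTensor H 𝓥.act ∘ₗ (TensorProduct.leftComm k V H H).toLinearMap ∘ₗ
    LinearMap.lTensor V (Coalgebra.comul (R := k) (A := H))

/-- Moving `H` to the right past a right `H`-comodule in a cross coproduct:
`h ⊗ v ↦ v⁽¹⁾ ⊗ h v⁽²⁾`. -/
def rightCoswap : H ⊗[k] V →ₗ[k] V ⊗[k] H :=
  LinearMap.lTensor V (LinearMap.mul' k H) ∘ₗ (TensorProduct.leftComm k H V H).toLinearMap ∘ₗ
    LinearMap.lTensor H 𝓥.coact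

end RightOps

variable (k H) in
/-- A braided group (Hopf algebra with braided antipode `antipode`) in `𝓜^H_H`, on an algebra
and coalgebra `B`. -/
structure RightBraidedGroup (B : Type*) [Ring B] [Algebra k B] [Coalgebra k B] extends
    RightCrossedModule k H B where
  antipode : B →ₗ[k] B
  mul_hom : RightIntertwines
    (rightTensorAct toRightCrossedModule toRightCrossedModule)
    (rightTensorCoact toRightCrossedModule toRightCrossedModule)
    act coact (LinearMap.mul' k B)
  unit_hom : RightIntertwines (rightUnitAct k H) (rightUnitCoact k H) act coact
    (Algebra.linearMap k B)
  comul_hom : RightIntertwines act coact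
    (rightTensorAct toRightCrossedModule toRightCrossedModule)
    (rightTensorCoact toRightCrossedModule toRightCrossedModule)
    (Coalgebra.comul (R := k) (A := B))
  counit_hom : RightIntertwines act coact (rightUnitAct k H) (rightUnitCoact k H)
    (Coalgebra.counit (R := k) (A := B))
  antipode_hom : RightIntertwines act coact act coact antipode
  comul_one : Coalgebra.comul (R := k) (1 : B) = 1 ⊗ₜ[k] 1
  comul_mul : ∀ a b : B,
    Coalgebra.comul (R := k) (a * b) =
      TensorProduct.map (LinearMap.mul' k B) (LinearMap.mul' k B)
        (mid (rightBraiding toRightCrossedModule toRightCrossedModule)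
          (Coalgebra.comul (R := k) a ⊗ₜ[k] Coalgebra.comul (R := k) b))
  counit_one : Coalgebra.counit (R := k) (1 : B) = 1
  counit_mul : ∀ a b : B,
    Coalgebra.counit (R := k) (a * b) =
      Coalgebra.counit (R := k) a * Coalgebra.counit (R := k) b
  antipode_left : ∀ b : B,
    LinearMap.mul' k B (LinearMap.rTensor B antipode (Coalgebra.comul (R := k) b)) =
      Coalgebra.counit (R := k) b • (1 : B)
  antipode_right : ∀ b : B,
    LinearMap.mul' k B (LinearMap.lTensor B antipode (Coalgebra.comul (R := k) b)) =
      Coalgebra.counit (R := k) b • (1 : B)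

/-! ### Left crossed modules -/

variable (k H) in
/-- A left crossed module over `H` (an object of `^H_H𝓜`): a left action `h ⊗ v ↦ h ▷ v` and
a left coaction `v ↦ v⁽¹⁾ ⊗ v⁽²⁾ ∈ H ⊗ V` such that
`h₁ v⁽¹⁾ ⊗ h₂ ▷ v⁽²⁾ = (h₁ ▷ v)⁽¹⁾ h₂ ⊗ (h₁ ▷ v)⁽²⁾`. -/
structure LeftCrossedModule (V : Type*) [AddCommGroup V] [Module k V] where
  act : H ⊗[k] V →ₗ[k] V
  coact : V →ₗ[k] H ⊗[k] V
  one_act : ∀ v : V, act ((1 : H) ⊗ₜ[k] v) = v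
  mul_act : ∀ (g h : H) (v : V),
    act ((g * h) ⊗ₜ[k] v) = act (g ⊗ₜ[k] act (h ⊗ₜ[k] v))
  counit_coact : ∀ v : V,
    LinearMap.rTensor V (Coalgebra.counit (R := k) (A := H)) (coact v) = (1 : k) ⊗ₜ[k] v
  coact_coassoc : ∀ v : V,
    TensorProduct.assoc k H H V
        (LinearMap.rTensor V (Coalgebra.comul (R := k) (A := H)) (coact v)) =
      LinearMap.lTensor H coact (coact v)
  crossed : ∀ (h : H) (v : V),
    TensorProduct.map (LinearMap.mul' k H) act
        (flipMid (Coalgebra.comul (R := k) h ⊗ₜ[k] coact v)) =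
      LinearMap.rTensor V (LinearMap.mul' k H)
        (TensorProduct.rightComm k H V H
          (LinearMap.rTensor H (coact ∘ₗ act)
            (TensorProduct.rightComm k H H V (Coalgebra.comul (R := k) h ⊗ₜ[k] v))))

/-- `f : V → W` intertwines the left actions `aV`, `aW` and the left coactions `cV`, `cW`. -/
def LeftIntertwines {V W : Type*} [AddCommGroup V] [Module k V] [AddCommGroup W] [Module k W]
    (aV : H ⊗[k] V →ₗ[k] V) (cV : V →ₗ[k] H ⊗[k] V)
    (aW : H ⊗[k] W →ₗ[k] W) (cW : W →ₗ[k] H ⊗[k] W) (f : V →ₗ[k] W) : Prop :=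
  f ∘ₗ aV = aW ∘ₗ LinearMap.lTensor H f ∧ cW ∘ₗ f = LinearMap.lTensor H f ∘ₗ cV

variable (k H) in
/-- The trivial left action on the unit object `k`: `h ▷ r = ε(h) r`. -/
def leftUnitAct : H ⊗[k] k →ₗ[k] k :=
  Coalgebra.counit (R := k) (A := H) ∘ₗ (TensorProduct.rid k H).toLinearMap

variable (k H) in
/-- The trivial left coaction on the unit object `k`: `r ↦ 1 ⊗ r`. -/
def leftUnitCoact : k →ₗ[k] H ⊗[k] k :=
  TensorProduct.mk k H k 1

section LeftOps

variable {V W : Type*} [AddCommGroup V] [Module k V] [AddCommGroup W] [Module k W]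
variable (𝓥 : LeftCrossedModule k H V) (𝓦 : LeftCrossedModule k H W)

/-- The left action on a tensor product: `h ▷ (v ⊗ w) = h₁ ▷ v ⊗ h₂ ▷ w`. -/
def leftTensorAct : H ⊗[k] (V ⊗[k] W) →ₗ[k] V ⊗[k] W :=
  TensorProduct.map 𝓥.act 𝓦.act ∘ₗ flipMid ∘ₗ
    LinearMap.rTensor (V ⊗[k] W) (Coalgebra.comul (R := k) (A := H))

/-- The left coaction on a tensor product: `v ⊗ w ↦ v⁽¹⁾ w⁽¹⁾ ⊗ (v⁽²⁾ ⊗ w⁽²⁾)`. -/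
def leftTensorCoact : V ⊗[k] W →ₗ[k] H ⊗[k] (V ⊗[k] W) :=
  LinearMap.rTensor (V ⊗[k] W) (LinearMap.mul' k H) ∘ₗ flipMid ∘ₗ
    TensorProduct.map 𝓥.coact 𝓦.coact

/-- The braiding of `^H_H𝓜`: `Ψ(v ⊗ w) = v⁽¹⁾ ▷ w ⊗ v⁽²⁾`. -/
def leftBraiding : V ⊗[k] W →ₗ[k] W ⊗[k] V :=
  LinearMap.rTensor V 𝓦.act ∘ₗ (TensorProduct.rightComm k H V W).toLinearMap ∘ₗ
    LinearMap.rTensor W 𝓥.coact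

/-- Moving `H` to the right past a left `H`-module in a cross product: `h ⊗ v ↦ h₁ ▷ v ⊗ h₂`. -/
def leftSwap : H ⊗[k] V →ₗ[k] V ⊗[k] H :=
  LinearMap.rTensor H 𝓥.act ∘ₗ (TensorProduct.rightComm k H H V).toLinearMap ∘ₗ
    LinearMap.rTensor V (Coalgebra.comul (R := k) (A := H))

/-- Moving `H` to the left past a left `H`-comodule in a cross coproduct:
`v ⊗ h ↦ v⁽¹⁾ h ⊗ v⁽²⁾`. -/
def leftCoswap : V ⊗[k] H →ₗ[k] H ⊗[k] V :=
  LinearMap.rTensor V (LinearMap.mul' k H) ∘ₗ (TensorProduct.rightComm k H V H).toLinearMap ∘ₗ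
    LinearMap.rTensor H 𝓥.coact

end LeftOps

variable (k H) in
/-- A braided group (Hopf algebra with braided antipode `antipode`) in `^H_H𝓜`, on an algebra
and coalgebra `C`. -/
structure LeftBraidedGroup (C : Type*) [Ring C] [Algebra k C] [Coalgebra k C] extends
    LeftCrossedModule k H C where
  antipode : C →ₗ[k] C
  mul_hom : LeftIntertwines
    (leftTensorAct toLeftCrossedModule toLeftCrossedModule)
    (leftTensorCoact toLeftCrossedModule toLeftCrossedModule)
    act coact (LinearMap.mul' k C)
  unit_hom : LeftIntertwines (leftUnitAct k H) (leftUnitCoact k H) act coact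
    (Algebra.linearMap k C)
  comul_hom : LeftIntertwines act coact
    (leftTensorAct toLeftCrossedModule toLeftCrossedModule)
    (leftTensorCoact toLeftCrossedModule toLeftCrossedModule)
    (Coalgebra.comul (R := k) (A := C))
  counit_hom : LeftIntertwines act coact (leftUnitAct k H) (leftUnitCoact k H)
    (Coalgebra.counit (R := k) (A := C))
  antipode_hom : LeftIntertwines act coact act coact antipode
  comul_one : Coalgebra.comul (R := k) (1 : C) = 1 ⊗ₜ[k] 1
  comul_mul : ∀ c d : C,
    Coalgebra.comul (R := k) (c * d) =
      TensorProduct.map (LinearMap.mul' k C) (LinearMap.mul' k C)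
        (mid (leftBraiding toLeftCrossedModule toLeftCrossedModule)
          (Coalgebra.comul (R := k) c ⊗ₜ[k] Coalgebra.comul (R := k) d))
  counit_one : Coalgebra.counit (R := k) (1 : C) = 1
  counit_mul : ∀ c d : C,
    Coalgebra.counit (R := k) (c * d) =
      Coalgebra.counit (R := k) c * Coalgebra.counit (R := k) d
  antipode_left : ∀ c : C,
    LinearMap.mul' k C (LinearMap.rTensor C antipode (Coalgebra.comul (R := k) c)) =
      Coalgebra.counit (R := k) c • (1 : C)
  antipode_right : ∀ c : C,
    LinearMap.mul' k C (LinearMap.lTensor C antipode (Coalgebra.comul (R := k) c)) =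
      Coalgebra.counit (R := k) c • (1 : C)

/-! ### Radford biproducts -/

variable {B C : Type*} [Ring B] [Algebra k B] [Coalgebra k B]
  [Ring C] [Algebra k C] [Coalgebra k C]

/-- The biproduct of `H` and a braided group `B` in `𝓜^H_H`, on `H ⊗ B`:
`(h ⊗ b)(g ⊗ a) = h g₁ ⊗ (b ◁ g₂) a`, `Δ(h ⊗ b) = (h₁ ⊗ b₁⁽¹⁾) ⊗ (h₂ b₁⁽²⁾ ⊗ b₂)`,
tensor product unit and counit, and `S(h ⊗ b) = (1 ⊗ S b⁽¹⁾)(S(h b⁽²⁾) ⊗ 1)`. -/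
def rightBiproduct (𝓑 : RightBraidedGroup k H B) : HopfData k (H ⊗[k] B) where
  mul := TensorProduct.map (LinearMap.mul' k H) (LinearMap.mul' k B) ∘ₗ
    mid (rightSwap 𝓑.toRightCrossedModule)
  one := 1 ⊗ₜ[k] 1
  comul := mid (rightCoswap 𝓑.toRightCrossedModule) ∘ₗ
    TensorProduct.map (Coalgebra.comul (R := k) (A := H)) (Coalgebra.comul (R := k) (A := B))
  counit := LinearMap.mul' k k ∘ₗ
    TensorProduct.map (Coalgebra.counit (R := k) (A := H)) (Coalgebra.counit (R := k) (A := B))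
  antipode := rightSwap 𝓑.toRightCrossedModule ∘ₗ
    TensorProduct.map 𝓑.antipode (HopfAlgebra.antipode k (A := H)) ∘ₗ
    rightCoswap 𝓑.toRightCrossedModule

/-- The biproduct of a braided group `C` in `^H_H𝓜` and `H`, on `C ⊗ H`:
`(c ⊗ h)(d ⊗ g) = c (h₁ ▷ d) ⊗ h₂ g`, `Δ(c ⊗ h) = (c₁ ⊗ c₂⁽¹⁾ h₁) ⊗ (c₂⁽²⁾ ⊗ h₂)`,
tensor product unit and counit, and `S(c ⊗ h) = (1 ⊗ S(c⁽¹⁾ h))(S c⁽²⁾ ⊗ 1)`. -/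
def leftBiproduct (𝓒 : LeftBraidedGroup k H C) : HopfData k (C ⊗[k] H) where
  mul := TensorProduct.map (LinearMap.mul' k C) (LinearMap.mul' k H) ∘ₗ
    mid (leftSwap 𝓒.toLeftCrossedModule)
  one := 1 ⊗ₜ[k] 1
  comul := mid (leftCoswap 𝓒.toLeftCrossedModule) ∘ₗ
    TensorProduct.map (Coalgebra.comul (R := k) (A := C)) (Coalgebra.comul (R := k) (A := H))
  counit := LinearMap.mul' k k ∘ₗ
    TensorProduct.map (Coalgebra.counit (R := k) (A := C)) (Coalgebra.counit (R := k) (A := H))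
  antipode := leftSwap 𝓒.toLeftCrossedModule ∘ₗ
    TensorProduct.map (HopfAlgebra.antipode k (A := H)) 𝓒.antipode ∘ₗ
    leftCoswap 𝓒.toLeftCrossedModule

/-! ### Pairing and compatibility -/

/-- The pairing `(c ⊗ d) ⊗ (a ⊗ b) ↦ ⟨c, a⟩ ⟨d, b⟩`. -/
def pairTwo (p : C ⊗[k] B →ₗ[k] k) : (C ⊗[k] C) ⊗[k] (B ⊗[k] B) →ₗ[k] k :=
  LinearMap.mul' k k ∘ₗ TensorProduct.map p p ∘ₗ flipMid

/-- A braided skew-pairing `⟨c, b⟩ = p (c ⊗ b)` between `C` in `^H_H𝓜` and `B` in `𝓜^H_H`: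
* `⟨h ▷ c, b⟩ = ⟨c, b ◁ h⟩`;
* `⟨c, a b⟩ = ⟨c₁, b⁽¹⁾⟩ ⟨c₂, a ◁ b⁽²⁾⟩` (`b⁽¹⁾ ⊗ a ◁ b⁽²⁾` is the braiding of `a ⊗ b`);
* `⟨c d, b⟩ = ⟨c, b₁⟩ ⟨d, b₂⟩`;
* `⟨c, 1⟩ = ε(c)` and `⟨1, b⟩ = ε(b)`;
* `⟨S c, S b⟩ = ⟨c, b⟩`, which for invertible braided antipode of `B` is the same as
  `⟨S c, b⟩ = ⟨c, S⁻¹ b⟩`. -/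
structure IsBraidedSkewPairing (𝓑 : RightBraidedGroup k H B) (𝓒 : LeftBraidedGroup k H C)
    (p : C ⊗[k] B →ₗ[k] k) : Prop where
  act : ∀ (h : H) (c : C) (b : B),
    p (𝓒.act (h ⊗ₜ[k] c) ⊗ₜ[k] b) = p (c ⊗ₜ[k] 𝓑.act (b ⊗ₜ[k] h))
  pair_mul : ∀ (c : C) (a b : B),
    p (c ⊗ₜ[k] (a * b)) =
      pairTwo p (Coalgebra.comul (R := k) c ⊗ₜ[k]
        rightBraiding 𝓑.toRightCrossedModule 𝓑.toRightCrossedModule (a ⊗ₜ[k] b))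
  mul_pair : ∀ (c d : C) (b : B),
    p ((c * d) ⊗ₜ[k] b) = pairTwo p ((c ⊗ₜ[k] d) ⊗ₜ[k] Coalgebra.comul (R := k) b)
  pair_one : ∀ c : C, p (c ⊗ₜ[k] 1) = Coalgebra.counit (R := k) c
  one_pair : ∀ b : B, p (1 ⊗ₜ[k] b) = Coalgebra.counit (R := k) b
  antipode : ∀ (c : C) (b : B),
    p (𝓒.antipode c ⊗ₜ[k] 𝓑.antipode b) = p (c ⊗ₜ[k] b)

/-- The compatibility condition `b⁽¹⁾ ◁ c⁽¹⁾ ⊗ b⁽²⁾ ▷ c⁽²⁾ = b ⊗ c`. -/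
def Compatible (𝓑 : RightBraidedGroup k H B) (𝓒 : LeftBraidedGroup k H C) : Prop :=
  ∀ (b : B) (c : C),
    TensorProduct.map 𝓑.act 𝓒.act (flipMid (𝓑.coact b ⊗ₜ[k] 𝓒.coact c)) = b ⊗ₜ[k] c

/-! ### The double biproduct -/

variable (k H B C) in
/-- The canonical inclusion `h ⊗ b ↦ 1 ⊗ h ⊗ b`. -/
def inclHB : H ⊗[k] B →ₗ[k] C ⊗[k] (H ⊗[k] B) :=
  TensorProduct.mk k C (H ⊗[k] B) 1

variable (k H B C) in
/-- The canonical inclusion `c ⊗ h ↦ c ⊗ h ⊗ 1`. -/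
def inclCH : C ⊗[k] H →ₗ[k] C ⊗[k] (H ⊗[k] B) :=
  LinearMap.lTensor C ((TensorProduct.mk k H B).flip 1)

variable (k H B C) in
/-- The canonical inclusion `b ↦ 1 ⊗ 1 ⊗ b`. -/
def inclB : B →ₗ[k] C ⊗[k] (H ⊗[k] B) :=
  inclHB k H B C ∘ₗ TensorProduct.mk k H B 1

variable (k H B C) in
/-- The canonical inclusion `h ↦ 1 ⊗ h ⊗ 1`. -/
def inclH : H →ₗ[k] C ⊗[k] (H ⊗[k] B) :=
  inclHB k H B C ∘ₗ (TensorProduct.mk k H B).flip 1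

variable (k H B C) in
/-- The canonical inclusion `c ↦ c ⊗ 1 ⊗ 1`. -/
def inclC : C →ₗ[k] C ⊗[k] (H ⊗[k] B) :=
  inclCH k H B C ∘ₗ (TensorProduct.mk k C H).flip 1

/-- The linear map `(x ⊗ h) ⊗ (c ⊗ d) ↦ ⟨c, x⟩ h · d`, product in `s`. -/
def crossLeft (p : C ⊗[k] B →ₗ[k] k) (s : HopfData k (C ⊗[k] (H ⊗[k] B))) :
    (B ⊗[k] H) ⊗[k] (C ⊗[k] C) →ₗ[k] C ⊗[k] (H ⊗[k] B) :=
  (TensorProduct.lid k (C ⊗[k] (H ⊗[k] B))).toLinearMap ∘ₗ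
    TensorProduct.map (p ∘ₗ (TensorProduct.comm k B C).toLinearMap)
      (s.mul ∘ₗ TensorProduct.map (inclH k H B C) (inclC k H B C)) ∘ₗ
    flipMid

/-- The linear map `(x ⊗ y) ⊗ (g ⊗ d) ↦ x · g ⟨S d, y⟩`, product in `s`, with `S` the braided
antipode of `C`. -/
def crossRight (𝓒 : LeftBraidedGroup k H C) (p : C ⊗[k] B →ₗ[k] k)
    (s : HopfData k (C ⊗[k] (H ⊗[k] B))) :
    (B ⊗[k] B) ⊗[k] (H ⊗[k] C) →ₗ[k] C ⊗[k] (H ⊗[k] B) :=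
  (TensorProduct.rid k (C ⊗[k] (H ⊗[k] B))).toLinearMap ∘ₗ
    TensorProduct.map (s.mul ∘ₗ TensorProduct.map (inclB k H B C) (inclH k H B C))
      (p ∘ₗ LinearMap.rTensor B 𝓒.antipode ∘ₗ (TensorProduct.comm k B C).toLinearMap) ∘ₗ
    flipMid

/-- The right-hand side of the cross relation, with products taken in `s`:
`⟨c₁, b₁⁽¹⁾⟩ b₁⁽²⁾ c₂ b₂ c₃⁽¹⁾ ⟨S c₃⁽²⁾, b₃⟩`. It is obtained from
`(b₁⁽¹⁾ ⊗ b₁⁽²⁾) ⊗ (b₂ ⊗ b₃)` and `(c₁ ⊗ c₂) ⊗ (c₃⁽¹⁾ ⊗ c₃⁽²⁾)`. -/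
def crossProduct (𝓑 : RightBraidedGroup k H B) (𝓒 : LeftBraidedGroup k H C)
    (p : C ⊗[k] B →ₗ[k] k) (s : HopfData k (C ⊗[k] (H ⊗[k] B))) (b : B) (c : C) :
    C ⊗[k] (H ⊗[k] B) :=
  s.mul (TensorProduct.map (crossLeft p s) (crossRight 𝓒 p s)
    (flipMid
      (TensorProduct.map 𝓑.coact (Coalgebra.comul (R := k) (A := B))
          (Coalgebra.comul (R := k) b) ⊗ₜ[k]
        TensorProduct.map (Coalgebra.comul (R := k) (A := C)) 𝓒.coact
          (Coalgebra.comul (R := k) c))))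

/-- `s` is a double biproduct structure on `C ⊗ H ⊗ B`: a Hopf algebra containing both
biproducts as sub-Hopf algebras by the canonical inclusions, in which `c ⊗ h ⊗ b` is the
product `c h b`, and in which the cross relations hold. -/
structure IsDoubleBiproduct (𝓑 : RightBraidedGroup k H B) (𝓒 : LeftBraidedGroup k H C)
    (p : C ⊗[k] B →ₗ[k] k) (s : HopfData k (C ⊗[k] (H ⊗[k] B))) : Prop where
  isHopf : s.IsHopf
  right_sub : (rightBiproduct 𝓑).IsSubHopf s (inclHB k H B C)
  left_sub : (leftBiproduct 𝓒).IsSubHopf s (inclCH k H B C)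
  triangular : ∀ (c : C) (h : H) (b : B),
    s.mul (s.mul (inclC k H B C c ⊗ₜ[k] inclH k H B C h) ⊗ₜ[k] inclB k H B C b) =
      c ⊗ₜ[k] (h ⊗ₜ[k] b)
  cross : ∀ (b : B) (c : C),
    s.mul (inclB k H B C b ⊗ₜ[k] inclC k H B C c) = crossProduct 𝓑 𝓒 p s b c

end Main

end DoubleBiproduct

end

open scoped TensorProduct

noncomputable section

namespace DoubleBiproduct

/-! ### Sweedler calculus for sums over a tensor -/

section Sweedler

variable {k : Type*} [CommSemiring k]

/-! The double biproduct is a cocycle twist of a simpler Hopf-type object in which `B` and `C`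
commute.

Write `A = H ⋉ B`. It is a Hopf algebra with an inclusion `i : H → A` and a bialgebra projection `π
: A → H`, and `π ∘ i = id`. Let `A` act on `C` through `π`, and push the coaction of `C` forward
along `i`. The compatibility condition is exactly what is needed to straighten the crossed-module
axiom over `A` into the one over `H` (`Compatible.isCrossedAlong`). Because `π ∘ i = id`, the
braiding of `C` with itself does not change (`leftBraiding_extend`), so `C` is a braided group over
`A`. Its biproduct `K = C ⋊ A` (`Ambient`) contains both `A` and `C ⋊ H`, and in it `bc = cb`.

The pairing enters as the functional `σ(x ⊗ y) = ⟨y_C, x_B⟩` on `K ⊗ K`, with `x_B`, `y_C` the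
coalgebra projections to `B` and `C`. The multiplicativity of the pairing in each variable makes `σ`
a 2-cocycle (`form_cocycle`), with convolution inverse `⟨S y_C, x_B⟩`. `Double` is the twist of `K`:
the same coalgebra, with product `σ(x₁ ⊗ y₁) x₂ y₂ σ⁻¹(x₃ ⊗ y₃)`. Now `σ` is trivial if the left
argument lies in `C ⋊ H` or the right one in `H ⋉ B`, so both remain sub-bialgebras and `c h b` is
not changed by the twist. Only `bc` changes, and expanding its twisted product gives the stated
cross relation (`Double.cross`). The antipode is `S(d a) = S(a) S(d)` for `d ∈ C ⋊ H` and `a ∈ H ⋉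
B`.

For uniqueness, the two subalgebras, the factorisation `c h b` and the cross relation determine all
products by associativity (`IsDoubleBiproduct.mulAt`). Coproduct and counit are multiplicative and
known on the two subalgebras, and the antipode is the convolution inverse of the identity.

All computations are done in Sweedler notation: `sw t F` is the sum of `F v w` over a chosen
decomposition of `t`, and the linearity of `F` in each slot is the side condition `Lin`, left to
`fun_prop`. -/

/-- `f` is the underlying function of a `k`-linear map. -/
@[fun_prop]
structure Lin (k : Type*) [CommSemiring k] {V W : Type*} [AddCommMonoid V] [Module k V]
    [AddCommMonoid W] [Module k W] (f : V → W) : Prop where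
  add : ∀ x y, f (x + y) = f x + f y
  smul : ∀ (c : k) x, f (c • x) = c • f x

variable {U V W X Y : Type*} [AddCommMonoid U] [AddCommMonoid V] [AddCommMonoid W]
  [AddCommMonoid X] [AddCommMonoid Y] [Module k U] [Module k V] [Module k W] [Module k X]
  [Module k Y]
variable {A : Type*} [Semiring A] [Algebra k A]

namespace Lin

@[fun_prop]
theorem id : Lin k (fun x : V => x) := ⟨fun _ _ => rfl, fun _ _ => rfl⟩

@[fun_prop]
theorem comp {g : W → X} {f : V → W} (hg : Lin k g) (hf : Lin k f) : Lin k (fun x => g (f x)) :=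
  ⟨fun x y => by rw [hf.add, hg.add], fun c x => by rw [hf.smul, hg.smul]⟩

@[fun_prop]
theorem linearMap (f : V →ₗ[k] W) : Lin k (fun x => f x) := ⟨map_add f, map_smul f⟩

@[fun_prop]
theorem linearEquiv (f : V ≃ₗ[k] W) : Lin k (fun x => f x) := ⟨map_add f, map_smul f⟩

@[fun_prop]
theorem algHom {A' : Type*} [Semiring A'] [Algebra k A'] (f : A →ₐ[k] A') :
    Lin k (fun x => f x) := ⟨map_add f, map_smul f⟩

@[fun_prop]
theorem tmul_left {f : U → V} (hf : Lin k f) (w : W) : Lin k (fun x => f x ⊗ₜ[k] w) :=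
  ⟨fun x y => by rw [hf.add, TensorProduct.add_tmul],
    fun c x => by rw [hf.smul, TensorProduct.smul_tmul']⟩

@[fun_prop]
theorem tmul_right {f : U → W} (hf : Lin k f) (v : V) : Lin k (fun x => v ⊗ₜ[k] f x) :=
  ⟨fun x y => by rw [hf.add, TensorProduct.tmul_add],
    fun c x => by rw [hf.smul, TensorProduct.tmul_smul]⟩

@[fun_prop]
theorem mul_left {f : U → A} (hf : Lin k f) (a : A) : Lin k (fun x => f x * a) :=
  ⟨fun x y => by rw [hf.add, add_mul], fun c x => by rw [hf.smul, smul_mul_assoc]⟩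

@[fun_prop]
theorem mul_right {f : U → A} (hf : Lin k f) (a : A) : Lin k (fun x => a * f x) :=
  ⟨fun x y => by rw [hf.add, mul_add], fun c x => by rw [hf.smul, mul_smul_comm]⟩

@[fun_prop]
theorem smul_left {f : U → k} (hf : Lin k f) (a : V) : Lin k (fun x => f x • a) :=
  ⟨fun x y => by rw [hf.add, add_smul], fun c x => by rw [hf.smul, smul_assoc]⟩

@[fun_prop]
theorem smul_right {f : U → V} (hf : Lin k f) (a : k) : Lin k (fun x => a • f x) :=
  ⟨fun x y => by rw [hf.add, smul_add], fun c x => by rw [hf.smul, smul_comm]⟩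

/-- The linear map with underlying function `f`. -/
def toLinearMap {f : V → W} (hf : Lin k f) : V →ₗ[k] W where
  toFun := f
  map_add' := hf.add
  map_smul' := hf.smul

end Lin

/-- The linear map on a tensor product induced by a function linear in each argument. -/
def ofBilin (F : V → W → X) (h₁ : ∀ w, Lin k (fun v => F v w)) (h₂ : ∀ v, Lin k (fun w => F v w)) :
    V ⊗[k] W →ₗ[k] X :=
  TensorProduct.lift (LinearMap.mk₂ k F (fun a b w => (h₁ w).add a b)
    (fun c a w => (h₁ w).smul c a) (fun v a b => (h₂ v).add a b) (fun c v a => (h₂ v).smul c a))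

@[simp]
theorem ofBilin_tmul (F : V → W → X) (h₁ : ∀ w, Lin k (fun v => F v w))
    (h₂ : ∀ v, Lin k (fun w => F v w)) (v : V) (w : W) : ofBilin F h₁ h₂ (v ⊗ₜ[k] w) = F v w := by
  simp [ofBilin]

/-- Sweedler notation: `sw t F = ∑ F v w` where `t = ∑ v ⊗ w`. -/
def sw (t : V ⊗[k] W) (F : V → W → X) : X :=
  ∑ i ∈ (TensorProduct.exists_finset t).choose, F i.1 i.2

/-- Read from right to left, this expands a coproduct or coaction inside a larger expression; linear
maps are then pushed through the sum. -/
theorem sw_tmul_eq (t : V ⊗[k] W) : sw t (fun v w => v ⊗ₜ[k] w) = t :=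
  (TensorProduct.exists_finset t).choose_spec.symm

theorem lin_sw (f : X → Y) (hf : Lin k f) (t : V ⊗[k] W) (F : V → W → X) :
    f (sw t F) = sw t (fun v w => f (F v w)) := by
  change hf.toLinearMap (sw t F) = _
  simp only [sw, map_sum]
  rfl

theorem map_sw (f : X →ₗ[k] Y) (t : V ⊗[k] W) (F : V → W → X) :
    f (sw t F) = sw t (fun v w => f (F v w)) := lin_sw (k := k) _ (by fun_prop) t F

theorem equiv_sw (f : X ≃ₗ[k] Y) (t : V ⊗[k] W) (F : V → W → X) :
    f (sw t F) = sw t (fun v w => f (F v w)) := lin_sw (k := k) _ (by fun_prop) t F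

theorem algHom_sw {A' : Type*} [Semiring A'] [Algebra k A'] (f : A →ₐ[k] A') (t : V ⊗[k] W)
    (F : V → W → A) : f (sw t F) = sw t (fun v w => f (F v w)) :=
  lin_sw (k := k) _ (by fun_prop) t F

theorem sw_tmul (t : V ⊗[k] W) (F : V → W → X) (y : Y) :
    sw t F ⊗ₜ[k] y = sw t (fun v w => F v w ⊗ₜ[k] y) :=
  lin_sw (k := k) (fun x => x ⊗ₜ[k] y) (by fun_prop) t F

theorem tmul_sw (t : V ⊗[k] W) (F : V → W → X) (y : Y) :
    y ⊗ₜ[k] sw t F = sw t (fun v w => y ⊗ₜ[k] F v w) :=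
  lin_sw (k := k) (fun x => y ⊗ₜ[k] x) (by fun_prop) t F

theorem sw_mul (t : V ⊗[k] W) (F : V → W → A) (y : A) :
    sw t F * y = sw t (fun v w => F v w * y) :=
  lin_sw (k := k) (fun x => x * y) (by fun_prop) t F

theorem mul_sw (t : V ⊗[k] W) (F : V → W → A) (y : A) :
    y * sw t F = sw t (fun v w => y * F v w) :=
  lin_sw (k := k) (fun x => y * x) (by fun_prop) t F

theorem smul_sw (t : V ⊗[k] W) (F : V → W → X) (c : k) :
    c • sw t F = sw t (fun v w => c • F v w) :=
  lin_sw (k := k) (fun x => c • x) (by fun_prop) t F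

theorem sw_smul (t : V ⊗[k] W) (F : V → W → k) (x : X) :
    sw t F • x = sw t (fun v w => F v w • x) :=
  lin_sw (k := k) (fun c => c • x) (by fun_prop) t F

/-- Specialised to one tensor, as in `sw_comm (Δ b)`, this is a rewrite rule that moves that single
sum inwards, and so brings nested sums to a common order. -/
theorem sw_comm {V' W' Z : Type*} [AddCommMonoid Z] [AddCommMonoid V'] [AddCommMonoid W'] [Module k V'] [Module k W']
    (t : V ⊗[k] W) (s : V' ⊗[k] W') (F : V → W → V' → W' → Z) :
    sw t (fun a b => sw s (fun c d => F a b c d)) =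
      sw s (fun c d => sw t (fun a b => F a b c d)) := Finset.sum_comm

theorem sw_congr {Z : Type*} [AddCommMonoid Z] {t : V ⊗[k] W} {F G : V → W → Z}
    (h : ∀ v w, F v w = G v w) : sw t F = sw t G :=
  Finset.sum_congr rfl fun _ _ => h _ _

theorem map_eq_sw (f : V ⊗[k] W →ₗ[k] X) (t : V ⊗[k] W) :
    f t = sw t (fun v w => f (v ⊗ₜ[k] w)) := by
  rw [← map_sw, sw_tmul_eq]

theorem ofBilin_apply (F : V → W → X) (h₁ : ∀ w, Lin k (fun v => F v w))
    (h₂ : ∀ v, Lin k (fun w => F v w)) (t : V ⊗[k] W) : ofBilin F h₁ h₂ t = sw t F := by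
  rw [map_eq_sw]; simp only [ofBilin_tmul]

@[fun_prop]
theorem Lin.sw_left (F : V → W → X) (h₁ : ∀ w, Lin k (fun v => F v w))
    (h₂ : ∀ v, Lin k (fun w => F v w)) : Lin k (fun t : V ⊗[k] W => sw t F) := by
  simp only [← ofBilin_apply F h₁ h₂]
  fun_prop

@[fun_prop]
theorem Lin.sw_right (t : V ⊗[k] W) (F : U → V → W → X) (h : ∀ v w, Lin k (fun u => F u v w)) :
    Lin k (fun u => sw t (fun v w => F u v w)) :=
  ⟨fun x y => by simp only [sw, (h _ _).add, Finset.sum_add_distrib],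
    fun c x => by simp only [sw, (h _ _).smul, Finset.smul_sum]⟩

/-- The decomposition behind `sw` is an arbitrary choice, and bilinearity of `F` is what makes the
value independent of it. Identities of finite sums, such as `sw_comm` and `lin_sw`, hold for any
`F`. -/
theorem sw_pure (v : V) (w : W) (F : V → W → X) (h₁ : ∀ w, Lin k (fun v => F v w))
    (h₂ : ∀ v, Lin k (fun w => F v w)) : sw (v ⊗ₜ[k] w) F = F v w := by
  rw [← ofBilin_apply F h₁ h₂, ofBilin_tmul]

theorem sw_sw {V' W' : Type*} [AddCommMonoid V'] [AddCommMonoid W'] [Module k V'] [Module k W']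
    (t : V ⊗[k] W) (G : V → W → V' ⊗[k] W') (F : V' → W' → X) (h₁ : ∀ w, Lin k (fun v => F v w))
    (h₂ : ∀ v, Lin k (fun w => F v w)) :
    sw (sw t G) F = sw t (fun v w => sw (G v w) F) :=
  lin_sw (k := k) (fun s => sw s F) (by fun_prop) t G

/-! ### Coalgebras -/

section Coalgebra

variable {D : Type*} [AddCommMonoid D] [Module k D] [Coalgebra k D]

local notation "Δ" => Coalgebra.comul (R := k)
local notation "ε" => Coalgebra.counit (R := k)

/-- The trilinear evaluation `a ⊗ (b ⊗ c) ↦ F a b c` is applied to both sides of coassociativity.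
The comodule versions `sw_coact_coassoc` below are obtained in the same way. -/
theorem sw_coassoc (x : D) (F : D → D → D → X) (h₁ : ∀ b c, Lin k (fun a => F a b c))
    (h₂ : ∀ a c, Lin k (fun b => F a b c)) (h₃ : ∀ a b, Lin k (fun c => F a b c)) :
    sw (Δ x) (fun a b => sw (Δ a) (fun c d => F c d b)) =
      sw (Δ x) (fun a b => sw (Δ b) (fun c d => F a c d)) := by
  have := congrArg (fun t => sw t fun a s => sw s fun b c => F a b c) (Coalgebra.coassoc_apply (R := k) x)
  beta_reduce at this
  rw [← sw_tmul_eq (Δ x)] at this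
  simp only [map_sw, LinearMap.rTensor_tmul, LinearMap.lTensor_tmul] at this
  simp (disch := fun_prop) only [sw_sw, sw_pure] at this
  have key : ∀ (t : D ⊗[k] D) (b : D), sw (TensorProduct.assoc k D D D (t ⊗ₜ[k] b))
      (fun a s => sw s fun b c => F a b c) = sw t fun c d => F c d b := fun t b => by
    conv_lhs => rw [← sw_tmul_eq t]
    rw [sw_tmul, equiv_sw]
    simp (disch := fun_prop) only [sw_sw, TensorProduct.assoc_tmul, sw_pure]
  rw [← this, equiv_sw]
  simp (disch := fun_prop) only [sw_sw, key]

theorem sw_counit_left (x : D) (F : D → X) (hF : Lin k F) :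
    sw (Δ x) (fun a b => ε a • F b) = F x := by
  have := congrArg (fun t => sw t fun (a : k) b => a • F b) (Coalgebra.rTensor_counit_comul (R := k) x)
  beta_reduce at this
  rw [← sw_tmul_eq (Δ x)] at this
  simp only [map_sw, LinearMap.rTensor_tmul] at this
  simpa (disch := fun_prop) only [sw_sw, sw_pure, one_smul] using this

theorem sw_counit_right (x : D) (F : D → X) (hF : Lin k F) :
    sw (Δ x) (fun a b => ε b • F a) = F x := by
  have := congrArg (fun t => sw t fun b (a : k) => a • F b) (Coalgebra.lTensor_counit_comul (R := k) x)
  beta_reduce at this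
  rw [← sw_tmul_eq (Δ x)] at this
  simp only [map_sw, LinearMap.lTensor_tmul] at this
  simpa (disch := fun_prop) only [sw_sw, sw_pure, one_smul] using this

end Coalgebra

end Sweedler

/-! ### Right crossed modules and braided groups in Sweedler notation -/

section RightSweedler

variable {k H : Type*} [Field k] [Ring H] [HopfAlgebra k H]

local notation "Δ" => Coalgebra.comul (R := k)
local notation "ε" => Coalgebra.counit (R := k)

namespace RightCrossedModule

variable {V X : Type*} [AddCommGroup V] [Module k V] [AddCommGroup X] [Module k X]
variable (𝓥 : RightCrossedModule k H V)

theorem sw_coact_counit (v : V) (F : V → X) (hF : Lin k F) :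
    sw (𝓥.coact v) (fun u g => ε g • F u) = F v := by
  have := congrArg (fun t => sw t fun u (a : k) => a • F u) (𝓥.coact_counit v)
  beta_reduce at this
  rw [← sw_tmul_eq (𝓥.coact v)] at this
  simp only [map_sw, LinearMap.lTensor_tmul] at this
  simpa (disch := fun_prop) only [sw_sw, sw_pure, one_smul] using this

theorem sw_coact_coassoc (v : V) (F : V → H → H → X) (h₁ : ∀ b c, Lin k (fun a => F a b c))
    (h₂ : ∀ a c, Lin k (fun b => F a b c)) (h₃ : ∀ a b, Lin k (fun c => F a b c)) :
    sw (𝓥.coact v) (fun a b => sw (𝓥.coact a) (fun c d => F c d b)) =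
      sw (𝓥.coact v) (fun a b => sw (Δ b) (fun c d => F a c d)) := by
  have := congrArg (fun t => sw t fun a s => sw s fun b c => F a b c) (𝓥.coact_coassoc v)
  beta_reduce at this
  rw [← sw_tmul_eq (𝓥.coact v)] at this
  simp only [map_sw, LinearMap.rTensor_tmul, LinearMap.lTensor_tmul] at this
  simp (disch := fun_prop) only [sw_sw, sw_pure] at this
  have key : ∀ (t : V ⊗[k] H) (b : H), sw (TensorProduct.assoc k V H H (t ⊗ₜ[k] b))
      (fun a s => sw s fun b c => F a b c) = sw t fun c d => F c d b := fun t b => by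
    conv_lhs => rw [← sw_tmul_eq t]
    rw [sw_tmul, equiv_sw]
    simp (disch := fun_prop) only [sw_sw, TensorProduct.assoc_tmul, sw_pure]
  rw [← this, equiv_sw]
  simp (disch := fun_prop) only [sw_sw, key]

theorem sw_crossed (v : V) (h : H) (F : V → H → X) (h₁ : ∀ b, Lin k (fun a => F a b))
    (h₂ : ∀ a, Lin k (fun b => F a b)) :
    sw (𝓥.coact v) (fun u g => sw (Δ h) fun h₁ h₂ => F (𝓥.act (u ⊗ₜ[k] h₁)) (g * h₂)) =
      sw (Δ h) fun h₁ h₂ => sw (𝓥.coact (𝓥.act (v ⊗ₜ[k] h₂))) fun w g => F w (h₁ * g) := by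
  have := congrArg (fun t => sw t F) (𝓥.crossed v h)
  beta_reduce at this
  rw [← sw_tmul_eq (𝓥.coact v), ← sw_tmul_eq (Δ h)] at this
  have key : ∀ (t : V ⊗[k] H) (h : H), sw (LinearMap.lTensor V (LinearMap.mul' k H)
      (TensorProduct.leftComm k H V H (h ⊗ₜ[k] t))) F = sw t fun w g => F w (h * g) :=
    fun t h => by
      conv_lhs => rw [← sw_tmul_eq t]
      simp (disch := fun_prop) only [tmul_sw, equiv_sw, map_sw, sw_sw,
        TensorProduct.leftComm_tmul, LinearMap.lTensor_tmul, sw_pure, LinearMap.mul'_apply]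
  rw [sw_comm]
  simpa (disch := fun_prop) only [sw_tmul, tmul_sw, map_sw, equiv_sw, sw_sw, flipMid,
    LinearEquiv.coe_coe, TensorProduct.tensorTensorTensorComm_tmul, TensorProduct.map_tmul,
    LinearMap.mul'_apply, sw_pure, TensorProduct.leftComm_tmul, LinearMap.lTensor_tmul,
    LinearMap.comp_apply, key] using this

end RightCrossedModule

namespace RightBraidedGroup

variable {B X : Type*} [Ring B] [Algebra k B] [Coalgebra k B] [AddCommGroup X] [Module k X]
variable (𝓑 : RightBraidedGroup k H B)

theorem mul_act (a b : B) (h : H) :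
    𝓑.act ((a * b) ⊗ₜ[k] h) = sw (Δ h) fun h₁ h₂ => 𝓑.act (a ⊗ₜ[k] h₁) * 𝓑.act (b ⊗ₜ[k] h₂) := by
  have := LinearMap.congr_fun 𝓑.mul_hom.1 ((a ⊗ₜ[k] b) ⊗ₜ[k] h)
  simp only [rightTensorAct, LinearMap.comp_apply, LinearMap.rTensor_tmul, LinearMap.mul'_apply,
    LinearMap.lTensor_tmul] at this
  rw [← this, ← sw_tmul_eq (Δ h)]
  simp (disch := fun_prop) only [tmul_sw, map_sw, sw_sw, flipMid,
    LinearEquiv.coe_coe, TensorProduct.tensorTensorTensorComm_tmul, TensorProduct.map_tmul,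
    LinearMap.mul'_apply, sw_pure]

theorem one_act (h : H) : 𝓑.act ((1 : B) ⊗ₜ[k] h) = ε h • 1 := by
  have := LinearMap.congr_fun 𝓑.unit_hom.1 ((1 : k) ⊗ₜ[k] h)
  simpa [rightUnitAct, Algebra.algebraMap_eq_smul_one, eq_comm] using this

theorem coact_one : 𝓑.coact (1 : B) = 1 ⊗ₜ[k] 1 := by
  have := LinearMap.congr_fun 𝓑.unit_hom.2 (1 : k)
  simpa [rightUnitCoact, Algebra.algebraMap_eq_smul_one, eq_comm] using this

theorem sw_coact_mul (a b : B) (F : B → H → X) (h₁ : ∀ b, Lin k (fun a => F a b))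
    (h₂ : ∀ a, Lin k (fun b => F a b)) :
    sw (𝓑.coact (a * b)) F =
      sw (𝓑.coact a) fun u g => sw (𝓑.coact b) fun w h => F (u * w) (g * h) := by
  have := LinearMap.congr_fun 𝓑.mul_hom.2 (a ⊗ₜ[k] b)
  simp only [rightTensorCoact, LinearMap.comp_apply, TensorProduct.map_tmul,
    LinearMap.mul'_apply] at this
  rw [this, ← sw_tmul_eq (𝓑.coact a), ← sw_tmul_eq (𝓑.coact b)]
  simp (disch := fun_prop) only [sw_tmul, tmul_sw, map_sw, sw_sw, flipMid,
    LinearEquiv.coe_coe, TensorProduct.tensorTensorTensorComm_tmul, LinearMap.lTensor_tmul,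
    LinearMap.rTensor_tmul, LinearMap.mul'_apply, sw_pure]
  rw [sw_comm]

theorem sw_comul_act (b : B) (h : H) (F : B → B → X) (h₁ : ∀ b, Lin k (fun a => F a b))
    (h₂ : ∀ a, Lin k (fun b => F a b)) :
    sw (Δ (𝓑.act (b ⊗ₜ[k] h))) F = sw (Δ b) fun b₁ b₂ => sw (Δ h) fun h₁ h₂ =>
      F (𝓑.act (b₁ ⊗ₜ[k] h₁)) (𝓑.act (b₂ ⊗ₜ[k] h₂)) := by
  have := LinearMap.congr_fun 𝓑.comul_hom.1 (b ⊗ₜ[k] h)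
  simp only [rightTensorAct, LinearMap.comp_apply, LinearMap.rTensor_tmul,
    LinearMap.lTensor_tmul] at this
  rw [this, ← sw_tmul_eq (Δ b), ← sw_tmul_eq (Δ h)]
  simp (disch := fun_prop) only [sw_tmul, tmul_sw, map_sw, sw_sw, flipMid,
    LinearEquiv.coe_coe, TensorProduct.tensorTensorTensorComm_tmul, TensorProduct.map_tmul,
    sw_pure]
  rw [sw_comm]

theorem sw_coact_comul (b : B) (F : B → B → H → X) (h₁ : ∀ b c, Lin k (fun a => F a b c))
    (h₂ : ∀ a c, Lin k (fun b => F a b c)) (h₃ : ∀ a b, Lin k (fun c => F a b c)) :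
    sw (𝓑.coact b) (fun u g => sw (Δ u) fun u₁ u₂ => F u₁ u₂ g) =
      sw (Δ b) fun b₁ b₂ => sw (𝓑.coact b₁) fun u g => sw (𝓑.coact b₂) fun w h =>
        F u w (g * h) := by
  have := congrArg (fun t => sw t fun s g => sw s fun u w => F u w g)
    (LinearMap.congr_fun 𝓑.comul_hom.2 b)
  beta_reduce at this
  simp only [rightTensorCoact, LinearMap.comp_apply] at this
  rw [← sw_tmul_eq (𝓑.coact b), ← sw_tmul_eq (Δ b)] at this
  have key : ∀ (s t : B ⊗[k] H), (sw (LinearMap.lTensor (B ⊗[k] B) (LinearMap.mul' k H)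
      (flipMid (s ⊗ₜ[k] t))) fun s g => sw s fun u w => F u w g) =
      sw s fun u g => sw t fun w h => F u w (g * h) := fun s t => by
    conv_lhs => rw [← sw_tmul_eq t, ← sw_tmul_eq s]
    simp (disch := fun_prop) only [sw_tmul, tmul_sw, map_sw, sw_sw, flipMid,
      LinearEquiv.coe_coe, TensorProduct.tensorTensorTensorComm_tmul, LinearMap.lTensor_tmul,
      LinearMap.mul'_apply, sw_pure]
    rw [sw_comm]
  simpa (disch := fun_prop) only [map_sw, sw_sw, TensorProduct.map_tmul, LinearMap.rTensor_tmul,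
    key, sw_pure, eq_comm] using this

theorem counit_act (b : B) (h : H) : ε (𝓑.act (b ⊗ₜ[k] h)) = ε b * ε h := by
  have := LinearMap.congr_fun 𝓑.counit_hom.1 (b ⊗ₜ[k] h)
  simpa [rightUnitAct] using this

theorem sw_coact_counit' (b : B) (F : H → X) (hF : Lin k F) :
    sw (𝓑.coact b) (fun u g => ε u • F g) = ε b • F 1 := by
  have := congrArg (fun t => sw t fun (a : k) g => a • F g)
    (LinearMap.congr_fun 𝓑.counit_hom.2 b)
  beta_reduce at this
  simp only [rightUnitCoact, LinearMap.comp_apply] at this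
  rw [← sw_tmul_eq (𝓑.coact b)] at this
  simpa (disch := fun_prop) only [map_sw, sw_sw, LinearMap.flip_apply, TensorProduct.mk_apply,
    LinearMap.rTensor_tmul, sw_pure, eq_comm] using this

theorem sw_comul_mul (a b : B) (F : B → B → X) (h₁ : ∀ b, Lin k (fun a => F a b))
    (h₂ : ∀ a, Lin k (fun b => F a b)) :
    sw (Δ (a * b)) F = sw (Δ a) fun a₁ a₂ => sw (Δ b) fun b₁ b₂ => sw (𝓑.coact b₁) fun u g =>
      F (a₁ * u) (𝓑.act (a₂ ⊗ₜ[k] g) * b₂) := by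
  rw [𝓑.comul_mul a b]
  conv_lhs => rw [← sw_tmul_eq (Δ a), ← sw_tmul_eq (Δ b)]
  simp only [sw_tmul, tmul_sw, map_sw]
  rw [sw_comm]
  simp (disch := fun_prop) only [sw_sw]
  refine sw_congr fun a₁ a₂ => sw_congr fun b₁ b₂ => ?_
  simp only [mid, rightBraiding, LinearMap.comp_apply, LinearEquiv.coe_coe,
    TensorProduct.assoc_tmul, LinearMap.lTensor_tmul, TensorProduct.assoc_symm_tmul,
    LinearMap.rTensor_tmul]
  conv_lhs => rw [← sw_tmul_eq (𝓑.coact b₁)]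
  simp (disch := fun_prop) only [sw_tmul, tmul_sw, map_sw, equiv_sw, sw_sw,
    TensorProduct.leftComm_tmul, LinearMap.lTensor_tmul, TensorProduct.assoc_tmul,
    TensorProduct.assoc_symm_tmul, TensorProduct.map_tmul, LinearMap.mul'_apply, sw_pure]

theorem sw_antipode_left (b : B) (F : B → X) (hF : Lin k F) :
    sw (Δ b) (fun b₁ b₂ => F (𝓑.antipode b₁ * b₂)) = ε b • F 1 := by
  have := 𝓑.antipode_left b
  rw [← sw_tmul_eq (Δ b)] at this
  simp only [map_sw, LinearMap.rTensor_tmul, LinearMap.mul'_apply] at this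
  rw [← lin_sw F hF, this, hF.smul]

theorem sw_antipode_right (b : B) (F : B → X) (hF : Lin k F) :
    sw (Δ b) (fun b₁ b₂ => F (b₁ * 𝓑.antipode b₂)) = ε b • F 1 := by
  have := 𝓑.antipode_right b
  rw [← sw_tmul_eq (Δ b)] at this
  simp only [map_sw, LinearMap.lTensor_tmul, LinearMap.mul'_apply] at this
  rw [← lin_sw F hF, this, hF.smul]

end RightBraidedGroup

end RightSweedler

/-! ### Left crossed modules and braided groups in Sweedler notation -/

section LeftSweedler

variable {k H : Type*} [Field k] [Ring H] [HopfAlgebra k H]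

local notation "Δ" => Coalgebra.comul (R := k)
local notation "ε" => Coalgebra.counit (R := k)

namespace LeftCrossedModule

variable {V X : Type*} [AddCommGroup V] [Module k V] [AddCommGroup X] [Module k X]
variable (𝓥 : LeftCrossedModule k H V)

theorem sw_coact_counit (v : V) (F : V → X) (hF : Lin k F) :
    sw (𝓥.coact v) (fun g u => ε g • F u) = F v := by
  have := congrArg (fun t => sw t fun (a : k) u => a • F u) (𝓥.counit_coact v)
  beta_reduce at this
  rw [← sw_tmul_eq (𝓥.coact v)] at this
  simp only [map_sw, LinearMap.rTensor_tmul] at this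
  simpa (disch := fun_prop) only [sw_sw, sw_pure, one_smul] using this

theorem sw_coact_coassoc (v : V) (F : H → H → V → X) (h₁ : ∀ b c, Lin k (fun a => F a b c))
    (h₂ : ∀ a c, Lin k (fun b => F a b c)) (h₃ : ∀ a b, Lin k (fun c => F a b c)) :
    sw (𝓥.coact v) (fun a b => sw (𝓥.coact b) (fun c d => F a c d)) =
      sw (𝓥.coact v) (fun a b => sw (Δ a) (fun c d => F c d b)) := by
  have := congrArg (fun t => sw t fun a s => sw s fun b c => F a b c) (𝓥.coact_coassoc v)
  beta_reduce at this
  rw [← sw_tmul_eq (𝓥.coact v)] at this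
  simp only [map_sw, LinearMap.rTensor_tmul, LinearMap.lTensor_tmul] at this
  simp (disch := fun_prop) only [sw_sw, sw_pure] at this
  have key : ∀ (t : H ⊗[k] H) (b : V), sw (TensorProduct.assoc k H H V (t ⊗ₜ[k] b))
      (fun a s => sw s fun b c => F a b c) = sw t fun c d => F c d b := fun t b => by
    conv_lhs => rw [← sw_tmul_eq t]
    rw [sw_tmul, equiv_sw]
    simp (disch := fun_prop) only [sw_sw, TensorProduct.assoc_tmul, sw_pure]
  rw [← this, equiv_sw]
  simp (disch := fun_prop) only [sw_sw, key]

theorem sw_crossed (h : H) (v : V) (F : H → V → X) (h₁ : ∀ b, Lin k (fun a => F a b))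
    (h₂ : ∀ a, Lin k (fun b => F a b)) :
    sw (Δ h) (fun h₁ h₂ => sw (𝓥.coact v) fun g u => F (h₁ * g) (𝓥.act (h₂ ⊗ₜ[k] u))) =
      sw (Δ h) fun h₁ h₂ => sw (𝓥.coact (𝓥.act (h₁ ⊗ₜ[k] v))) fun g u => F (g * h₂) u := by
  have := congrArg (fun t => sw t F) (𝓥.crossed h v)
  beta_reduce at this
  rw [← sw_tmul_eq (𝓥.coact v), ← sw_tmul_eq (Δ h)] at this
  have key : ∀ (t : H ⊗[k] V) (h : H), sw (LinearMap.rTensor V (LinearMap.mul' k H)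
      (TensorProduct.rightComm k H V H (t ⊗ₜ[k] h))) F = sw t fun g u => F (g * h) u :=
    fun t h => by
      conv_lhs => rw [← sw_tmul_eq t]
      simp (disch := fun_prop) only [sw_tmul, equiv_sw, map_sw, sw_sw,
        TensorProduct.rightComm_tmul, LinearMap.rTensor_tmul, sw_pure, LinearMap.mul'_apply]
  rw [sw_comm]
  simpa (disch := fun_prop) only [sw_tmul, tmul_sw, map_sw, equiv_sw, sw_sw, flipMid,
    LinearEquiv.coe_coe, TensorProduct.tensorTensorTensorComm_tmul, TensorProduct.map_tmul,
    LinearMap.mul'_apply, sw_pure, TensorProduct.rightComm_tmul, LinearMap.rTensor_tmul,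
    LinearMap.comp_apply, key] using this

end LeftCrossedModule

namespace LeftBraidedGroup

variable {C X : Type*} [Ring C] [Algebra k C] [Coalgebra k C] [AddCommGroup X] [Module k X]
variable (𝓒 : LeftBraidedGroup k H C)

theorem act_mul (h : H) (a b : C) :
    𝓒.act (h ⊗ₜ[k] (a * b)) = sw (Δ h) fun h₁ h₂ => 𝓒.act (h₁ ⊗ₜ[k] a) * 𝓒.act (h₂ ⊗ₜ[k] b) := by
  have := LinearMap.congr_fun 𝓒.mul_hom.1 (h ⊗ₜ[k] (a ⊗ₜ[k] b))
  simp only [leftTensorAct, LinearMap.comp_apply, LinearMap.lTensor_tmul, LinearMap.mul'_apply,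
    LinearMap.rTensor_tmul] at this
  rw [← this, ← sw_tmul_eq (Δ h)]
  simp (disch := fun_prop) only [sw_tmul, map_sw, sw_sw, flipMid,
    LinearEquiv.coe_coe, TensorProduct.tensorTensorTensorComm_tmul, TensorProduct.map_tmul,
    LinearMap.mul'_apply, sw_pure]

theorem act_one (h : H) : 𝓒.act (h ⊗ₜ[k] (1 : C)) = ε h • 1 := by
  have := LinearMap.congr_fun 𝓒.unit_hom.1 (h ⊗ₜ[k] (1 : k))
  simpa [leftUnitAct, Algebra.algebraMap_eq_smul_one, eq_comm] using this

theorem coact_one : 𝓒.coact (1 : C) = 1 ⊗ₜ[k] 1 := by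
  have := LinearMap.congr_fun 𝓒.unit_hom.2 (1 : k)
  simpa [leftUnitCoact, Algebra.algebraMap_eq_smul_one, eq_comm] using this

theorem sw_coact_mul (a b : C) (F : H → C → X) (h₁ : ∀ b, Lin k (fun a => F a b))
    (h₂ : ∀ a, Lin k (fun b => F a b)) :
    sw (𝓒.coact (a * b)) F =
      sw (𝓒.coact a) fun g u => sw (𝓒.coact b) fun h w => F (g * h) (u * w) := by
  have := LinearMap.congr_fun 𝓒.mul_hom.2 (a ⊗ₜ[k] b)
  simp only [leftTensorCoact, LinearMap.comp_apply, TensorProduct.map_tmul,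
    LinearMap.mul'_apply] at this
  rw [this, ← sw_tmul_eq (𝓒.coact a), ← sw_tmul_eq (𝓒.coact b)]
  simp (disch := fun_prop) only [sw_tmul, tmul_sw, map_sw, sw_sw, flipMid,
    LinearEquiv.coe_coe, TensorProduct.tensorTensorTensorComm_tmul, LinearMap.lTensor_tmul,
    LinearMap.rTensor_tmul, LinearMap.mul'_apply, sw_pure]
  rw [sw_comm]

theorem sw_comul_act (h : H) (b : C) (F : C → C → X) (h₁ : ∀ b, Lin k (fun a => F a b))
    (h₂ : ∀ a, Lin k (fun b => F a b)) :
    sw (Δ (𝓒.act (h ⊗ₜ[k] b))) F = sw (Δ h) fun h₁ h₂ => sw (Δ b) fun b₁ b₂ =>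
      F (𝓒.act (h₁ ⊗ₜ[k] b₁)) (𝓒.act (h₂ ⊗ₜ[k] b₂)) := by
  have := LinearMap.congr_fun 𝓒.comul_hom.1 (h ⊗ₜ[k] b)
  simp only [leftTensorAct, LinearMap.comp_apply, LinearMap.rTensor_tmul,
    LinearMap.lTensor_tmul] at this
  rw [this, ← sw_tmul_eq (Δ b), ← sw_tmul_eq (Δ h)]
  simp (disch := fun_prop) only [sw_tmul, tmul_sw, map_sw, sw_sw, flipMid,
    LinearEquiv.coe_coe, TensorProduct.tensorTensorTensorComm_tmul, TensorProduct.map_tmul,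
    sw_pure]
  rw [sw_comm]

theorem sw_coact_comul (b : C) (F : H → C → C → X) (h₁ : ∀ b c, Lin k (fun a => F a b c))
    (h₂ : ∀ a c, Lin k (fun b => F a b c)) (h₃ : ∀ a b, Lin k (fun c => F a b c)) :
    sw (𝓒.coact b) (fun g u => sw (Δ u) fun u₁ u₂ => F g u₁ u₂) =
      sw (Δ b) fun b₁ b₂ => sw (𝓒.coact b₁) fun g u => sw (𝓒.coact b₂) fun h w =>
        F (g * h) u w := by
  have := congrArg (fun t => sw t fun g s => sw s fun u w => F g u w)
    (LinearMap.congr_fun 𝓒.comul_hom.2 b)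
  beta_reduce at this
  simp only [leftTensorCoact, LinearMap.comp_apply] at this
  rw [← sw_tmul_eq (𝓒.coact b), ← sw_tmul_eq (Δ b)] at this
  have key : ∀ (s t : H ⊗[k] C), (sw (LinearMap.rTensor (C ⊗[k] C) (LinearMap.mul' k H)
      (flipMid (s ⊗ₜ[k] t))) fun g s => sw s fun u w => F g u w) =
      sw s fun g u => sw t fun h w => F (g * h) u w := fun s t => by
    conv_lhs => rw [← sw_tmul_eq t, ← sw_tmul_eq s]
    simp (disch := fun_prop) only [sw_tmul, tmul_sw, map_sw, sw_sw, flipMid,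
      LinearEquiv.coe_coe, TensorProduct.tensorTensorTensorComm_tmul, LinearMap.rTensor_tmul,
      LinearMap.mul'_apply, sw_pure]
    rw [sw_comm]
  simpa (disch := fun_prop) only [map_sw, sw_sw, TensorProduct.map_tmul, LinearMap.lTensor_tmul,
    key, sw_pure, eq_comm] using this

theorem counit_act (h : H) (b : C) : ε (𝓒.act (h ⊗ₜ[k] b)) = ε h * ε b := by
  have := LinearMap.congr_fun 𝓒.counit_hom.1 (h ⊗ₜ[k] b)
  simpa [leftUnitAct, mul_comm] using this

theorem sw_coact_counit' (b : C) (F : H → X) (hF : Lin k F) :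
    sw (𝓒.coact b) (fun g u => ε u • F g) = ε b • F 1 := by
  have := congrArg (fun t => sw t fun g (a : k) => a • F g)
    (LinearMap.congr_fun 𝓒.counit_hom.2 b)
  beta_reduce at this
  simp only [leftUnitCoact, LinearMap.comp_apply] at this
  rw [← sw_tmul_eq (𝓒.coact b)] at this
  simpa (disch := fun_prop) only [map_sw, sw_sw, TensorProduct.mk_apply,
    LinearMap.lTensor_tmul, sw_pure, eq_comm] using this

theorem sw_comul_mul (a b : C) (F : C → C → X) (h₁ : ∀ b, Lin k (fun a => F a b))
    (h₂ : ∀ a, Lin k (fun b => F a b)) :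
    sw (Δ (a * b)) F = sw (Δ a) fun a₁ a₂ => sw (Δ b) fun b₁ b₂ => sw (𝓒.coact a₂) fun g u =>
      F (a₁ * 𝓒.act (g ⊗ₜ[k] b₁)) (u * b₂) := by
  rw [𝓒.comul_mul a b]
  conv_lhs => rw [← sw_tmul_eq (Δ a), ← sw_tmul_eq (Δ b)]
  simp only [sw_tmul, tmul_sw, map_sw]
  rw [sw_comm]
  simp (disch := fun_prop) only [sw_sw]
  refine sw_congr fun a₁ a₂ => sw_congr fun b₁ b₂ => ?_
  simp only [mid, leftBraiding, LinearMap.comp_apply, LinearEquiv.coe_coe,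
    TensorProduct.assoc_tmul, LinearMap.lTensor_tmul, TensorProduct.assoc_symm_tmul,
    LinearMap.rTensor_tmul]
  conv_lhs => rw [← sw_tmul_eq (𝓒.coact a₂)]
  simp (disch := fun_prop) only [sw_tmul, tmul_sw, map_sw, equiv_sw, sw_sw,
    TensorProduct.rightComm_tmul, LinearMap.rTensor_tmul, TensorProduct.assoc_tmul,
    TensorProduct.assoc_symm_tmul, TensorProduct.map_tmul, LinearMap.mul'_apply, sw_pure]

theorem sw_antipode_left (b : C) (F : C → X) (hF : Lin k F) :
    sw (Δ b) (fun b₁ b₂ => F (𝓒.antipode b₁ * b₂)) = ε b • F 1 := by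
  have := 𝓒.antipode_left b
  rw [← sw_tmul_eq (Δ b)] at this
  simp only [map_sw, LinearMap.rTensor_tmul, LinearMap.mul'_apply] at this
  rw [← lin_sw F hF, this, hF.smul]

theorem sw_antipode_right (b : C) (F : C → X) (hF : Lin k F) :
    sw (Δ b) (fun b₁ b₂ => F (b₁ * 𝓒.antipode b₂)) = ε b • F 1 := by
  have := 𝓒.antipode_right b
  rw [← sw_tmul_eq (Δ b)] at this
  simp only [map_sw, LinearMap.lTensor_tmul, LinearMap.mul'_apply] at this
  rw [← lin_sw F hF, this, hF.smul]

end LeftBraidedGroup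

end LeftSweedler

/-! ### Bialgebra and antipode axioms in Sweedler notation -/

section Bialgebra

variable {k A X : Type*} [CommSemiring k] [Semiring A] [AddCommMonoid X] [Module k X]

theorem sw_comul_mul [Bialgebra k A] (x y : A) (F : A → A → X)
    (h₁ : ∀ b, Lin k (fun a => F a b)) (h₂ : ∀ a, Lin k (fun b => F a b)) :
    sw (Coalgebra.comul (R := k) (x * y)) F = sw (Coalgebra.comul (R := k) x) fun x₁ x₂ =>
      sw (Coalgebra.comul (R := k) y) fun y₁ y₂ => F (x₁ * y₁) (x₂ * y₂) := by
  rw [Bialgebra.comul_mul]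
  conv_lhs => rw [← sw_tmul_eq (Coalgebra.comul (R := k) x),
    ← sw_tmul_eq (Coalgebra.comul (R := k) y)]
  simp (disch := fun_prop) only [sw_mul, mul_sw, Algebra.TensorProduct.tmul_mul_tmul, sw_sw,
    sw_pure]
  rw [sw_comm]

theorem sw_comul_one [Bialgebra k A] (F : A → A → X)
    (h₁ : ∀ b, Lin k (fun a => F a b)) (h₂ : ∀ a, Lin k (fun b => F a b)) :
    sw (Coalgebra.comul (R := k) (1 : A)) F = F 1 1 := by
  rw [Bialgebra.comul_one, Algebra.TensorProduct.one_def, sw_pure _ _ _ h₁ h₂]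

theorem sw_hopf_left [HopfAlgebra k A] (x : A) (F : A → X) (hF : Lin k F) :
    sw (Coalgebra.comul (R := k) x) (fun a b => F (HopfAlgebra.antipode k a * b)) =
      Coalgebra.counit (R := k) x • F 1 := by
  have := HopfAlgebra.mul_antipode_rTensor_comul_apply (R := k) x
  rw [← sw_tmul_eq (Coalgebra.comul (R := k) x)] at this
  simp only [map_sw, LinearMap.rTensor_tmul, LinearMap.mul'_apply] at this
  rw [← lin_sw F hF, this, Algebra.algebraMap_eq_smul_one, hF.smul]

theorem sw_hopf_right [HopfAlgebra k A] (x : A) (F : A → X) (hF : Lin k F) :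
    sw (Coalgebra.comul (R := k) x) (fun a b => F (a * HopfAlgebra.antipode k b)) =
      Coalgebra.counit (R := k) x • F 1 := by
  have := HopfAlgebra.mul_antipode_lTensor_comul_apply (R := k) x
  rw [← sw_tmul_eq (Coalgebra.comul (R := k) x)] at this
  simp only [map_sw, LinearMap.lTensor_tmul, LinearMap.mul'_apply] at this
  rw [← lin_sw F hF, this, Algebra.algebraMap_eq_smul_one, hF.smul]

end Bialgebra

/-! ### The right biproduct as a Hopf algebra -/

section RightBiproduct

variable {k H B : Type*} [Field k] [Ring H] [HopfAlgebra k H] [Ring B] [Algebra k B]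
  [Coalgebra k B]

local notation "Δ" => Coalgebra.comul (R := k)
local notation "ε" => Coalgebra.counit (R := k)

theorem rightBiproduct_mul_tmul (𝓑 : RightBraidedGroup k H B) (h g : H) (b a : B) :
    (rightBiproduct 𝓑).mul ((h ⊗ₜ[k] b) ⊗ₜ[k] (g ⊗ₜ[k] a)) =
      sw (Δ g) fun g₁ g₂ => (h * g₁) ⊗ₜ[k] (𝓑.act (b ⊗ₜ[k] g₂) * a) := by
  simp only [rightBiproduct, mid, rightSwap, LinearMap.comp_apply, LinearEquiv.coe_coe,
    TensorProduct.assoc_tmul, TensorProduct.assoc_symm_tmul, LinearMap.lTensor_tmul,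
    LinearMap.rTensor_tmul]
  conv_lhs => rw [← sw_tmul_eq (Δ g)]
  simp only [tmul_sw, sw_tmul, map_sw, equiv_sw, TensorProduct.leftComm_tmul,
    TensorProduct.assoc_tmul, TensorProduct.assoc_symm_tmul, LinearMap.lTensor_tmul,
    TensorProduct.map_tmul, LinearMap.mul'_apply]

theorem rightBiproduct_comul_tmul (𝓑 : RightBraidedGroup k H B) (h : H) (b : B) :
    (rightBiproduct 𝓑).comul (h ⊗ₜ[k] b) =
      sw (Δ h) fun h₁ h₂ => sw (Δ b) fun b₁ b₂ => sw (𝓑.coact b₁) fun u g =>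
        (h₁ ⊗ₜ[k] u) ⊗ₜ[k] ((h₂ * g) ⊗ₜ[k] b₂) := by
  simp only [rightBiproduct, LinearMap.comp_apply, TensorProduct.map_tmul]
  conv_lhs => rw [← sw_tmul_eq (Δ h), ← sw_tmul_eq (Δ b)]
  simp only [tmul_sw, sw_tmul, map_sw]
  rw [sw_comm]
  refine sw_congr fun h₁ h₂ => sw_congr fun b₁ b₂ => ?_
  simp only [mid, rightCoswap, LinearMap.comp_apply, LinearEquiv.coe_coe,
    TensorProduct.assoc_tmul, TensorProduct.assoc_symm_tmul, LinearMap.lTensor_tmul,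
    LinearMap.rTensor_tmul]
  conv_lhs => rw [← sw_tmul_eq (𝓑.coact b₁)]
  simp only [tmul_sw, sw_tmul, map_sw, equiv_sw, TensorProduct.leftComm_tmul,
    TensorProduct.assoc_tmul, TensorProduct.assoc_symm_tmul, LinearMap.lTensor_tmul,
    LinearMap.mul'_apply]

theorem rightBiproduct_antipode_tmul (𝓑 : RightBraidedGroup k H B) (h : H) (b : B) :
    (rightBiproduct 𝓑).antipode (h ⊗ₜ[k] b) =
      sw (𝓑.coact b) fun u g => sw (Δ (HopfAlgebra.antipode k (h * g))) fun s₁ s₂ =>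
        s₁ ⊗ₜ[k] 𝓑.act (𝓑.antipode u ⊗ₜ[k] s₂) := by
  simp only [rightBiproduct, rightCoswap, LinearMap.comp_apply, LinearEquiv.coe_coe,
    LinearMap.lTensor_tmul]
  conv_lhs => rw [← sw_tmul_eq (𝓑.coact b)]
  simp only [tmul_sw, map_sw, equiv_sw, TensorProduct.leftComm_tmul,
    LinearMap.lTensor_tmul, TensorProduct.map_tmul, LinearMap.mul'_apply, rightSwap,
    LinearMap.comp_apply, LinearEquiv.coe_coe]
  refine sw_congr fun u g => ?_
  conv_lhs => rw [← sw_tmul_eq (Δ (HopfAlgebra.antipode k (h * g)))]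
  simp only [tmul_sw, map_sw, equiv_sw, TensorProduct.leftComm_tmul,
    LinearMap.lTensor_tmul]

/-- The space `H ⊗ B` with the Hopf algebra structure `rightBiproduct`. -/
def RightBi (_ : RightBraidedGroup k H B) : Type _ := H ⊗[k] B

namespace RightBi

variable (𝓑 : RightBraidedGroup k H B)

instance : AddCommGroup (RightBi 𝓑) := inferInstanceAs (AddCommGroup (H ⊗[k] B))

instance : Module k (RightBi 𝓑) := inferInstanceAs (Module k (H ⊗[k] B))

/-- The identity map, as a linear equivalence from `H ⊗ B`. -/
def equiv : H ⊗[k] B ≃ₗ[k] RightBi 𝓑 := LinearEquiv.refl k (H ⊗[k] B)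

/-- The pure tensor `h ⊗ b`. -/
def mk (h : H) (b : B) : RightBi 𝓑 := equiv 𝓑 (h ⊗ₜ[k] b)

variable {𝓑} in
theorem induction {P : RightBi 𝓑 → Prop} (hm : ∀ h b, P (mk 𝓑 h b))
    (ha : ∀ x y, P x → P y → P (x + y)) (x : RightBi 𝓑) : P x := by
  obtain ⟨x, rfl⟩ := (equiv 𝓑).surjective x
  induction x with
  | zero => have := hm 0 0; rwa [mk, TensorProduct.zero_tmul] at this
  | tmul h b => exact hm h b
  | add x y hx hy => rw [map_add]; exact ha _ _ hx hy

@[fun_prop]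
theorem lin_mk_left (b : B) : Lin k (fun h => mk 𝓑 h b) := by unfold mk; fun_prop

@[fun_prop]
theorem lin_mk_right (h : H) : Lin k (fun b => mk 𝓑 h b) := by unfold mk; fun_prop

instance : Mul (RightBi 𝓑) := ⟨fun x y => equiv 𝓑 ((rightBiproduct 𝓑).mul ((equiv 𝓑).symm x ⊗ₜ[k] (equiv 𝓑).symm y))⟩

instance : One (RightBi 𝓑) := ⟨equiv 𝓑 (rightBiproduct 𝓑).one⟩

theorem mul_def (x y : RightBi 𝓑) : x * y =
    equiv 𝓑 ((rightBiproduct 𝓑).mul ((equiv 𝓑).symm x ⊗ₜ[k] (equiv 𝓑).symm y)) := rfl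

theorem mk_mul_mk (h g : H) (b a : B) : mk 𝓑 h b * mk 𝓑 g a =
    sw (Δ g) fun g₁ g₂ => mk 𝓑 (h * g₁) (𝓑.act (b ⊗ₜ[k] g₂) * a) := by
  rw [mul_def, mk, mk, LinearEquiv.symm_apply_apply, LinearEquiv.symm_apply_apply,
    rightBiproduct_mul_tmul, equiv_sw]
  rfl

theorem one_eq : (1 : RightBi 𝓑) = mk 𝓑 1 1 := rfl

theorem lin_mul_left (y : RightBi 𝓑) : Lin k (fun x : RightBi 𝓑 => x * y) := by
  simp only [mul_def]; fun_prop

theorem lin_mul_right (x : RightBi 𝓑) : Lin k (fun y : RightBi 𝓑 => x * y) := by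
  simp only [mul_def]; fun_prop

/-- On pure tensors this is associativity of a smash product. It needs that `B` is an `H`-module
algebra and that `Δ` of `H` is coassociative and multiplicative; the coaction plays no role. -/
theorem mul_assoc_aux (x y z : RightBi 𝓑) : x * y * z = x * (y * z) := by
  induction x using induction with
  | ha x x' h h' => simp only [(lin_mul_left 𝓑 _).add, h, h']
  | hm h b =>
  induction y using induction with
  | ha x x' h h' => simp only [(lin_mul_left 𝓑 _).add, (lin_mul_right 𝓑 _).add, h, h']
  | hm g a =>
  induction z using induction with
  | ha x x' h h' => simp only [(lin_mul_right 𝓑 _).add, h, h']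
  | hm f e =>
  simp only [mk_mul_mk]
  rw [lin_sw (k := k) _ (lin_mul_left 𝓑 _), lin_sw (k := k) _ (lin_mul_right 𝓑 _)]
  simp only [mk_mul_mk]
  simp (disch := fun_prop) only [sw_comul_mul]
  simp only [𝓑.mul_act, sw_mul, lin_sw _ (lin_mk_right 𝓑 _)]
  rw [sw_comm (Δ f) (Δ g)]
  simp (disch := fun_prop) only [sw_coassoc, mul_assoc, 𝓑.act_mul]

instance : Ring (RightBi 𝓑) :=
  { (inferInstance : AddCommGroup (RightBi 𝓑)), (inferInstance : Mul (RightBi 𝓑)),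
    (inferInstance : One (RightBi 𝓑)) with
    mul_assoc := mul_assoc_aux 𝓑
    one_mul := fun x => by
      induction x using induction with
      | ha x x' h h' => rw [(lin_mul_right 𝓑 _).add, h, h']
      | hm h b =>
        rw [one_eq, mk_mul_mk]
        simp (disch := fun_prop) only [one_mul, 𝓑.one_act, smul_mul_assoc, (lin_mk_right 𝓑 _).smul,
          sw_counit_right]
    mul_one := fun x => by
      induction x using induction with
      | ha x x' h h' => rw [(lin_mul_left 𝓑 _).add, h, h']
      | hm h b =>
        rw [one_eq, mk_mul_mk]
        simp (disch := fun_prop) only [sw_comul_one, mul_one, 𝓑.act_one]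
    left_distrib := fun x => (lin_mul_right 𝓑 x).add
    right_distrib := fun x y z => (lin_mul_left 𝓑 z).add x y
    zero_mul := fun x => (lin_mul_left 𝓑 x).toLinearMap.map_zero
    mul_zero := fun x => (lin_mul_right 𝓑 x).toLinearMap.map_zero }

instance : Algebra k (RightBi 𝓑) :=
  Algebra.ofModule (fun c x y => (lin_mul_left 𝓑 y).smul c x)
    (fun c x y => (lin_mul_right 𝓑 x).smul c y)

/-- The inclusion of `H`. -/
def inlH : H →ₐ[k] RightBi 𝓑 :=
  AlgHom.ofLinearMap (lin_mk_left 𝓑 1).toLinearMap rfl fun g h => by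
    change mk 𝓑 (g * h) 1 = mk 𝓑 g 1 * mk 𝓑 h 1
    rw [mk_mul_mk]
    simp (disch := fun_prop) only [𝓑.one_act, mul_one, (lin_mk_right 𝓑 _).smul, sw_counit_right]

/-- The inclusion of `B`. -/
def inrB : B →ₐ[k] RightBi 𝓑 :=
  AlgHom.ofLinearMap (lin_mk_right 𝓑 1).toLinearMap rfl fun a b => by
    change mk 𝓑 1 (a * b) = mk 𝓑 1 a * mk 𝓑 1 b
    rw [mk_mul_mk]
    simp (disch := fun_prop) only [sw_comul_one, mul_one, 𝓑.act_one]

local notation "ι" => inlH 𝓑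
local notation "κ" => inrB 𝓑

theorem inlH_apply (h : H) : ι h = mk 𝓑 h 1 := rfl

theorem inrB_apply (b : B) : κ b = mk 𝓑 1 b := rfl

theorem mk_eq (h : H) (b : B) : mk 𝓑 h b = ι h * κ b := by
  rw [inlH_apply, inrB_apply, mk_mul_mk]
  simp (disch := fun_prop) only [sw_comul_one, mul_one, 𝓑.act_one, one_mul]

/-- The straightening rule. Together with the algebra maps `ι` and `κ` it presents the cross
product, and `lift` is the corresponding universal property. -/
theorem inrB_mul_inlH (b : B) (h : H) :
    κ b * ι h = sw (Δ h) fun h₁ h₂ => ι h₁ * κ (𝓑.act (b ⊗ₜ[k] h₂)) := by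
  simp only [← mk_eq]
  rw [inlH_apply, inrB_apply, mk_mul_mk]
  simp only [one_mul, mul_one]

theorem inrB_mul_inlH_mul (b : B) (h : H) (x : RightBi 𝓑) :
    κ b * (ι h * x) = sw (Δ h) fun h₁ h₂ => ι h₁ * (κ (𝓑.act (b ⊗ₜ[k] h₂)) * x) := by
  rw [← mul_assoc, inrB_mul_inlH, sw_mul]
  simp only [mul_assoc]

section Lift

variable {R : Type*} [Ring R] [Algebra k R] (f : H →ₐ[k] R) (g : B →ₐ[k] R)

/-- The algebra map on the cross product determined by its restrictions to `H` and `B`. -/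
def lift (hfg : ∀ b h, g b * f h = sw (Δ h) fun h₁ h₂ => f h₁ * g (𝓑.act (b ⊗ₜ[k] h₂))) :
    RightBi 𝓑 →ₐ[k] R :=
  have hφ : ∀ h b, (ofBilin (fun h b => f h * g b) (by fun_prop) (by fun_prop) ∘ₗ
      (equiv 𝓑).symm.toLinearMap) (mk 𝓑 h b) = f h * g b := fun h b => by
    simp only [LinearMap.comp_apply, LinearEquiv.coe_coe, mk, LinearEquiv.symm_apply_apply,
      ofBilin_tmul]
  AlgHom.ofLinearMap (ofBilin (fun h b => f h * g b) (by fun_prop) (by fun_prop) ∘ₗ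
      (equiv 𝓑).symm.toLinearMap)
    ((hφ 1 1).trans (by simp)) fun x y => by
      induction x using induction with
      | ha x x' h h' => simp only [add_mul, map_add, h, h']
      | hm h b =>
      induction y using induction with
      | ha x x' h h' => simp only [mul_add, map_add, h, h']
      | hm h' b' =>
      rw [mk_mul_mk, map_sw]
      simp only [hφ, map_mul]
      rw [mul_assoc, ← mul_assoc (g b), hfg]
      simp only [sw_mul, mul_sw, mul_assoc]

theorem lift_mk (hfg : ∀ b h, g b * f h = sw (Δ h) fun h₁ h₂ => f h₁ * g (𝓑.act (b ⊗ₜ[k] h₂)))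
    (h : H) (b : B) : lift 𝓑 f g hfg (mk 𝓑 h b) = f h * g b := by
  change (ofBilin (fun h b => f h * g b) (by fun_prop) (by fun_prop) ∘ₗ
    (equiv 𝓑).symm.toLinearMap) (mk 𝓑 h b) = f h * g b
  simp only [LinearMap.comp_apply, LinearEquiv.coe_coe, mk, LinearEquiv.symm_apply_apply,
    ofBilin_tmul]

end Lift

-- Pure tensors are products `ι h * κ b`. Once coproduct and counit are algebra maps, the coalgebra
-- axioms are equalities of algebra maps and need checking only on `H` and on `B`.
variable {𝓑} in
theorem algHom_ext {R : Type*} [Semiring R] [Algebra k R] {f g : RightBi 𝓑 →ₐ[k] R}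
    (hH : ∀ h, f (inlH 𝓑 h) = g (inlH 𝓑 h)) (hB : ∀ b, f (inrB 𝓑 b) = g (inrB 𝓑 b)) : f = g := by
  ext x
  induction x using induction with
  | ha x x' h h' => simp only [map_add, h, h']
  | hm h b => simp only [mk_eq, map_mul, hH, hB]

/-- The coproduct, as a map on `RightBi`. -/
def comulAux : RightBi 𝓑 →ₗ[k] RightBi 𝓑 ⊗[k] RightBi 𝓑 :=
  TensorProduct.map (equiv 𝓑).toLinearMap (equiv 𝓑).toLinearMap ∘ₗ (rightBiproduct 𝓑).comul ∘ₗ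
    (equiv 𝓑).symm.toLinearMap

theorem comulAux_mk (h : H) (b : B) : comulAux 𝓑 (mk 𝓑 h b) =
    sw (Δ h) fun h₁ h₂ => sw (Δ b) fun b₁ b₂ => sw (𝓑.coact b₁) fun u g =>
      (ι h₁ * κ u) ⊗ₜ[k] (ι h₂ * (ι g * κ b₂)) := by
  have : ∀ h g b, ι h * (ι g * κ b) = mk 𝓑 (h * g) b := fun h g b => by
    rw [← mul_assoc, ← map_mul, mk_eq]
  simp only [this]
  simp only [← mk_eq]
  simp only [comulAux, mk, LinearMap.comp_apply, LinearEquiv.coe_coe,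
    LinearEquiv.symm_apply_apply, rightBiproduct_comul_tmul, map_sw, TensorProduct.map_tmul]

theorem comulAux_inlH (h : H) : comulAux 𝓑 (ι h) = sw (Δ h) fun h₁ h₂ => ι h₁ ⊗ₜ[k] ι h₂ := by
  rw [inlH_apply, comulAux_mk]
  simp (disch := fun_prop) only [𝓑.comul_one, 𝓑.coact_one, sw_pure, map_one, mul_one]

theorem comulAux_inrB (b : B) : comulAux 𝓑 (κ b) =
    sw (Δ b) fun b₁ b₂ => sw (𝓑.coact b₁) fun u g => κ u ⊗ₜ[k] (ι g * κ b₂) := by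
  rw [inrB_apply, comulAux_mk]
  simp (disch := fun_prop) only [sw_comul_one, map_one, one_mul]

/-- The braiding in the coproduct of `a b` contributes `a₂ ◁ b₁⁽²⁾`. In the product of the two
coproducts the same term appears when `a₂` is moved to the right past `b₁⁽²⁾`, which comultiplies
`b₁⁽²⁾`. Comodule coassociativity for `b₁` identifies the two. -/
theorem comulAux_inrB_mul (a b : B) :
    comulAux 𝓑 (κ (a * b)) = comulAux 𝓑 (κ a) * comulAux 𝓑 (κ b) := by
  simp only [comulAux_inrB, sw_mul, mul_sw, Algebra.TensorProduct.tmul_mul_tmul]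
  simp (disch := fun_prop) only [𝓑.sw_comul_mul, 𝓑.sw_coact_mul, mul_assoc, inrB_mul_inlH_mul,
    tmul_sw, mul_sw, map_mul]
  rw [sw_comm]
  refine sw_congr fun b₁ b₂ => ?_
  rw [sw_comm]
  refine Eq.trans ?_ ((𝓑.sw_coact_coassoc b₁ (fun w h g => sw (Δ a) fun a₁ a₂ =>
    sw (𝓑.coact a₁) fun u' g' => (κ u' * κ w) ⊗ₜ[k] (ι g' * (ι h *
      (κ (𝓑.act (a₂ ⊗ₜ[k] g)) * κ b₂)))) (by fun_prop) (by fun_prop) (by fun_prop)).trans ?_)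
  · refine sw_congr fun u g => ?_
    simp only [sw_comm (𝓑.coact u)]
  · refine sw_congr fun u g => ?_
    simp only [sw_comm (Δ g)]

/-- This is the straightening rule for the coproducts, and the place where the crossed-module axiom
of `B` is used. -/
theorem comulAux_comm (b : B) (h : H) : comulAux 𝓑 (κ b) * comulAux 𝓑 (ι h) =
    sw (Δ h) fun h₁ h₂ => comulAux 𝓑 (ι h₁) * comulAux 𝓑 (κ (𝓑.act (b ⊗ₜ[k] h₂))) := by
  simp only [comulAux_inrB, comulAux_inlH, sw_mul, mul_sw, Algebra.TensorProduct.tmul_mul_tmul]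
  simp (disch := fun_prop) only [𝓑.sw_comul_act, inrB_mul_inlH, mul_assoc, mul_sw, sw_tmul,
    tmul_sw, sw_comm (Δ b), sw_comm (𝓑.coact _)]
  -- Coassociativity regroups `h` as `p ⊗ (q ⊗ x) ⊗ y`, with `q ⊗ x` the coproduct of the middle
  -- part `s`. The crossed-module axiom is then applied to `b₁` and `s` alone.
  calc _ = sw (Δ h) fun a y => sw (Δ a) fun p s => sw (Δ b) fun b₁ b₂ =>
        sw (𝓑.coact b₁) fun u g => sw (Δ s) fun q x =>
          (ι p * κ (𝓑.act (u ⊗ₜ[k] q))) ⊗ₜ[k] (ι g * (ι x * κ (𝓑.act (b₂ ⊗ₜ[k] y)))) := by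
        simp (disch := fun_prop) only [sw_comm (Δ b), sw_comm (𝓑.coact _), ← sw_coassoc]
    _ = sw (Δ h) fun a y => sw (Δ a) fun p s => sw (Δ b) fun b₁ b₂ => sw (Δ s) fun q x =>
        sw (𝓑.coact (𝓑.act (b₁ ⊗ₜ[k] x))) fun v w =>
          (ι p * κ v) ⊗ₜ[k] (ι q * (ι w * κ (𝓑.act (b₂ ⊗ₜ[k] y)))) := by
        refine sw_congr fun a y => sw_congr fun p s => sw_congr fun b₁ b₂ => ?_
        simpa only [map_mul, mul_assoc] using 𝓑.sw_crossed b₁ s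
          (fun v w => (ι p * κ v) ⊗ₜ[k] (ι w * κ (𝓑.act (b₂ ⊗ₜ[k] y))))
          (by fun_prop) (by fun_prop)
    _ = _ := by
        simp (disch := fun_prop) only [sw_comm (Δ b), ← sw_coassoc]

/-- The restriction of the coproduct to `B`, as an algebra map. -/
def comulB : B →ₐ[k] RightBi 𝓑 ⊗[k] RightBi 𝓑 :=
  AlgHom.ofLinearMap (comulAux 𝓑 ∘ₗ (κ).toLinearMap)
    (by
      simp only [LinearMap.comp_apply, AlgHom.toLinearMap_apply, comulAux_inrB]
      simp (disch := fun_prop) only [𝓑.comul_one, sw_pure, 𝓑.coact_one, map_one, mul_one,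
        Algebra.TensorProduct.one_def])
    (comulAux_inrB_mul 𝓑)

theorem comulB_apply (b : B) : comulB 𝓑 b = comulAux 𝓑 (κ b) := rfl

theorem map_comul_inlH (h : H) : Algebra.TensorProduct.map ι ι (Δ h) = comulAux 𝓑 (ι h) := by
  rw [comulAux_inlH]
  conv_lhs => rw [← sw_tmul_eq (Δ h)]
  simp only [algHom_sw, Algebra.TensorProduct.map_tmul]

/-- The coproduct as an algebra map. -/
def comulAlg : RightBi 𝓑 →ₐ[k] RightBi 𝓑 ⊗[k] RightBi 𝓑 :=
  lift 𝓑 ((Algebra.TensorProduct.map ι ι).comp (Bialgebra.comulAlgHom k H)) (comulB 𝓑) (by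
    simp only [AlgHom.comp_apply, Bialgebra.comulAlgHom_apply, map_comul_inlH, comulB_apply]
    exact comulAux_comm 𝓑)

theorem comulAlg_mk (h : H) (b : B) : comulAlg 𝓑 (mk 𝓑 h b) = comulAux 𝓑 (mk 𝓑 h b) := by
  rw [comulAlg, lift_mk]
  simp only [AlgHom.comp_apply, Bialgebra.comulAlgHom_apply, map_comul_inlH, comulB_apply]
  simp only [comulAux_inlH, comulAux_inrB, comulAux_mk, sw_mul, mul_sw,
    Algebra.TensorProduct.tmul_mul_tmul]
  rw [sw_comm]
  refine sw_congr fun _ _ => ?_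
  rw [sw_comm]

/-- `comulAlg` is multiplicative by construction, while `comulAux` is given by the formula of the
biproduct; each computation uses whichever description suits it. -/
theorem comulAlg_eq (x : RightBi 𝓑) : comulAlg 𝓑 x = comulAux 𝓑 x := by
  induction x using induction with
  | ha x y hx hy => rw [map_add, map_add, hx, hy]
  | hm h b => exact comulAlg_mk 𝓑 h b

theorem comulAlg_inlH (h : H) : comulAlg 𝓑 (ι h) = sw (Δ h) fun h₁ h₂ => ι h₁ ⊗ₜ[k] ι h₂ := by
  rw [comulAlg_eq, comulAux_inlH]

theorem comulAlg_inrB (b : B) : comulAlg 𝓑 (κ b) =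
    sw (Δ b) fun b₁ b₂ => sw (𝓑.coact b₁) fun u g => κ u ⊗ₜ[k] (ι g * κ b₂) := by
  rw [comulAlg_eq, comulAux_inrB]

/-- The counit of `B`, as an algebra map. -/
def counitB : B →ₐ[k] k := AlgHom.ofLinearMap ε 𝓑.counit_one 𝓑.counit_mul

theorem counitB_apply (b : B) : counitB 𝓑 b = ε b := rfl

/-- The counit as an algebra map. -/
def counitAlg : RightBi 𝓑 →ₐ[k] k :=
  lift 𝓑 (Bialgebra.counitAlgHom k H) (counitB 𝓑) fun b h => by
    simp only [Bialgebra.counitAlgHom_apply, counitB_apply, 𝓑.counit_act]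
    exact (sw_counit_left (k := k) h (fun x => ε b * ε x) (by fun_prop)).symm

theorem counitAlg_mk (h : H) (b : B) : counitAlg 𝓑 (mk 𝓑 h b) = ε h * ε b :=
  lift_mk ..

theorem counitAlg_inlH (h : H) : counitAlg 𝓑 (ι h) = ε h := by
  rw [inlH_apply, counitAlg_mk, 𝓑.counit_one, mul_one]

theorem counitAlg_inrB (b : B) : counitAlg 𝓑 (κ b) = ε b := by
  rw [inrB_apply, counitAlg_mk, Bialgebra.counit_one, one_mul]

theorem coassoc_aux : (Algebra.TensorProduct.assoc k k k _ _ _).toAlgHom.comp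
    ((Algebra.TensorProduct.map (comulAlg 𝓑) (.id k _)).comp (comulAlg 𝓑)) =
      (Algebra.TensorProduct.map (.id k _) (comulAlg 𝓑)).comp (comulAlg 𝓑) := by
  refine algHom_ext (fun h => ?_) fun b => ?_
  · simp only [AlgHom.comp_apply, comulAlg_inlH, algHom_sw, Algebra.TensorProduct.map_tmul,
      sw_tmul, tmul_sw, AlgEquiv.toAlgHom_apply, Algebra.TensorProduct.assoc_tmul, AlgHom.id_apply]
    simp (disch := fun_prop) only [sw_coassoc]
  · simp only [AlgHom.comp_apply, comulAlg_inrB, algHom_sw, Algebra.TensorProduct.map_tmul,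
      sw_tmul, tmul_sw, AlgEquiv.toAlgHom_apply, Algebra.TensorProduct.assoc_tmul, AlgHom.id_apply,
      map_mul, comulAlg_inlH, sw_mul, mul_sw, Algebra.TensorProduct.tmul_mul_tmul]
    simp (disch := fun_prop) only [𝓑.sw_coact_comul]
    -- Both sides are brought to `b₁⁽¹⁾ ⊗ b₁⁽²⁾₁ b₂⁽¹⁾ ⊗ b₁⁽²⁾₂ b₂⁽²⁾ b₃`, using coassociativity of
    -- `B` for the outer sums and comodule coassociativity for `b₁`.
    refine Eq.trans ?_ ((sw_coassoc b (fun a c d => sw (𝓑.coact a) fun v g =>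
      sw (𝓑.coact c) fun w h => sw (Δ g) fun g₁ g₂ => κ v ⊗ₜ[k]
        ((ι g₁ * κ w) ⊗ₜ[k] (ι g₂ * (ι h * κ d))))
      (by fun_prop) (by fun_prop) (by fun_prop)).trans ?_)
    · refine sw_congr fun a d => sw_congr fun b₁ b₂ => ?_
      refine Eq.trans ?_ ((𝓑.sw_coact_coassoc b₁ (fun v f g => sw (𝓑.coact b₂) fun w h =>
        κ v ⊗ₜ[k] ((ι f * κ w) ⊗ₜ[k] (ι g * (ι h * κ d))))
        (by fun_prop) (by fun_prop) (by fun_prop)).trans ?_)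
      · refine sw_congr fun u g => ?_
        rw [sw_comm]
        simp only [map_mul, mul_assoc]
      · refine sw_congr fun u g => ?_
        rw [sw_comm]
    · refine sw_congr fun a c => ?_
      rw [sw_comm]

theorem counit_comul_aux : (Algebra.TensorProduct.map (counitAlg 𝓑) (.id k (RightBi 𝓑))).comp
    (comulAlg 𝓑) = (Algebra.TensorProduct.lid k (RightBi 𝓑)).symm := by
  -- The scalar leg is turned into a scalar multiple, the form in which the counit lemmas apply.
  have hs : ∀ (a : k) (x : RightBi 𝓑), a ⊗ₜ[k] x = a • ((1 : k) ⊗ₜ[k] x) := fun a x => by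
    rw [TensorProduct.smul_tmul', smul_eq_mul, mul_one]
  refine algHom_ext (fun h => ?_) fun b => ?_
  · simp only [AlgHom.comp_apply, comulAlg_inlH, algHom_sw, Algebra.TensorProduct.map_tmul,
      counitAlg_inlH, AlgHom.id_apply]
    simp only [hs (ε _)]
    exact sw_counit_left h (fun x => (1 : k) ⊗ₜ[k] ι x) (by fun_prop)
  · simp only [AlgHom.comp_apply, comulAlg_inrB, algHom_sw, Algebra.TensorProduct.map_tmul,
      counitAlg_inrB, AlgHom.id_apply]
    simp only [hs (ε _)]
    simp (disch := fun_prop) only [𝓑.sw_coact_counit', map_one, one_mul]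
    exact sw_counit_left b (fun x => (1 : k) ⊗ₜ[k] κ x) (by fun_prop)

theorem comul_counit_aux : (Algebra.TensorProduct.map (.id k (RightBi 𝓑)) (counitAlg 𝓑)).comp
    (comulAlg 𝓑) = (Algebra.TensorProduct.rid k k (RightBi 𝓑)).symm := by
  have hs : ∀ (a : k) (x : RightBi 𝓑), x ⊗ₜ[k] a = a • (x ⊗ₜ[k] (1 : k)) := fun a x => by
    rw [← TensorProduct.tmul_smul, smul_eq_mul, mul_one]
  refine algHom_ext (fun h => ?_) fun b => ?_
  · simp only [AlgHom.comp_apply, comulAlg_inlH, algHom_sw, Algebra.TensorProduct.map_tmul,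
      counitAlg_inlH, AlgHom.id_apply]
    simp only [hs (ε _)]
    exact sw_counit_right h (fun x => ι x ⊗ₜ[k] (1 : k)) (by fun_prop)
  · simp only [AlgHom.comp_apply, comulAlg_inrB, algHom_sw, Algebra.TensorProduct.map_tmul,
      map_mul, counitAlg_inlH, counitAlg_inrB, AlgHom.id_apply]
    simp only [hs (ε _ * _), mul_smul]
    simp (disch := fun_prop) only [𝓑.sw_coact_counit]
    exact sw_counit_right b (fun x => κ x ⊗ₜ[k] (1 : k)) (by fun_prop)

instance : Bialgebra k (RightBi 𝓑) :=
  Bialgebra.ofAlgHom (comulAlg 𝓑) (counitAlg 𝓑) (coassoc_aux 𝓑) (counit_comul_aux 𝓑)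
    (comul_counit_aux 𝓑)

/-- The antipode. -/
def antipodeAux : RightBi 𝓑 →ₗ[k] RightBi 𝓑 :=
  (equiv 𝓑).toLinearMap ∘ₗ (rightBiproduct 𝓑).antipode ∘ₗ (equiv 𝓑).symm.toLinearMap

theorem antipodeAux_mk (h : H) (b : B) : antipodeAux 𝓑 (mk 𝓑 h b) =
    sw (𝓑.coact b) fun u g => κ (𝓑.antipode u) * ι (HopfAlgebra.antipode k (h * g)) := by
  simp only [inrB_mul_inlH, ← mk_eq]
  simp only [antipodeAux, mk, LinearMap.comp_apply, LinearEquiv.coe_coe,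
    LinearEquiv.symm_apply_apply, rightBiproduct_antipode_tmul, equiv_sw]

/-- Comodule coassociativity turns the repeated coaction into the coproduct of `g`, so that the
inner factor is `S((h g)₁) (h g)₂`. The antipode of `H` removes it first; what remains is the
braided antipode identity in `B`. -/
theorem antipodeAux_left (h : H) (b : B) :
    LinearMap.mul' k _ (LinearMap.rTensor _ (antipodeAux 𝓑) (comulAux 𝓑 (mk 𝓑 h b))) =
      (ε h * ε b) • 1 := by
  rw [comulAux_mk]
  simp only [← mk_eq, map_sw, LinearMap.rTensor_tmul, LinearMap.mul'_apply, antipodeAux_mk]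
  simp only [mk_eq, sw_mul, mul_assoc]
  calc _ = sw (Δ b) fun b₁ b₂ => sw (𝓑.coact b₁) fun u g => sw (Δ h) fun h₁ h₂ =>
        sw (Δ g) fun g₁ g₂ => κ (𝓑.antipode u) *
          (ι (HopfAlgebra.antipode k (h₁ * g₁) * (h₂ * g₂)) * κ b₂) := by
        rw [sw_comm]
        refine sw_congr fun b₁ b₂ => ?_
        rw [sw_comm]
        simp (disch := fun_prop) only [sw_comm (Δ h), 𝓑.sw_coact_coassoc, map_mul, mul_assoc]
    _ = sw (Δ b) fun b₁ b₂ => sw (𝓑.coact b₁) fun u g => ε g • ε h • κ (𝓑.antipode u * b₂) := by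
        refine sw_congr fun b₁ b₂ => sw_congr fun u g => ?_
        rw [← sw_comul_mul h g (fun x y => κ (𝓑.antipode u) *
          (ι (HopfAlgebra.antipode k x * y) * κ b₂)) (by fun_prop) (by fun_prop),
          sw_hopf_left (h * g) (fun x => κ (𝓑.antipode u) * (ι x * κ b₂)) (by fun_prop),
          map_one, one_mul, Bialgebra.counit_mul, mul_comm (ε h), mul_smul, map_mul]
    _ = _ := by
        simp (disch := fun_prop) only [𝓑.sw_coact_counit]
        rw [𝓑.sw_antipode_left b (fun x => ε h • κ x) (by fun_prop), map_one, ← mul_smul,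
          mul_comm (ε h)]

/-- Here the order is reversed. As the coproduct of `B` is colinear, the coaction can be taken
before the coproduct. The braided antipode then collapses `u₁ S(u₂)`, and the antipode of `H` acts
last. -/
theorem antipodeAux_right (h : H) (b : B) :
    LinearMap.mul' k _ (LinearMap.lTensor _ (antipodeAux 𝓑) (comulAux 𝓑 (mk 𝓑 h b))) =
      (ε h * ε b) • 1 := by
  rw [comulAux_mk]
  simp only [← mul_assoc (ι _) (ι _), ← map_mul]
  simp only [← mk_eq, map_sw, LinearMap.lTensor_tmul, LinearMap.mul'_apply, antipodeAux_mk]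
  simp only [mk_eq, mul_sw, mul_assoc]
  calc _ = sw (Δ h) fun h₁ h₂ => sw (𝓑.coact b) fun u g => sw (Δ u) fun u₁ u₂ =>
        ι h₁ * (κ (u₁ * 𝓑.antipode u₂) * ι (HopfAlgebra.antipode k (h₂ * g))) := by
        simp (disch := fun_prop) only [𝓑.sw_coact_comul, map_mul, mul_assoc]
    _ = sw (Δ h) fun h₁ h₂ => ε b • (ι (h₁ * HopfAlgebra.antipode k h₂)) := by
        refine sw_congr fun h₁ h₂ => ?_
        simp only [fun u g => 𝓑.sw_antipode_right u (fun x => ι h₁ * (κ x *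
          ι (HopfAlgebra.antipode k (h₂ * g)))) (by fun_prop), map_one, one_mul]
        rw [𝓑.sw_coact_counit' b (fun g => ι h₁ * ι (HopfAlgebra.antipode k (h₂ * g)))
          (by fun_prop), mul_one, map_mul]
    _ = _ := by
        rw [sw_hopf_right h (fun x => ε b • ι x) (by fun_prop), map_one, ← mul_smul]

instance : HopfAlgebra k (RightBi 𝓑) where
  antipode := antipodeAux 𝓑
  mul_antipode_rTensor_comul := by
    ext x
    induction x using induction with
    | ha x y hx hy => rw [map_add, map_add, hx, hy]
    | hm h b =>
    change LinearMap.mul' k _ (LinearMap.rTensor _ (antipodeAux 𝓑) (comulAlg 𝓑 (mk 𝓑 h b))) =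
      algebraMap k _ (counitAlg 𝓑 (mk 𝓑 h b))
    rw [comulAlg_eq, counitAlg_mk, antipodeAux_left, Algebra.algebraMap_eq_smul_one]
  mul_antipode_lTensor_comul := by
    ext x
    induction x using induction with
    | ha x y hx hy => rw [map_add, map_add, hx, hy]
    | hm h b =>
    change LinearMap.mul' k _ (LinearMap.lTensor _ (antipodeAux 𝓑) (comulAlg 𝓑 (mk 𝓑 h b))) =
      algebraMap k _ (counitAlg 𝓑 (mk 𝓑 h b))
    rw [comulAlg_eq, counitAlg_mk, antipodeAux_right, Algebra.algebraMap_eq_smul_one]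

end RightBi

end RightBiproduct

/-! ### The left biproduct as a Hopf algebra -/

section LeftBiproduct

variable {k H C : Type*} [Field k] [Ring H] [HopfAlgebra k H] [Ring C] [Algebra k C]
  [Coalgebra k C]

local notation "Δ" => Coalgebra.comul (R := k)
local notation "ε" => Coalgebra.counit (R := k)

theorem leftBiproduct_mul_tmul (𝓒 : LeftBraidedGroup k H C) (c d : C) (h g : H) :
    (leftBiproduct 𝓒).mul ((c ⊗ₜ[k] h) ⊗ₜ[k] (d ⊗ₜ[k] g)) =
      sw (Δ h) fun h₁ h₂ => (c * 𝓒.act (h₁ ⊗ₜ[k] d)) ⊗ₜ[k] (h₂ * g) := by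
  simp only [leftBiproduct, mid, leftSwap, LinearMap.comp_apply, LinearEquiv.coe_coe,
    TensorProduct.assoc_tmul, TensorProduct.assoc_symm_tmul, LinearMap.lTensor_tmul,
    LinearMap.rTensor_tmul]
  conv_lhs => rw [← sw_tmul_eq (Δ h)]
  simp only [tmul_sw, sw_tmul, map_sw, equiv_sw, TensorProduct.rightComm_tmul,
    TensorProduct.assoc_tmul, TensorProduct.assoc_symm_tmul, LinearMap.rTensor_tmul,
    TensorProduct.map_tmul, LinearMap.mul'_apply]

theorem leftBiproduct_comul_tmul (𝓒 : LeftBraidedGroup k H C) (c : C) (h : H) :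
    (leftBiproduct 𝓒).comul (c ⊗ₜ[k] h) =
      sw (Δ c) fun c₁ c₂ => sw (Δ h) fun h₁ h₂ => sw (𝓒.coact c₂) fun g u =>
        (c₁ ⊗ₜ[k] (g * h₁)) ⊗ₜ[k] (u ⊗ₜ[k] h₂) := by
  simp only [leftBiproduct, LinearMap.comp_apply, TensorProduct.map_tmul]
  conv_lhs => rw [← sw_tmul_eq (Δ h), ← sw_tmul_eq (Δ c)]
  simp only [tmul_sw, sw_tmul, map_sw]
  rw [sw_comm]
  refine sw_congr fun c₁ c₂ => sw_congr fun h₁ h₂ => ?_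
  simp only [mid, leftCoswap, LinearMap.comp_apply, LinearEquiv.coe_coe,
    TensorProduct.assoc_tmul, TensorProduct.assoc_symm_tmul, LinearMap.lTensor_tmul,
    LinearMap.rTensor_tmul]
  conv_lhs => rw [← sw_tmul_eq (𝓒.coact c₂)]
  simp only [tmul_sw, sw_tmul, map_sw, equiv_sw, TensorProduct.rightComm_tmul,
    TensorProduct.assoc_tmul, TensorProduct.assoc_symm_tmul, LinearMap.rTensor_tmul,
    LinearMap.mul'_apply]

theorem leftBiproduct_antipode_tmul (𝓒 : LeftBraidedGroup k H C) (c : C) (h : H) :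
    (leftBiproduct 𝓒).antipode (c ⊗ₜ[k] h) =
      sw (𝓒.coact c) fun g u => sw (Δ (HopfAlgebra.antipode k (g * h))) fun s₁ s₂ =>
        𝓒.act (s₁ ⊗ₜ[k] 𝓒.antipode u) ⊗ₜ[k] s₂ := by
  simp only [leftBiproduct, leftCoswap, LinearMap.comp_apply, LinearEquiv.coe_coe,
    LinearMap.rTensor_tmul]
  conv_lhs => rw [← sw_tmul_eq (𝓒.coact c)]
  simp only [sw_tmul, map_sw, equiv_sw, TensorProduct.rightComm_tmul,
    LinearMap.rTensor_tmul, TensorProduct.map_tmul, LinearMap.mul'_apply, leftSwap,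
    LinearMap.comp_apply, LinearEquiv.coe_coe]
  refine sw_congr fun g u => ?_
  conv_lhs => rw [← sw_tmul_eq (Δ (HopfAlgebra.antipode k (g * h)))]
  simp only [sw_tmul, map_sw, equiv_sw, TensorProduct.rightComm_tmul,
    LinearMap.rTensor_tmul]

/-- The space `C ⊗ H` with the Hopf algebra structure `leftBiproduct`. -/
def LeftBi (_ : LeftBraidedGroup k H C) : Type _ := C ⊗[k] H

namespace LeftBi

variable (𝓒 : LeftBraidedGroup k H C)

instance : AddCommGroup (LeftBi 𝓒) := inferInstanceAs (AddCommGroup (C ⊗[k] H))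

instance : Module k (LeftBi 𝓒) := inferInstanceAs (Module k (C ⊗[k] H))

/-- The identity map, as a linear equivalence from `C ⊗ H`. -/
def equiv : C ⊗[k] H ≃ₗ[k] LeftBi 𝓒 := LinearEquiv.refl k (C ⊗[k] H)

/-- The pure tensor `c ⊗ h`. -/
def mk (c : C) (h : H) : LeftBi 𝓒 := equiv 𝓒 (c ⊗ₜ[k] h)

variable {𝓒} in
theorem induction {P : LeftBi 𝓒 → Prop} (hm : ∀ c h, P (mk 𝓒 c h))
    (ha : ∀ x y, P x → P y → P (x + y)) (x : LeftBi 𝓒) : P x := by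
  obtain ⟨x, rfl⟩ := (equiv 𝓒).surjective x
  induction x with
  | zero => have := hm 0 0; rwa [mk, TensorProduct.zero_tmul] at this
  | tmul c h => exact hm c h
  | add x y hx hy => rw [map_add]; exact ha _ _ hx hy

@[fun_prop]
theorem lin_mk_left (h : H) : Lin k (fun c => mk 𝓒 c h) := by unfold mk; fun_prop

@[fun_prop]
theorem lin_mk_right (c : C) : Lin k (fun h => mk 𝓒 c h) := by unfold mk; fun_prop

instance : Mul (LeftBi 𝓒) :=
  ⟨fun x y => equiv 𝓒 ((leftBiproduct 𝓒).mul ((equiv 𝓒).symm x ⊗ₜ[k] (equiv 𝓒).symm y))⟩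

instance : One (LeftBi 𝓒) := ⟨equiv 𝓒 (leftBiproduct 𝓒).one⟩

theorem mul_def (x y : LeftBi 𝓒) : x * y =
    equiv 𝓒 ((leftBiproduct 𝓒).mul ((equiv 𝓒).symm x ⊗ₜ[k] (equiv 𝓒).symm y)) := rfl

theorem mk_mul_mk (c d : C) (h g : H) : mk 𝓒 c h * mk 𝓒 d g =
    sw (Δ h) fun h₁ h₂ => mk 𝓒 (c * 𝓒.act (h₁ ⊗ₜ[k] d)) (h₂ * g) := by
  rw [mul_def, mk, mk, LinearEquiv.symm_apply_apply, LinearEquiv.symm_apply_apply,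
    leftBiproduct_mul_tmul, equiv_sw]
  rfl

theorem one_eq : (1 : LeftBi 𝓒) = mk 𝓒 1 1 := rfl

theorem lin_mul_left (y : LeftBi 𝓒) : Lin k (fun x : LeftBi 𝓒 => x * y) := by
  simp only [mul_def]; fun_prop

theorem lin_mul_right (x : LeftBi 𝓒) : Lin k (fun y : LeftBi 𝓒 => x * y) := by
  simp only [mul_def]; fun_prop

/-- The mirror image of the right-handed case: only the module algebra structure of `C` enters, not
its coaction. -/
theorem mul_assoc_aux (x y z : LeftBi 𝓒) : x * y * z = x * (y * z) := by
  induction x using induction with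
  | ha x x' h h' => simp only [(lin_mul_left 𝓒 _).add, h, h']
  | hm c h =>
  induction y using induction with
  | ha x x' h h' => simp only [(lin_mul_left 𝓒 _).add, (lin_mul_right 𝓒 _).add, h, h']
  | hm d g =>
  induction z using induction with
  | ha x x' h h' => simp only [(lin_mul_right 𝓒 _).add, h, h']
  | hm e f =>
  simp only [mk_mul_mk]
  rw [lin_sw (k := k) _ (lin_mul_left 𝓒 _), lin_sw (k := k) _ (lin_mul_right 𝓒 _)]
  simp only [mk_mul_mk]
  simp (disch := fun_prop) only [sw_comul_mul]
  simp only [𝓒.act_mul, mul_sw, lin_sw _ (lin_mk_left 𝓒 _)]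
  rw [sw_comm (Δ g) (Δ h)]
  simp (disch := fun_prop) only [sw_comm (Δ g), sw_coassoc, mul_assoc, 𝓒.mul_act]

instance : Ring (LeftBi 𝓒) :=
  { (inferInstance : AddCommGroup (LeftBi 𝓒)), (inferInstance : Mul (LeftBi 𝓒)),
    (inferInstance : One (LeftBi 𝓒)) with
    mul_assoc := mul_assoc_aux 𝓒
    one_mul := fun x => by
      induction x using induction with
      | ha x x' h h' => rw [(lin_mul_right 𝓒 _).add, h, h']
      | hm c h =>
        rw [one_eq, mk_mul_mk]
        simp (disch := fun_prop) only [sw_comul_one, one_mul, 𝓒.one_act]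
    mul_one := fun x => by
      induction x using induction with
      | ha x x' h h' => rw [(lin_mul_left 𝓒 _).add, h, h']
      | hm c h =>
        rw [one_eq, mk_mul_mk]
        simp (disch := fun_prop) only [mul_one, 𝓒.act_one, mul_smul_comm, (lin_mk_left 𝓒 _).smul,
          sw_counit_left]
    left_distrib := fun x => (lin_mul_right 𝓒 x).add
    right_distrib := fun x y z => (lin_mul_left 𝓒 z).add x y
    zero_mul := fun x => (lin_mul_left 𝓒 x).toLinearMap.map_zero
    mul_zero := fun x => (lin_mul_right 𝓒 x).toLinearMap.map_zero }

instance : Algebra k (LeftBi 𝓒) :=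
  Algebra.ofModule (fun c x y => (lin_mul_left 𝓒 y).smul c x)
    (fun c x y => (lin_mul_right 𝓒 x).smul c y)

/-- The inclusion of `C`. -/
def inlC : C →ₐ[k] LeftBi 𝓒 :=
  AlgHom.ofLinearMap (lin_mk_left 𝓒 1).toLinearMap rfl fun a b => by
    change mk 𝓒 (a * b) 1 = mk 𝓒 a 1 * mk 𝓒 b 1
    rw [mk_mul_mk]
    simp (disch := fun_prop) only [sw_comul_one, mul_one, 𝓒.one_act]

/-- The inclusion of `H`. -/
def inrH : H →ₐ[k] LeftBi 𝓒 :=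
  AlgHom.ofLinearMap (lin_mk_right 𝓒 1).toLinearMap rfl fun g h => by
    change mk 𝓒 1 (g * h) = mk 𝓒 1 g * mk 𝓒 1 h
    rw [mk_mul_mk]
    simp (disch := fun_prop) only [𝓒.act_one, one_mul, (lin_mk_left 𝓒 _).smul, sw_counit_left]

local notation "ι" => inlC 𝓒
local notation "κ" => inrH 𝓒

theorem inlC_apply (c : C) : ι c = mk 𝓒 c 1 := rfl

theorem inrH_apply (h : H) : κ h = mk 𝓒 1 h := rfl

theorem mk_eq (c : C) (h : H) : mk 𝓒 c h = ι c * κ h := by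
  rw [inlC_apply, inrH_apply, mk_mul_mk]
  simp (disch := fun_prop) only [sw_comul_one, mul_one, 𝓒.one_act, one_mul]

theorem inrH_mul_inlC (h : H) (c : C) :
    κ h * ι c = sw (Δ h) fun h₁ h₂ => ι (𝓒.act (h₁ ⊗ₜ[k] c)) * κ h₂ := by
  simp only [← mk_eq]
  rw [inlC_apply, inrH_apply, mk_mul_mk]
  simp only [one_mul, mul_one]

theorem inrH_mul_inlC_mul (h : H) (c : C) (x : LeftBi 𝓒) :
    κ h * (ι c * x) = sw (Δ h) fun h₁ h₂ => ι (𝓒.act (h₁ ⊗ₜ[k] c)) * (κ h₂ * x) := by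
  rw [← mul_assoc, inrH_mul_inlC, sw_mul]
  simp only [mul_assoc]

section Lift

variable {R : Type*} [Ring R] [Algebra k R] (f : C →ₐ[k] R) (g : H →ₐ[k] R)

/-- The algebra map on the cross product determined by its restrictions to `C` and `H`. -/
def lift (hfg : ∀ h c, g h * f c = sw (Δ h) fun h₁ h₂ => f (𝓒.act (h₁ ⊗ₜ[k] c)) * g h₂) :
    LeftBi 𝓒 →ₐ[k] R :=
  have hφ : ∀ c h, (ofBilin (fun c h => f c * g h) (by fun_prop) (by fun_prop) ∘ₗ
      (equiv 𝓒).symm.toLinearMap) (mk 𝓒 c h) = f c * g h := fun c h => by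
    simp only [LinearMap.comp_apply, LinearEquiv.coe_coe, mk, LinearEquiv.symm_apply_apply,
      ofBilin_tmul]
  AlgHom.ofLinearMap (ofBilin (fun c h => f c * g h) (by fun_prop) (by fun_prop) ∘ₗ
      (equiv 𝓒).symm.toLinearMap)
    ((hφ 1 1).trans (by simp)) fun x y => by
      induction x using induction with
      | ha x x' h h' => simp only [add_mul, map_add, h, h']
      | hm c h =>
      induction y using induction with
      | ha x x' h h' => simp only [mul_add, map_add, h, h']
      | hm c' h' =>
      rw [mk_mul_mk, map_sw]
      simp only [hφ, map_mul]
      rw [mul_assoc, ← mul_assoc (g h), hfg]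
      simp only [sw_mul, mul_sw, mul_assoc]

theorem lift_mk (hfg : ∀ h c, g h * f c = sw (Δ h) fun h₁ h₂ => f (𝓒.act (h₁ ⊗ₜ[k] c)) * g h₂)
    (c : C) (h : H) : lift 𝓒 f g hfg (mk 𝓒 c h) = f c * g h := by
  change (ofBilin (fun c h => f c * g h) (by fun_prop) (by fun_prop) ∘ₗ
    (equiv 𝓒).symm.toLinearMap) (mk 𝓒 c h) = f c * g h
  simp only [LinearMap.comp_apply, LinearEquiv.coe_coe, mk, LinearEquiv.symm_apply_apply,
    ofBilin_tmul]

end Lift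

variable {𝓒} in
theorem algHom_ext {R : Type*} [Semiring R] [Algebra k R] {f g : LeftBi 𝓒 →ₐ[k] R}
    (hC : ∀ c, f (inlC 𝓒 c) = g (inlC 𝓒 c)) (hH : ∀ h, f (inrH 𝓒 h) = g (inrH 𝓒 h)) :
    f = g := by
  ext x
  induction x using induction with
  | ha x x' h h' => simp only [map_add, h, h']
  | hm c h => simp only [mk_eq, map_mul, hH, hC]

/-- The coproduct, as a map on `LeftBi`. -/
def comulAux : LeftBi 𝓒 →ₗ[k] LeftBi 𝓒 ⊗[k] LeftBi 𝓒 :=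
  TensorProduct.map (equiv 𝓒).toLinearMap (equiv 𝓒).toLinearMap ∘ₗ (leftBiproduct 𝓒).comul ∘ₗ
    (equiv 𝓒).symm.toLinearMap

theorem comulAux_mk (c : C) (h : H) : comulAux 𝓒 (mk 𝓒 c h) =
    sw (Δ c) fun c₁ c₂ => sw (Δ h) fun h₁ h₂ => sw (𝓒.coact c₂) fun g u =>
      (ι c₁ * (κ g * κ h₁)) ⊗ₜ[k] (ι u * κ h₂) := by
  simp only [← map_mul (κ)]
  simp only [← mk_eq]
  simp only [comulAux, mk, LinearMap.comp_apply, LinearEquiv.coe_coe,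
    LinearEquiv.symm_apply_apply, leftBiproduct_comul_tmul, map_sw, TensorProduct.map_tmul]

theorem comulAux_inrH (h : H) : comulAux 𝓒 (κ h) = sw (Δ h) fun h₁ h₂ => κ h₁ ⊗ₜ[k] κ h₂ := by
  rw [inrH_apply, comulAux_mk]
  simp (disch := fun_prop) only [𝓒.comul_one, 𝓒.coact_one, sw_pure, map_one, one_mul]

theorem comulAux_inlC (c : C) : comulAux 𝓒 (ι c) =
    sw (Δ c) fun c₁ c₂ => sw (𝓒.coact c₂) fun g u => (ι c₁ * κ g) ⊗ₜ[k] ι u := by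
  rw [inlC_apply, comulAux_mk]
  simp (disch := fun_prop) only [sw_comul_one, map_one, mul_one]

/-- The braiding contributes `a₂⁽¹⁾ ▷ b₁`, which also arises from moving `a₂⁽¹⁾` to the right past
`b₁` in the product of coproducts. Comodule coassociativity for `a₂` matches the remaining
`H`-factors. -/
theorem comulAux_inlC_mul (a b : C) :
    comulAux 𝓒 (ι (a * b)) = comulAux 𝓒 (ι a) * comulAux 𝓒 (ι b) := by
  simp only [comulAux_inlC, sw_mul, mul_sw, Algebra.TensorProduct.tmul_mul_tmul]
  simp (disch := fun_prop) only [𝓒.sw_comul_mul, 𝓒.sw_coact_mul, mul_assoc, inrH_mul_inlC_mul,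
    sw_tmul, mul_sw, map_mul]
  rw [sw_comm]
  refine sw_congr fun b₁ b₂ => ?_
  rw [sw_comm (𝓒.coact b₂)]
  refine sw_congr fun a₁ a₂ => (𝓒.sw_coact_coassoc a₂ (fun g h w =>
    sw (𝓒.coact b₂) fun g' u' => (ι a₁ * (ι (𝓒.act (g ⊗ₜ[k] b₁)) * (κ h * κ g'))) ⊗ₜ[k]
      (ι w * ι u')) (by fun_prop) (by fun_prop) (by fun_prop)).trans ?_
  simp only [sw_comm (𝓒.coact b₂)]

theorem comulAux_comm (h : H) (b : C) : comulAux 𝓒 (κ h) * comulAux 𝓒 (ι b) =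
    sw (Δ h) fun h₁ h₂ => comulAux 𝓒 (ι (𝓒.act (h₁ ⊗ₜ[k] b))) * comulAux 𝓒 (κ h₂) := by
  simp only [comulAux_inrH, comulAux_inlC, sw_mul, mul_sw, Algebra.TensorProduct.tmul_mul_tmul]
  simp (disch := fun_prop) only [𝓒.sw_comul_act, inrH_mul_inlC, inrH_mul_inlC_mul, mul_assoc,
    sw_tmul, tmul_sw, sw_comm (Δ b), sw_comm (𝓒.coact _)]
  -- As for `B`, the regrouping isolates the middle part `s` of `h`, where the crossed-module axiom
  -- is applied to `s` and `b₂`.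
  calc _ = sw (Δ h) fun a y => sw (Δ a) fun p s => sw (Δ b) fun b₁ b₂ =>
        sw (Δ s) fun q x => sw (𝓒.coact b₂) fun g u =>
          (ι (𝓒.act (p ⊗ₜ[k] b₁)) * (κ q * κ g)) ⊗ₜ[k] (ι (𝓒.act (x ⊗ₜ[k] u)) * κ y) := by
        simp (disch := fun_prop) only [sw_comm (Δ b), ← sw_coassoc]
    _ = sw (Δ h) fun a y => sw (Δ a) fun p s => sw (Δ b) fun b₁ b₂ => sw (Δ s) fun q x =>
        sw (𝓒.coact (𝓒.act (q ⊗ₜ[k] b₂))) fun g u =>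
          (ι (𝓒.act (p ⊗ₜ[k] b₁)) * (κ g * κ x)) ⊗ₜ[k] (ι u * κ y) := by
        refine sw_congr fun a y => sw_congr fun p s => sw_congr fun b₁ b₂ => ?_
        simpa only [map_mul] using 𝓒.sw_crossed s b₂
          (fun g u => (ι (𝓒.act (p ⊗ₜ[k] b₁)) * κ g) ⊗ₜ[k] (ι u * κ y))
          (by fun_prop) (by fun_prop)
    _ = _ := by
        simp (disch := fun_prop) only [sw_comm (Δ b), ← sw_coassoc]

/-- The restriction of the coproduct to `C`, as an algebra map. -/
def comulC : C →ₐ[k] LeftBi 𝓒 ⊗[k] LeftBi 𝓒 :=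
  AlgHom.ofLinearMap (comulAux 𝓒 ∘ₗ (ι).toLinearMap)
    (by
      simp only [LinearMap.comp_apply, AlgHom.toLinearMap_apply, comulAux_inlC]
      simp (disch := fun_prop) only [𝓒.comul_one, sw_pure, 𝓒.coact_one, map_one, mul_one,
        Algebra.TensorProduct.one_def])
    (comulAux_inlC_mul 𝓒)

theorem comulC_apply (c : C) : comulC 𝓒 c = comulAux 𝓒 (ι c) := rfl

theorem map_comul_inrH (h : H) : Algebra.TensorProduct.map κ κ (Δ h) = comulAux 𝓒 (κ h) := by
  rw [comulAux_inrH]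
  conv_lhs => rw [← sw_tmul_eq (Δ h)]
  simp only [algHom_sw, Algebra.TensorProduct.map_tmul]

/-- The coproduct as an algebra map. -/
def comulAlg : LeftBi 𝓒 →ₐ[k] LeftBi 𝓒 ⊗[k] LeftBi 𝓒 :=
  lift 𝓒 (comulC 𝓒) ((Algebra.TensorProduct.map κ κ).comp (Bialgebra.comulAlgHom k H)) (by
    simp only [AlgHom.comp_apply, Bialgebra.comulAlgHom_apply, map_comul_inrH, comulC_apply]
    exact comulAux_comm 𝓒)

theorem comulAlg_mk (c : C) (h : H) : comulAlg 𝓒 (mk 𝓒 c h) = comulAux 𝓒 (mk 𝓒 c h) := by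
  rw [comulAlg, lift_mk]
  simp only [AlgHom.comp_apply, Bialgebra.comulAlgHom_apply, map_comul_inrH, comulC_apply]
  simp only [comulAux_inrH, comulAux_inlC, comulAux_mk, sw_mul, mul_sw,
    Algebra.TensorProduct.tmul_mul_tmul]
  rw [sw_comm]
  simp only [sw_comm (Δ h), mul_assoc]

theorem comulAlg_eq (x : LeftBi 𝓒) : comulAlg 𝓒 x = comulAux 𝓒 x := by
  induction x using induction with
  | ha x y hx hy => rw [map_add, map_add, hx, hy]
  | hm c h => exact comulAlg_mk 𝓒 c h

theorem comulAlg_inrH (h : H) : comulAlg 𝓒 (κ h) = sw (Δ h) fun h₁ h₂ => κ h₁ ⊗ₜ[k] κ h₂ := by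
  rw [comulAlg_eq, comulAux_inrH]

theorem comulAlg_inlC (c : C) : comulAlg 𝓒 (ι c) =
    sw (Δ c) fun c₁ c₂ => sw (𝓒.coact c₂) fun g u => (ι c₁ * κ g) ⊗ₜ[k] ι u := by
  rw [comulAlg_eq, comulAux_inlC]

/-- The counit of `C`, as an algebra map. -/
def counitC : C →ₐ[k] k := AlgHom.ofLinearMap ε 𝓒.counit_one 𝓒.counit_mul

theorem counitC_apply (c : C) : counitC 𝓒 c = ε c := rfl

/-- The counit as an algebra map. -/
def counitAlg : LeftBi 𝓒 →ₐ[k] k :=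
  lift 𝓒 (counitC 𝓒) (Bialgebra.counitAlgHom k H) fun h c => by
    simp only [Bialgebra.counitAlgHom_apply, counitC_apply, 𝓒.counit_act]
    simp only [mul_assoc, mul_comm (ε h) (ε c)]
    exact (sw_counit_left (k := k) h (fun x => ε c * ε x) (by fun_prop)).symm

theorem counitAlg_mk (c : C) (h : H) : counitAlg 𝓒 (mk 𝓒 c h) = ε c * ε h :=
  lift_mk ..

theorem counitAlg_inrH (h : H) : counitAlg 𝓒 (κ h) = ε h := by
  rw [inrH_apply, counitAlg_mk, 𝓒.counit_one, one_mul]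

theorem counitAlg_inlC (c : C) : counitAlg 𝓒 (ι c) = ε c := by
  rw [inlC_apply, counitAlg_mk, Bialgebra.counit_one, mul_one]

theorem coassoc_aux : (Algebra.TensorProduct.assoc k k k _ _ _).toAlgHom.comp
    ((Algebra.TensorProduct.map (comulAlg 𝓒) (.id k _)).comp (comulAlg 𝓒)) =
      (Algebra.TensorProduct.map (.id k _) (comulAlg 𝓒)).comp (comulAlg 𝓒) := by
  refine algHom_ext (fun b => ?_) fun h => ?_
  · simp only [AlgHom.comp_apply, comulAlg_inlC, algHom_sw, Algebra.TensorProduct.map_tmul,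
      sw_tmul, tmul_sw, AlgEquiv.toAlgHom_apply, Algebra.TensorProduct.assoc_tmul, AlgHom.id_apply,
      map_mul, comulAlg_inrH, sw_mul, mul_sw, Algebra.TensorProduct.tmul_mul_tmul]
    simp (disch := fun_prop) only [𝓒.sw_coact_comul]
    -- The common form of the two sides is `c₁ c₂⁽¹⁾ c₃⁽¹⁾₁ ⊗ c₂⁽²⁾ c₃⁽¹⁾₂ ⊗ c₃⁽²⁾`, for the element
    -- of `C` whose threefold coproduct is `c₁ ⊗ c₂ ⊗ c₃`.
    refine Eq.symm (Eq.trans ?_ ((sw_coassoc b (fun d c a => sw (𝓒.coact a) fun g v =>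
      sw (𝓒.coact c) fun h w => sw (Δ g) fun g₁ g₂ => (ι d * (κ h * κ g₁)) ⊗ₜ[k]
        ((ι w * κ g₂) ⊗ₜ[k] ι v))
      (by fun_prop) (by fun_prop) (by fun_prop)).symm.trans ?_))
    · refine sw_congr fun d a => sw_congr fun b₁ b₂ => ?_
      refine Eq.trans ?_ ((𝓒.sw_coact_coassoc b₂ (fun g f v => sw (𝓒.coact b₁) fun h w =>
        (ι d * (κ h * κ g)) ⊗ₜ[k] ((ι w * κ f) ⊗ₜ[k] ι v))
        (by fun_prop) (by fun_prop) (by fun_prop)).trans ?_)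
      · rw [sw_comm]
        refine sw_congr fun u g => ?_
        rw [sw_comm]
        simp only [map_mul]
      · refine sw_congr fun u g => ?_
        rw [sw_comm]
    · refine sw_congr fun a c => ?_
      rw [sw_comm]
      refine sw_congr fun g u => ?_
      simp only [sw_comm (Δ g), mul_assoc]
  · simp only [AlgHom.comp_apply, comulAlg_inrH, algHom_sw, Algebra.TensorProduct.map_tmul,
      sw_tmul, tmul_sw, AlgEquiv.toAlgHom_apply, Algebra.TensorProduct.assoc_tmul, AlgHom.id_apply]
    simp (disch := fun_prop) only [sw_coassoc]

theorem counit_comul_aux : (Algebra.TensorProduct.map (counitAlg 𝓒) (.id k (LeftBi 𝓒))).comp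
    (comulAlg 𝓒) = (Algebra.TensorProduct.lid k (LeftBi 𝓒)).symm := by
  have hs : ∀ (a : k) (x : LeftBi 𝓒), a ⊗ₜ[k] x = a • ((1 : k) ⊗ₜ[k] x) := fun a x => by
    rw [TensorProduct.smul_tmul', smul_eq_mul, mul_one]
  refine algHom_ext (fun c => ?_) fun h => ?_
  · simp only [AlgHom.comp_apply, comulAlg_inlC, algHom_sw, Algebra.TensorProduct.map_tmul,
      map_mul, counitAlg_inrH, counitAlg_inlC, AlgHom.id_apply]
    simp only [hs (ε _ * _), mul_smul]
    simp (disch := fun_prop) only [← smul_sw, 𝓒.sw_coact_counit]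
    exact sw_counit_left c (fun x => (1 : k) ⊗ₜ[k] ι x) (by fun_prop)
  · simp only [AlgHom.comp_apply, comulAlg_inrH, algHom_sw, Algebra.TensorProduct.map_tmul,
      counitAlg_inrH, AlgHom.id_apply]
    simp only [hs (ε _)]
    exact sw_counit_left h (fun x => (1 : k) ⊗ₜ[k] κ x) (by fun_prop)

theorem comul_counit_aux : (Algebra.TensorProduct.map (.id k (LeftBi 𝓒)) (counitAlg 𝓒)).comp
    (comulAlg 𝓒) = (Algebra.TensorProduct.rid k k (LeftBi 𝓒)).symm := by
  have hs : ∀ (a : k) (x : LeftBi 𝓒), x ⊗ₜ[k] a = a • (x ⊗ₜ[k] (1 : k)) := fun a x => by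
    rw [← TensorProduct.tmul_smul, smul_eq_mul, mul_one]
  refine algHom_ext (fun c => ?_) fun h => ?_
  · simp only [AlgHom.comp_apply, comulAlg_inlC, algHom_sw, Algebra.TensorProduct.map_tmul,
      counitAlg_inlC, AlgHom.id_apply]
    simp only [hs (ε _)]
    simp (disch := fun_prop) only [𝓒.sw_coact_counit', map_one, mul_one]
    exact sw_counit_right c (fun x => ι x ⊗ₜ[k] (1 : k)) (by fun_prop)
  · simp only [AlgHom.comp_apply, comulAlg_inrH, algHom_sw, Algebra.TensorProduct.map_tmul,
      counitAlg_inrH, AlgHom.id_apply]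
    simp only [hs (ε _)]
    exact sw_counit_right h (fun x => κ x ⊗ₜ[k] (1 : k)) (by fun_prop)

instance : Bialgebra k (LeftBi 𝓒) :=
  Bialgebra.ofAlgHom (comulAlg 𝓒) (counitAlg 𝓒) (coassoc_aux 𝓒) (counit_comul_aux 𝓒)
    (comul_counit_aux 𝓒)

/-- The antipode. -/
def antipodeAux : LeftBi 𝓒 →ₗ[k] LeftBi 𝓒 :=
  (equiv 𝓒).toLinearMap ∘ₗ (leftBiproduct 𝓒).antipode ∘ₗ (equiv 𝓒).symm.toLinearMap

theorem antipodeAux_mk (c : C) (h : H) : antipodeAux 𝓒 (mk 𝓒 c h) =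
    sw (𝓒.coact c) fun g u => κ (HopfAlgebra.antipode k (g * h)) * ι (𝓒.antipode u) := by
  simp only [inrH_mul_inlC, ← mk_eq]
  simp only [antipodeAux, mk, LinearMap.comp_apply, LinearEquiv.coe_coe,
    LinearEquiv.symm_apply_apply, leftBiproduct_antipode_tmul, equiv_sw]

/-- The order of cancellation is opposite to that in `H ⋉ B`: for the left inverse the braided
antipode collapses first, after the coaction has been taken before the coproduct, and then the
antipode of `H`. -/
theorem antipodeAux_left (c : C) (h : H) :
    LinearMap.mul' k _ (LinearMap.rTensor _ (antipodeAux 𝓒) (comulAux 𝓒 (mk 𝓒 c h))) =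
      (ε c * ε h) • 1 := by
  rw [comulAux_mk]
  simp only [← map_mul (κ)]
  simp only [← mk_eq, map_sw, LinearMap.rTensor_tmul, LinearMap.mul'_apply, antipodeAux_mk]
  simp only [mk_eq, sw_mul, ← mul_assoc]
  calc _ = sw (Δ h) fun h₁ h₂ => sw (𝓒.coact c) fun g u => sw (Δ u) fun u₁ u₂ =>
        κ (HopfAlgebra.antipode k (g * h₁)) * ι (𝓒.antipode u₁ * u₂) * κ h₂ := by
        simp (disch := fun_prop) only [𝓒.sw_coact_comul, map_mul, mul_assoc]
        rw [sw_comm]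
        refine sw_congr fun h₁ h₂ => sw_congr fun c₁ c₂ => ?_
        rw [sw_comm]
    _ = sw (Δ h) fun h₁ h₂ => ε c • (κ (HopfAlgebra.antipode k h₁ * h₂)) := by
        refine sw_congr fun h₁ h₂ => ?_
        simp only [fun u g => 𝓒.sw_antipode_left u (fun x =>
          κ (HopfAlgebra.antipode k (g * h₁)) * ι x * κ h₂) (by fun_prop), map_one, mul_one]
        rw [𝓒.sw_coact_counit' c (fun g => κ (HopfAlgebra.antipode k (g * h₁)) * κ h₂)
          (by fun_prop), one_mul, map_mul]
    _ = _ := by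
        rw [sw_hopf_left h (fun x => ε c • κ x) (by fun_prop), map_one, ← mul_smul,
          mul_comm (ε h)]

/-- The inner factor is `(g h)₁ S((g h)₂)` once comodule coassociativity has produced the coproduct
of `g`; removing it leaves the braided antipode identity in `C`. -/
theorem antipodeAux_right (c : C) (h : H) :
    LinearMap.mul' k _ (LinearMap.lTensor _ (antipodeAux 𝓒) (comulAux 𝓒 (mk 𝓒 c h))) =
      (ε c * ε h) • 1 := by
  rw [comulAux_mk]
  simp only [← mk_eq, map_sw, LinearMap.lTensor_tmul, LinearMap.mul'_apply, antipodeAux_mk]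
  simp only [mul_sw, mul_assoc]
  calc _ = sw (Δ c) fun c₁ c₂ => sw (𝓒.coact c₂) fun g u => sw (Δ g) fun g₁ g₂ =>
        sw (Δ h) fun h₁ h₂ => ι c₁ *
          (κ ((g₁ * h₁) * HopfAlgebra.antipode k (g₂ * h₂)) * ι (𝓒.antipode u)) := by
        refine sw_congr fun c₁ c₂ => ?_
        simp (disch := fun_prop) only [sw_comm (Δ h), 𝓒.sw_coact_coassoc, map_mul, mul_assoc]
    _ = sw (Δ c) fun c₁ c₂ => sw (𝓒.coact c₂) fun g u => ε g • ε h • ι (c₁ * 𝓒.antipode u) := by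
        refine sw_congr fun c₁ c₂ => sw_congr fun g u => ?_
        rw [← sw_comul_mul g h (fun x y => ι c₁ * (κ (x * HopfAlgebra.antipode k y) *
          ι (𝓒.antipode u))) (by fun_prop) (by fun_prop),
          sw_hopf_right (g * h) (fun x => ι c₁ * (κ x * ι (𝓒.antipode u))) (by fun_prop),
          map_one, one_mul, Bialgebra.counit_mul, mul_smul, map_mul]
    _ = _ := by
        simp (disch := fun_prop) only [𝓒.sw_coact_counit]
        rw [𝓒.sw_antipode_right c (fun x => ε h • ι x) (by fun_prop), map_one, ← mul_smul]

instance : HopfAlgebra k (LeftBi 𝓒) where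
  antipode := antipodeAux 𝓒
  mul_antipode_rTensor_comul := by
    ext x
    induction x using induction with
    | ha x y hx hy => rw [map_add, map_add, hx, hy]
    | hm c h =>
    change LinearMap.mul' k _ (LinearMap.rTensor _ (antipodeAux 𝓒) (comulAlg 𝓒 (mk 𝓒 c h))) =
      algebraMap k _ (counitAlg 𝓒 (mk 𝓒 c h))
    rw [comulAlg_eq, counitAlg_mk, antipodeAux_left, Algebra.algebraMap_eq_smul_one]
  mul_antipode_lTensor_comul := by
    ext x
    induction x using induction with
    | ha x y hx hy => rw [map_add, map_add, hx, hy]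
    | hm c h =>
    change LinearMap.mul' k _ (LinearMap.lTensor _ (antipodeAux 𝓒) (comulAlg 𝓒 (mk 𝓒 c h))) =
      algebraMap k _ (counitAlg 𝓒 (mk 𝓒 c h))
    rw [comulAlg_eq, counitAlg_mk, antipodeAux_right, Algebra.algebraMap_eq_smul_one]

end LeftBi

end LeftBiproduct

/-! ### Structure maps of the biproducts -/

section CoalgHom

variable {k D E X : Type*} [CommSemiring k] [AddCommMonoid D] [Module k D] [Coalgebra k D]
  [AddCommMonoid E] [Module k E] [Coalgebra k E] [AddCommMonoid X] [Module k X]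

@[fun_prop]
theorem Lin.coalgHom (φ : D →ₗc[k] E) : Lin k (fun x => φ x) := ⟨map_add φ, map_smul φ⟩

@[fun_prop]
theorem Lin.bialgHom {A A' : Type*} [Semiring A] [Semiring A'] [Bialgebra k A] [Bialgebra k A']
    (φ : A →ₐc[k] A') : Lin k (fun x => φ x) := ⟨map_add φ, map_smul φ⟩

theorem sw_comul_map {Φ : Type*} [FunLike Φ D E] [CoalgHomClass Φ k D E] (φ : Φ) (x : D)
    (F : E → E → X) (h₁ : ∀ b, Lin k (fun a => F a b)) (h₂ : ∀ a, Lin k (fun b => F a b)) :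
    sw (Coalgebra.comul (R := k) (φ x)) F =
      sw (Coalgebra.comul (R := k) x) fun a b => F (φ a) (φ b) := by
  rw [← CoalgHomClass.map_comp_comul_apply]
  conv_lhs => rw [← sw_tmul_eq (Coalgebra.comul (R := k) x)]
  simp (disch := fun_prop) only [map_sw, sw_sw, TensorProduct.map_tmul, sw_pure]
  rfl

end CoalgHom

/-! ### Inclusion of `H` in `H ⋉ B` and projections to `H` and `B` -/

section RightStructure

variable {k H B X : Type*} [Field k] [Ring H] [HopfAlgebra k H] [Ring B] [Algebra k B]
  [Coalgebra k B] [AddCommGroup X] [Module k X] (𝓑 : RightBraidedGroup k H B)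

local notation "Δ" => Coalgebra.comul (R := k)
local notation "ε" => Coalgebra.counit (R := k)

namespace RightBi

local notation "ι" => inlH 𝓑
local notation "κ" => inrB 𝓑

theorem counit_mk (h : H) (b : B) : ε (mk 𝓑 h b) = ε h * ε b := counitAlg_mk 𝓑 h b

theorem counit_inlH (h : H) : ε (ι h) = ε h := counitAlg_inlH 𝓑 h

theorem counit_inrB (b : B) : ε (κ b) = ε b := counitAlg_inrB 𝓑 b

theorem comul_mk (h : H) (b : B) : Δ (mk 𝓑 h b) =
    sw (Δ h) fun h₁ h₂ => sw (Δ b) fun b₁ b₂ => sw (𝓑.coact b₁) fun u g =>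
      mk 𝓑 h₁ u ⊗ₜ[k] mk 𝓑 (h₂ * g) b₂ :=
  (comulAlg_mk 𝓑 h b).trans (by rw [comulAux_mk]; simp only [mk_eq, map_mul, mul_assoc])

theorem comul_inlH (h : H) : Δ (ι h) = sw (Δ h) fun h₁ h₂ => ι h₁ ⊗ₜ[k] ι h₂ :=
  comulAlg_inlH 𝓑 h

theorem comul_inrB (b : B) : Δ (κ b) =
    sw (Δ b) fun b₁ b₂ => sw (𝓑.coact b₁) fun u g => κ u ⊗ₜ[k] (ι g * κ b₂) :=
  comulAlg_inrB 𝓑 b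

/-- The inclusion of `H`, as a map of bialgebras. -/
def incl : H →ₐc[k] RightBi 𝓑 :=
  BialgHom.ofAlgHom (inlH 𝓑) (AlgHom.ext fun h => counit_inlH 𝓑 h) (AlgHom.ext fun h => by
    change TensorProduct.map (inlH 𝓑).toLinearMap (inlH 𝓑).toLinearMap (Δ h) = Δ (ι h)
    rw [comul_inlH]
    conv_lhs => rw [← sw_tmul_eq (Δ h)]
    simp only [map_sw, TensorProduct.map_tmul]
    rfl)

theorem incl_apply (h : H) : incl 𝓑 h = ι h := rfl

/-- The projection to `H`, as a map of algebras. -/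
def projAlg : RightBi 𝓑 →ₐ[k] H :=
  lift 𝓑 (AlgHom.id k H) ((Algebra.ofId k H).comp (counitB 𝓑)) fun b h => by
    simp only [AlgHom.comp_apply, counitB_apply, AlgHom.id_apply, Algebra.ofId_apply,
      Algebra.algebraMap_eq_smul_one, 𝓑.counit_act, smul_mul_assoc, one_mul, mul_smul_comm, mul_one]
    simp only [mul_smul]
    exact (sw_counit_right (k := k) h (fun x => ε b • x) (by fun_prop)).symm.trans
      (sw_congr fun _ _ => smul_comm ..)

theorem projAlg_mk (h : H) (b : B) : projAlg 𝓑 (mk 𝓑 h b) = ε b • h := by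
  rw [projAlg, lift_mk]
  simp only [AlgHom.comp_apply, counitB_apply, AlgHom.id_apply, Algebra.ofId_apply,
    Algebra.algebraMap_eq_smul_one, mul_smul_comm, mul_one]

theorem projAlg_inlH (h : H) : projAlg 𝓑 (ι h) = h := by
  rw [inlH_apply, projAlg_mk, 𝓑.counit_one, one_smul]

theorem projAlg_inrB (b : B) : projAlg 𝓑 (κ b) = ε b • 1 := by
  rw [inrB_apply, projAlg_mk]

/-- The projection to `H`, as a map of bialgebras. -/
def proj : RightBi 𝓑 →ₐc[k] H :=
  BialgHom.ofAlgHom (projAlg 𝓑)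
    (algHom_ext
      (fun h => by
        simp only [AlgHom.comp_apply, Bialgebra.counitAlgHom_apply, projAlg_inlH, counit_inlH])
      (fun b => by
        simp only [AlgHom.comp_apply, Bialgebra.counitAlgHom_apply, projAlg_inrB, counit_inrB,
          map_smul, Bialgebra.counit_one, smul_eq_mul, mul_one]))
    (algHom_ext
      (fun h => by
        simp only [AlgHom.comp_apply, Bialgebra.comulAlgHom_apply, projAlg_inlH, comul_inlH,
          algHom_sw, Algebra.TensorProduct.map_tmul, sw_tmul_eq])
      (fun b => by
        simp only [AlgHom.comp_apply, Bialgebra.comulAlgHom_apply, projAlg_inrB, comul_inrB,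
          algHom_sw, Algebra.TensorProduct.map_tmul, map_mul, projAlg_inlH, map_smul,
          Bialgebra.comul_one, mul_smul_comm, mul_one, TensorProduct.tmul_smul,
          ← TensorProduct.smul_tmul', ← smul_sw]
        simp (disch := fun_prop) only [𝓑.sw_coact_counit']
        exact sw_counit_right b (fun v => ε v • (1 : H) ⊗ₜ[k] (1 : H)) (by fun_prop)))

theorem proj_mk (h : H) (b : B) : proj 𝓑 (mk 𝓑 h b) = ε b • h := projAlg_mk 𝓑 h b

theorem proj_incl (h : H) : proj 𝓑 (ι h) = h := by
  rw [inlH_apply, proj_mk, 𝓑.counit_one, one_smul]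

/-- The map `h ⊗ b ↦ ε(h) b`, as a linear map. -/
def projBLin : RightBi 𝓑 →ₗ[k] B :=
  ofBilin (fun h b => ε h • b) (by fun_prop) (by fun_prop) ∘ₗ (equiv 𝓑).symm.toLinearMap

theorem projBLin_mk (h : H) (b : B) : projBLin 𝓑 (mk 𝓑 h b) = ε h • b := by
  simp only [projBLin, mk, LinearMap.comp_apply, LinearEquiv.coe_coe,
    LinearEquiv.symm_apply_apply, ofBilin_tmul]

/-- The map `h ⊗ b ↦ ε(h) b`, as a map of coalgebras. -/
def projB : RightBi 𝓑 →ₗc[k] B :=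
  { projBLin 𝓑 with
    counit_comp := LinearMap.ext fun x => by
      change ε (projBLin 𝓑 x) = ε x
      induction x using induction with
      | ha x y hx hy => simp only [map_add, hx, hy]
      | hm h b => rw [projBLin_mk, counit_mk, map_smul, smul_eq_mul]
    map_comp_comul := LinearMap.ext fun x => by
      change TensorProduct.map (projBLin 𝓑) (projBLin 𝓑) (Δ x) = Δ (projBLin 𝓑 x)
      induction x using induction with
      | ha x y hx hy => simp only [map_add, hx, hy]
      | hm h b =>
        simp only [comul_mk, projBLin_mk, map_sw, TensorProduct.map_tmul, Bialgebra.counit_mul,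
          mul_smul, TensorProduct.tmul_smul, ← TensorProduct.smul_tmul', ← smul_sw]
        simp (disch := fun_prop) only [← smul_sw, 𝓑.sw_coact_counit]
        exact (sw_counit_right h (fun x => ε x • sw (Δ b) fun b₁ b₂ => b₁ ⊗ₜ[k] b₂)
          (by fun_prop)).trans (by rw [sw_tmul_eq, map_smul]) }

theorem projB_mk (h : H) (b : B) : projB 𝓑 (mk 𝓑 h b) = ε h • b := projBLin_mk 𝓑 h b

/-- The projection to `B` is not multiplicative, but it is linear over `H ⋉ B` for its right action
on `B`, in which `H` acts by `◁` and `B` by multiplication. This controls `(x y)_B` in the cocycle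
identity. -/
theorem projB_mul_mk (a : RightBi 𝓑) (h : H) (b : B) :
    projB 𝓑 (a * mk 𝓑 h b) = 𝓑.act (projB 𝓑 a ⊗ₜ[k] h) * b := by
  induction a using induction with
  | ha x y hx hy => simp only [map_add, add_mul, TensorProduct.add_tmul, hx, hy]
  | hm h' b' =>
    rw [mk_mul_mk, lin_sw (k := k) (fun x => projB 𝓑 x) (by fun_prop)]
    simp only [projB_mk, Bialgebra.counit_mul, mul_smul, ← smul_sw]
    rw [sw_counit_left h (fun x => 𝓑.act (b' ⊗ₜ[k] x) * b) (by fun_prop),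
      ← TensorProduct.smul_tmul', map_smul, smul_mul_assoc]

end RightBi

end RightStructure

/-! ### Inclusion of `H` in `C ⋊ H` and projections to `H` and `C` -/

section LeftStructure

variable {k H C X : Type*} [Field k] [Ring H] [HopfAlgebra k H] [Ring C] [Algebra k C]
  [Coalgebra k C] [AddCommGroup X] [Module k X] (𝓒 : LeftBraidedGroup k H C)

local notation "Δ" => Coalgebra.comul (R := k)
local notation "ε" => Coalgebra.counit (R := k)

namespace LeftBi

local notation "ι" => inlC 𝓒
local notation "κ" => inrH 𝓒

theorem counit_mk (c : C) (h : H) : ε (mk 𝓒 c h) = ε c * ε h := counitAlg_mk 𝓒 c h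

theorem counit_inlC (c : C) : ε (ι c) = ε c := counitAlg_inlC 𝓒 c

theorem counit_inrH (h : H) : ε (κ h) = ε h := counitAlg_inrH 𝓒 h

theorem comul_mk (c : C) (h : H) : Δ (mk 𝓒 c h) =
    sw (Δ c) fun c₁ c₂ => sw (Δ h) fun h₁ h₂ => sw (𝓒.coact c₂) fun g u =>
      mk 𝓒 c₁ (g * h₁) ⊗ₜ[k] mk 𝓒 u h₂ :=
  (comulAlg_mk 𝓒 c h).trans (by rw [comulAux_mk]; simp only [mk_eq, map_mul])

theorem comul_inrH (h : H) : Δ (κ h) = sw (Δ h) fun h₁ h₂ => κ h₁ ⊗ₜ[k] κ h₂ :=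
  comulAlg_inrH 𝓒 h

theorem comul_inlC (c : C) : Δ (ι c) =
    sw (Δ c) fun c₁ c₂ => sw (𝓒.coact c₂) fun g u => (ι c₁ * κ g) ⊗ₜ[k] ι u :=
  comulAlg_inlC 𝓒 c

/-- The inclusion of `H`, as a map of bialgebras. -/
def incl : H →ₐc[k] LeftBi 𝓒 :=
  BialgHom.ofAlgHom (inrH 𝓒) (AlgHom.ext fun h => counit_inrH 𝓒 h) (AlgHom.ext fun h => by
    change TensorProduct.map (inrH 𝓒).toLinearMap (inrH 𝓒).toLinearMap (Δ h) = Δ (κ h)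
    rw [comul_inrH]
    conv_lhs => rw [← sw_tmul_eq (Δ h)]
    simp only [map_sw, TensorProduct.map_tmul]
    rfl)

theorem incl_apply (h : H) : incl 𝓒 h = κ h := rfl

/-- The projection to `H`, as a map of algebras. -/
def projAlg : LeftBi 𝓒 →ₐ[k] H :=
  lift 𝓒 ((Algebra.ofId k H).comp (counitC 𝓒)) (AlgHom.id k H) fun h c => by
    simp only [AlgHom.comp_apply, counitC_apply, AlgHom.id_apply, Algebra.ofId_apply,
      Algebra.algebraMap_eq_smul_one, 𝓒.counit_act, smul_mul_assoc, one_mul, mul_smul_comm, mul_one]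
    simp only [mul_smul]
    exact (sw_counit_left (k := k) h (fun x => ε c • x) (by fun_prop)).symm

theorem projAlg_mk (c : C) (h : H) : projAlg 𝓒 (mk 𝓒 c h) = ε c • h := by
  rw [projAlg, lift_mk]
  simp only [AlgHom.comp_apply, counitC_apply, AlgHom.id_apply, Algebra.ofId_apply,
    Algebra.algebraMap_eq_smul_one, smul_mul_assoc, one_mul]

theorem projAlg_inrH (h : H) : projAlg 𝓒 (κ h) = h := by
  rw [inrH_apply, projAlg_mk, 𝓒.counit_one, one_smul]

theorem projAlg_inlC (c : C) : projAlg 𝓒 (ι c) = ε c • 1 := by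
  rw [inlC_apply, projAlg_mk]

/-- The projection to `H`, as a map of bialgebras. -/
def proj : LeftBi 𝓒 →ₐc[k] H :=
  BialgHom.ofAlgHom (projAlg 𝓒)
    (algHom_ext
      (fun c => by
        simp only [AlgHom.comp_apply, Bialgebra.counitAlgHom_apply, projAlg_inlC, counit_inlC,
          map_smul, Bialgebra.counit_one, smul_eq_mul, mul_one])
      (fun h => by
        simp only [AlgHom.comp_apply, Bialgebra.counitAlgHom_apply, projAlg_inrH, counit_inrH]))
    (algHom_ext
      (fun c => by
        simp only [AlgHom.comp_apply, Bialgebra.comulAlgHom_apply, projAlg_inlC, comul_inlC,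
          algHom_sw, Algebra.TensorProduct.map_tmul, map_mul, projAlg_inrH, map_smul,
          Bialgebra.comul_one, smul_mul_assoc, one_mul, TensorProduct.tmul_smul,
          ← TensorProduct.smul_tmul']
        simp (disch := fun_prop) only [𝓒.sw_coact_counit']
        exact sw_counit_right c (fun v => ε v • (1 : H) ⊗ₜ[k] (1 : H)) (by fun_prop))
      (fun h => by
        simp only [AlgHom.comp_apply, Bialgebra.comulAlgHom_apply, projAlg_inrH, comul_inrH,
          algHom_sw, Algebra.TensorProduct.map_tmul, sw_tmul_eq]))

theorem proj_mk (c : C) (h : H) : proj 𝓒 (mk 𝓒 c h) = ε c • h := projAlg_mk 𝓒 c h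

/-- The map `c ⊗ h ↦ c ε(h)`, as a linear map. -/
def projCLin : LeftBi 𝓒 →ₗ[k] C :=
  ofBilin (fun c h => ε h • c) (by fun_prop) (by fun_prop) ∘ₗ (equiv 𝓒).symm.toLinearMap

theorem projCLin_mk (c : C) (h : H) : projCLin 𝓒 (mk 𝓒 c h) = ε h • c := by
  simp only [projCLin, mk, LinearMap.comp_apply, LinearEquiv.coe_coe,
    LinearEquiv.symm_apply_apply, ofBilin_tmul]

/-- The map `c ⊗ h ↦ c ε(h)`, as a map of coalgebras. -/
def projC : LeftBi 𝓒 →ₗc[k] C :=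
  { projCLin 𝓒 with
    counit_comp := LinearMap.ext fun x => by
      change ε (projCLin 𝓒 x) = ε x
      induction x using induction with
      | ha x y hx hy => simp only [map_add, hx, hy]
      | hm c h => rw [projCLin_mk, counit_mk, map_smul, smul_eq_mul, mul_comm]
    map_comp_comul := LinearMap.ext fun x => by
      change TensorProduct.map (projCLin 𝓒) (projCLin 𝓒) (Δ x) = Δ (projCLin 𝓒 x)
      induction x using induction with
      | ha x y hx hy => simp only [map_add, hx, hy]
      | hm c h =>
        simp only [comul_mk, projCLin_mk, map_sw, TensorProduct.map_tmul, Bialgebra.counit_mul,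
          mul_smul, TensorProduct.tmul_smul, ← TensorProduct.smul_tmul', ← smul_sw]
        simp (disch := fun_prop) only [𝓒.sw_coact_counit]
        refine (sw_congr fun v w =>
          sw_counit_right h (fun x => ε x • v ⊗ₜ[k] w) (by fun_prop)).trans ?_
        rw [← smul_sw, sw_tmul_eq, map_smul] }

theorem projC_mk (c : C) (h : H) : projC 𝓒 (mk 𝓒 c h) = ε h • c := projCLin_mk 𝓒 c h

/-- The counterpart for `C`: the projection is linear over `C ⋊ H` for its left action on `C`. This
controls `(x y)_C` in the cocycle identity. -/
theorem projC_mk_mul (c : C) (h : H) (a : LeftBi 𝓒) :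
    projC 𝓒 (mk 𝓒 c h * a) = c * 𝓒.act (h ⊗ₜ[k] projC 𝓒 a) := by
  induction a using induction with
  | ha x y hx hy => simp only [map_add, mul_add, TensorProduct.tmul_add, hx, hy]
  | hm c' h' =>
    rw [mk_mul_mk, lin_sw (k := k) (fun x => projC 𝓒 x) (by fun_prop)]
    simp only [projC_mk, Bialgebra.counit_mul, mul_smul]
    rw [sw_counit_right h (fun x => ε h' • (c * 𝓒.act (x ⊗ₜ[k] c'))) (by fun_prop),
      TensorProduct.tmul_smul, map_smul, mul_smul_comm]

end LeftBi

end LeftStructure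

/-! ### Linearity of `sw` in the tensor -/

section Linearity

variable {k V W X : Type*} [CommSemiring k] [AddCommMonoid V] [AddCommMonoid W] [AddCommMonoid X]
  [Module k V] [Module k W] [Module k X]

theorem sw_add_left (s t : V ⊗[k] W) (F : V → W → X) (h₁ : ∀ w, Lin k (fun v => F v w))
    (h₂ : ∀ v, Lin k (fun w => F v w)) : sw (s + t) F = sw s F + sw t F :=
  (Lin.sw_left F h₁ h₂).add _ _

theorem sw_smul_left (r : k) (t : V ⊗[k] W) (F : V → W → X) (h₁ : ∀ w, Lin k (fun v => F v w))
    (h₂ : ∀ v, Lin k (fun w => F v w)) : sw (r • t) F = r • sw t F :=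
  (Lin.sw_left F h₁ h₂).smul _ _

end Linearity

/-! ### Change of Hopf algebra along a split bialgebra map -/

section Extend

variable {k H A C : Type*} [Field k] [Ring H] [HopfAlgebra k H] [Ring A] [HopfAlgebra k A]
  [Ring C] [Algebra k C] [Coalgebra k C]

local notation "Δ" => Coalgebra.comul (R := k)
local notation "ε" => Coalgebra.counit (R := k)

section LeftOps

variable {V W : Type*} [AddCommGroup V] [Module k V] [AddCommGroup W] [Module k W]
  (𝓥 : LeftCrossedModule k H V) (𝓦 : LeftCrossedModule k H W)

theorem leftTensorAct_tmul (h : H) (v : V) (w : W) :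
    leftTensorAct 𝓥 𝓦 (h ⊗ₜ[k] (v ⊗ₜ[k] w)) =
      sw (Δ h) fun h₁ h₂ => 𝓥.act (h₁ ⊗ₜ[k] v) ⊗ₜ[k] 𝓦.act (h₂ ⊗ₜ[k] w) := by
  simp only [leftTensorAct, LinearMap.comp_apply, LinearMap.rTensor_tmul]
  conv_lhs => rw [← sw_tmul_eq (Δ h)]
  simp only [sw_tmul, map_sw, LinearEquiv.coe_coe, TensorProduct.tensorTensorTensorComm_tmul,
    TensorProduct.map_tmul]

theorem leftTensorCoact_tmul (v : V) (w : W) :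
    leftTensorCoact 𝓥 𝓦 (v ⊗ₜ[k] w) =
      sw (𝓥.coact v) fun g u => sw (𝓦.coact w) fun h x => (g * h) ⊗ₜ[k] (u ⊗ₜ[k] x) := by
  simp only [leftTensorCoact, LinearMap.comp_apply, TensorProduct.map_tmul]
  conv_lhs => rw [← sw_tmul_eq (𝓥.coact v), ← sw_tmul_eq (𝓦.coact w)]
  simp only [sw_tmul, tmul_sw, map_sw, LinearEquiv.coe_coe,
    TensorProduct.tensorTensorTensorComm_tmul, LinearMap.rTensor_tmul, LinearMap.mul'_apply]
  rw [sw_comm]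

theorem leftBraiding_tmul (v : V) (w : W) :
    leftBraiding 𝓥 𝓦 (v ⊗ₜ[k] w) =
      sw (𝓥.coact v) fun g u => 𝓦.act (g ⊗ₜ[k] w) ⊗ₜ[k] u := by
  simp only [leftBraiding, LinearMap.comp_apply, LinearMap.rTensor_tmul]
  conv_lhs => rw [← sw_tmul_eq (𝓥.coact v)]
  simp only [sw_tmul, map_sw, LinearEquiv.coe_coe, TensorProduct.rightComm_tmul,
    LinearMap.rTensor_tmul]

end LeftOps

/-- The crossed-module condition over `A` for the action restricted along `π : A → H` and the
coaction pushed forward along `i : H → A`. -/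
def LeftCrossedModule.IsCrossedAlong {V : Type*} [AddCommGroup V] [Module k V]
    (𝓥 : LeftCrossedModule k H V) (i : H →ₐc[k] A) (π : A →ₐc[k] H) : Prop :=
  ∀ (a : A) (v : V),
    (sw (Δ a) fun a₁ a₂ => sw (𝓥.coact v) fun g u =>
      (a₁ * i g) ⊗ₜ[k] 𝓥.act (π a₂ ⊗ₜ[k] u)) =
    sw (Δ a) fun a₁ a₂ => sw (𝓥.coact (𝓥.act (π a₁ ⊗ₜ[k] v))) fun g u =>
      (i g * a₂) ⊗ₜ[k] u

variable (i : H →ₐc[k] A) (π : A →ₐc[k] H)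

/-- The left crossed module over `A` obtained by restriction along `π` and push forward
along `i`. -/
def LeftCrossedModule.extend {V : Type*} [AddCommGroup V] [Module k V]
    (𝓥 : LeftCrossedModule k H V) (hc : 𝓥.IsCrossedAlong i π) : LeftCrossedModule k A V where
  act := 𝓥.act ∘ₗ LinearMap.rTensor V (π : A →ₗ[k] H)
  coact := LinearMap.rTensor V (i : H →ₗ[k] A) ∘ₗ 𝓥.coact
  one_act v := by simp [𝓥.one_act]
  mul_act g h v := by simp [𝓥.mul_act]
  counit_coact v := by
    rw [LinearMap.comp_apply, ← 𝓥.counit_coact, ← LinearMap.rTensor_comp_apply]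
    congr 2
    ext x
    exact CoalgHomClass.counit_comp_apply i x
  coact_coassoc v := by
    simp only [LinearMap.comp_apply]
    conv_lhs => rw [← sw_tmul_eq (𝓥.coact v)]
    conv_rhs => rw [← sw_tmul_eq (𝓥.coact v)]
    simp only [map_sw, equiv_sw, LinearMap.rTensor_tmul, LinearMap.lTensor_tmul,
      LinearMap.comp_apply]
    refine Eq.trans (Eq.trans (sw_congr fun g u => ?_)
      (𝓥.sw_coact_coassoc v (fun g h u => i g ⊗ₜ[k] (i h ⊗ₜ[k] u))
        (by fun_prop) (by fun_prop) (by fun_prop)).symm) (sw_congr fun g u => ?_)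
    · change TensorProduct.assoc k A A V (Δ (i g) ⊗ₜ[k] u) = _
      conv_lhs => rw [← sw_tmul_eq (Δ (i g))]
      rw [sw_tmul, equiv_sw]
      exact sw_comul_map i g (fun x y => x ⊗ₜ[k] (y ⊗ₜ[k] u)) (by fun_prop) (by fun_prop)
    · conv_rhs => rw [← sw_tmul_eq (𝓥.coact u)]
      simp only [map_sw, tmul_sw, LinearMap.rTensor_tmul]
      rfl
  crossed a v := by
    have := hc a v
    simp only [LinearMap.comp_apply]
    conv_lhs => rw [← sw_tmul_eq (𝓥.coact v), ← sw_tmul_eq (Δ a)]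
    conv_rhs => rw [← sw_tmul_eq (Δ a)]
    simp only [map_sw, sw_tmul, tmul_sw, equiv_sw, LinearMap.rTensor_tmul,
      LinearEquiv.coe_coe, TensorProduct.tensorTensorTensorComm_tmul, TensorProduct.map_tmul,
      LinearMap.mul'_apply, TensorProduct.rightComm_tmul, LinearMap.comp_apply]
    rw [sw_comm]
    refine this.trans (sw_congr fun a₁ a₂ => ?_)
    change _ = LinearMap.rTensor V (LinearMap.mul' k A) (TensorProduct.rightComm k A V A
      (LinearMap.rTensor V (i : H →ₗ[k] A) (𝓥.coact (𝓥.act (π a₁ ⊗ₜ[k] v))) ⊗ₜ[k] a₂))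
    conv_rhs => rw [← sw_tmul_eq (𝓥.coact (𝓥.act (π a₁ ⊗ₜ[k] v)))]
    simp only [map_sw, sw_tmul, equiv_sw, LinearMap.rTensor_tmul, TensorProduct.rightComm_tmul,
      LinearMap.mul'_apply]
    rfl

section Module

variable {V W X : Type*} [AddCommGroup V] [Module k V] [AddCommGroup W] [Module k W]
  [AddCommGroup X] [Module k X] (𝓥 : LeftCrossedModule k H V) (hc : 𝓥.IsCrossedAlong i π)
  (𝓦 : LeftCrossedModule k H W) (hd : 𝓦.IsCrossedAlong i π)

theorem LeftCrossedModule.extend_act (a : A) (v : V) :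
    (𝓥.extend i π hc).act (a ⊗ₜ[k] v) = 𝓥.act (π a ⊗ₜ[k] v) := rfl

theorem LeftCrossedModule.sw_extend_coact (v : V) (F : A → V → X)
    (h₁ : ∀ b, Lin k (fun a => F a b)) (h₂ : ∀ a, Lin k (fun b => F a b)) :
    sw ((𝓥.extend i π hc).coact v) F = sw (𝓥.coact v) fun g u => F (i g) u := by
  change sw (LinearMap.rTensor V (i : H →ₗ[k] A) (𝓥.coact v)) F = _
  conv_lhs => rw [← sw_tmul_eq (𝓥.coact v)]
  simp (disch := fun_prop) only [map_sw, sw_sw, LinearMap.rTensor_tmul, sw_pure]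
  rfl

theorem leftTensorAct_extend : leftTensorAct (𝓥.extend i π hc) (𝓦.extend i π hd) =
    leftTensorAct 𝓥 𝓦 ∘ₗ LinearMap.rTensor (V ⊗[k] W) (π : A →ₗ[k] H) := by
  refine TensorProduct.ext' fun a t => ?_
  induction t with
  | zero => simp only [TensorProduct.tmul_zero, map_zero]
  | add x y hx hy => simp only [TensorProduct.tmul_add, map_add, hx, hy]
  | tmul v w =>
    rw [leftTensorAct_tmul, LinearMap.comp_apply, LinearMap.rTensor_tmul]
    refine Eq.trans ?_ (leftTensorAct_tmul 𝓥 𝓦 (π a) v w).symm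
    exact (sw_comul_map π a (fun h₁ h₂ => 𝓥.act (h₁ ⊗ₜ[k] v) ⊗ₜ[k] 𝓦.act (h₂ ⊗ₜ[k] w))
      (by fun_prop) (by fun_prop)).symm

theorem leftTensorCoact_extend : leftTensorCoact (𝓥.extend i π hc) (𝓦.extend i π hd) =
    LinearMap.rTensor (V ⊗[k] W) (i : H →ₗ[k] A) ∘ₗ leftTensorCoact 𝓥 𝓦 := by
  refine TensorProduct.ext' fun v w => ?_
  rw [leftTensorCoact_tmul, LinearMap.comp_apply, leftTensorCoact_tmul]
  simp (disch := fun_prop) only [LeftCrossedModule.sw_extend_coact, map_sw,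
    LinearMap.rTensor_tmul]
  simp only [← map_mul]
  rfl

/-- The new coaction lands in `i(H)` and the new action factors through `π`, so the braiding sees
only `π ∘ i = id`. This is why the braided multiplicativity of the coproduct passes unchanged to the
larger Hopf algebra. -/
theorem leftBraiding_extend (hπ : ∀ h, π (i h) = h) :
    leftBraiding (𝓥.extend i π hc) (𝓦.extend i π hd) = leftBraiding 𝓥 𝓦 := by
  refine TensorProduct.ext' fun v w => ?_
  rw [leftBraiding_tmul, leftBraiding_tmul]
  simp (disch := fun_prop) only [LeftCrossedModule.sw_extend_coact, LeftCrossedModule.extend_act,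
    hπ]

theorem LeftIntertwines.extend {aV : H ⊗[k] V →ₗ[k] V} {cV : V →ₗ[k] H ⊗[k] V}
    {aW : H ⊗[k] W →ₗ[k] W} {cW : W →ₗ[k] H ⊗[k] W} {f : V →ₗ[k] W}
    (hf : LeftIntertwines aV cV aW cW f) :
    LeftIntertwines (aV ∘ₗ LinearMap.rTensor V (π : A →ₗ[k] H))
      (LinearMap.rTensor V (i : H →ₗ[k] A) ∘ₗ cV)
      (aW ∘ₗ LinearMap.rTensor W (π : A →ₗ[k] H))
      (LinearMap.rTensor W (i : H →ₗ[k] A) ∘ₗ cW) f := by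
  constructor
  · rw [← LinearMap.comp_assoc, hf.1, LinearMap.comp_assoc, LinearMap.comp_assoc,
      LinearMap.lTensor_comp_rTensor, LinearMap.rTensor_comp_lTensor]
  · rw [LinearMap.comp_assoc, hf.2, ← LinearMap.comp_assoc, ← LinearMap.comp_assoc,
      LinearMap.lTensor_comp_rTensor, LinearMap.rTensor_comp_lTensor]

end Module

theorem leftUnitAct_extend :
    leftUnitAct k A = leftUnitAct k H ∘ₗ LinearMap.rTensor k (π : A →ₗ[k] H) := by
  refine TensorProduct.ext' fun a r => ?_
  simp [leftUnitAct]

theorem leftUnitCoact_extend :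
    leftUnitCoact k A = LinearMap.rTensor k (i : H →ₗ[k] A) ∘ₗ leftUnitCoact k H := by
  ext
  simp [leftUnitCoact]

/-- The braided group over `A` obtained by restriction along `π` and push forward along `i`. -/
def LeftBraidedGroup.extend (𝓒 : LeftBraidedGroup k H C)
    (hc : 𝓒.toLeftCrossedModule.IsCrossedAlong i π) (hπ : ∀ h, π (i h) = h) :
    LeftBraidedGroup k A C where
  toLeftCrossedModule := 𝓒.toLeftCrossedModule.extend i π hc
  antipode := 𝓒.antipode
  mul_hom := by
    rw [leftTensorAct_extend, leftTensorCoact_extend]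
    exact 𝓒.mul_hom.extend i π
  unit_hom := by
    rw [leftUnitAct_extend π, leftUnitCoact_extend i]
    exact 𝓒.unit_hom.extend i π
  comul_hom := by
    rw [leftTensorAct_extend, leftTensorCoact_extend]
    exact 𝓒.comul_hom.extend i π
  counit_hom := by
    rw [leftUnitAct_extend π, leftUnitCoact_extend i]
    exact 𝓒.counit_hom.extend i π
  antipode_hom := 𝓒.antipode_hom.extend i π
  comul_one := 𝓒.comul_one
  comul_mul := by
    rw [leftBraiding_extend i π _ hc _ hc hπ]
    exact 𝓒.comul_mul
  counit_one := 𝓒.counit_one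
  counit_mul := 𝓒.counit_mul
  antipode_left := 𝓒.antipode_left
  antipode_right := 𝓒.antipode_right

end Extend

/-! ### Compatibility as a crossed-module condition over `H ⋉ B` -/

section Ambient

variable {k H B C X : Type*} [Field k] [Ring H] [HopfAlgebra k H] [Ring B] [Algebra k B]
  [Coalgebra k B] [Ring C] [Algebra k C] [Coalgebra k C] [AddCommGroup X] [Module k X]
  {𝓑 : RightBraidedGroup k H B} {𝓒 : LeftBraidedGroup k H C}

local notation "Δ" => Coalgebra.comul (R := k)
local notation "ε" => Coalgebra.counit (R := k)

theorem Compatible.sw_eq (hcomp : Compatible 𝓑 𝓒) (b : B) (c : C) (F : B → C → X)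
    (h₁ : ∀ b, Lin k (fun a => F a b)) (h₂ : ∀ a, Lin k (fun b => F a b)) :
    (sw (𝓑.coact b) fun u g => sw (𝓒.coact c) fun h w =>
      F (𝓑.act (u ⊗ₜ[k] h)) (𝓒.act (g ⊗ₜ[k] w))) = F b c := by
  have := congrArg (fun t => sw t F) (hcomp b c)
  beta_reduce at this
  rw [← sw_tmul_eq (𝓑.coact b), ← sw_tmul_eq (𝓒.coact c)] at this
  rw [sw_comm]
  simpa (disch := fun_prop) only [sw_tmul, tmul_sw, map_sw, sw_sw, flipMid,
    LinearEquiv.coe_coe, TensorProduct.tensorTensorTensorComm_tmul, TensorProduct.map_tmul,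
    sw_pure] using this

/-- For `a = h b` the left-hand side is `h₁ b⁽¹⁾ v⁽¹⁾ ⊗ h₂ b⁽²⁾ ▷ v⁽²⁾`, since `π` kills `b₂`.
Moving `b⁽¹⁾` past `v⁽¹⁾` comultiplies `v⁽¹⁾`, and comodule coassociativity makes `b⁽¹⁾ ◁ w⁽¹⁾ ⊗
b⁽²⁾ ▷ w⁽²⁾` appear with `w = v⁽²⁾`. Compatibility replaces this by `b ⊗ w`. -/
theorem Compatible.isCrossedAlong (hcomp : Compatible 𝓑 𝓒) :
    𝓒.toLeftCrossedModule.IsCrossedAlong (RightBi.incl 𝓑) (RightBi.proj 𝓑) := by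
  intro a v
  induction a using RightBi.induction with
  | ha x y hx hy =>
    simp (disch := fun_prop) only [map_add, sw_add_left, hx, hy]
  | hm h b =>
    simp (disch := fun_prop) only [RightBi.comul_mk, sw_sw, sw_pure, RightBi.proj_mk]
    simp only [← TensorProduct.smul_tmul', map_smul, TensorProduct.tmul_smul, ← smul_sw]
    simp (disch := fun_prop) only [sw_smul_left, sw_comm (𝓑.coact _) (𝓒.coact _),
      𝓑.sw_coact_counit', sw_counit_left, sw_counit_right,
      mul_one]
    simp only [RightBi.incl_apply, RightBi.mk_eq, mul_assoc, RightBi.inrB_mul_inlH]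
    simp only [← mul_assoc, ← map_mul]
    -- What has to remain is the crossed-module axiom over `H` for `h` and `v`, with `b` multiplied
    -- on the right of the first leg.
    refine Eq.trans (sw_congr fun h₁ h₂ => ?_) (𝓒.sw_crossed h v
      (fun g u => (RightBi.inlH 𝓑 g * RightBi.inrB 𝓑 b) ⊗ₜ[k] u) (by fun_prop) (by fun_prop))
    refine Eq.trans ?_ (Eq.trans (𝓒.sw_coact_coassoc v (fun c e d => sw (𝓑.coact b) fun u g =>
      (RightBi.inlH 𝓑 h₁ * (RightBi.inlH 𝓑 c * RightBi.inrB 𝓑 (𝓑.act (u ⊗ₜ[k] e)))) ⊗ₜ[k]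
        𝓒.act ((h₂ * g) ⊗ₜ[k] d)) (by fun_prop) (by fun_prop) (by fun_prop)).symm ?_)
    · simp only [sw_comm (Δ _) (𝓑.coact b), mul_sw, sw_tmul]
    · refine sw_congr fun g u => ?_
      simp only [𝓒.mul_act, map_mul, mul_assoc]
      rw [sw_comm]
      exact hcomp.sw_eq b u (fun b u => (RightBi.inlH 𝓑 h₁ * (RightBi.inlH 𝓑 g *
        RightBi.inrB 𝓑 b)) ⊗ₜ[k] 𝓒.act (h₂ ⊗ₜ[k] u)) (by fun_prop) (by fun_prop)

end Ambient

/-! ### Convolution with scalar-valued maps -/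

section Convolution

variable {k Q P X Y Z : Type*} [CommRing k] [AddCommGroup Q] [Module k Q] [Coalgebra k Q]
  [AddCommGroup P] [Module k P] [Coalgebra k P]
  [AddCommGroup X] [Module k X] [AddCommGroup Y] [Module k Y] [AddCommGroup Z] [Module k Z]

local notation "Δ" => Coalgebra.comul (R := k)
local notation "ε" => Coalgebra.counit (R := k)

/-- The map `x ↦ f(x₁) F(x₂)`. -/
def lact (f : Q →ₗ[k] k) (F : Q →ₗ[k] X) : Q →ₗ[k] X :=
  ofBilin (fun a b => f a • F b) (by fun_prop) (by fun_prop) ∘ₗ Coalgebra.comul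

/-- The map `x ↦ F(x₁) g(x₂)`. -/
def ract (F : Q →ₗ[k] X) (g : Q →ₗ[k] k) : Q →ₗ[k] X :=
  ofBilin (fun a b => g b • F a) (by fun_prop) (by fun_prop) ∘ₗ Coalgebra.comul

/-- The map `x ↦ F(x₁) ⊗ G(x₂)`. -/
def tact (F : Q →ₗ[k] X) (G : Q →ₗ[k] Y) : Q →ₗ[k] X ⊗[k] Y :=
  TensorProduct.map F G ∘ₗ Coalgebra.comul

theorem lact_apply (f : Q →ₗ[k] k) (F : Q →ₗ[k] X) (x : Q) :
    lact f F x = sw (Δ x) fun a b => f a • F b := by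
  rw [lact, LinearMap.comp_apply, ofBilin_apply]

theorem ract_apply (F : Q →ₗ[k] X) (g : Q →ₗ[k] k) (x : Q) :
    ract F g x = sw (Δ x) fun a b => g b • F a := by
  rw [ract, LinearMap.comp_apply, ofBilin_apply]

theorem tact_apply (F : Q →ₗ[k] X) (G : Q →ₗ[k] Y) (x : Q) :
    tact F G x = sw (Δ x) fun a b => F a ⊗ₜ[k] G b := by
  rw [tact, LinearMap.comp_apply]
  conv_lhs => rw [← sw_tmul_eq (Δ x)]
  simp only [map_sw, TensorProduct.map_tmul]

/-- For scalar-valued maps both actions are the convolution product, so `lact f g` also serves as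
the product of functionals. -/
theorem ract_eq_lact (f g : Q →ₗ[k] k) : ract f g = lact f g := by
  ext x
  simp only [lact_apply, ract_apply, smul_eq_mul, mul_comm]

theorem lact_lact (f g : Q →ₗ[k] k) (F : Q →ₗ[k] X) :
    lact f (lact g F) = lact (lact f g) F := by
  ext x
  simp only [lact_apply, smul_sw, sw_smul]
  refine (sw_coassoc x (fun a b c => f a • g b • F c) (by fun_prop) (by fun_prop)
    (by fun_prop)).symm.trans ?_
  simp only [smul_assoc]

theorem ract_ract (f g : Q →ₗ[k] k) (F : Q →ₗ[k] X) :
    ract (ract F f) g = ract F (lact f g) := by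
  ext x
  simp only [lact_apply, ract_apply, smul_sw, sw_smul]
  refine (sw_coassoc x (fun a b c => g c • f b • F a) (by fun_prop) (by fun_prop)
    (by fun_prop)).trans ?_
  simp only [smul_smul, smul_eq_mul, mul_comm]

theorem ract_lact (f g : Q →ₗ[k] k) (F : Q →ₗ[k] X) :
    ract (lact f F) g = lact f (ract F g) := by
  ext x
  simp only [lact_apply, ract_apply, smul_sw]
  refine (sw_coassoc x (fun a b c => g c • f a • F b) (by fun_prop) (by fun_prop)
    (by fun_prop)).trans ?_
  simp only [smul_smul, mul_comm]

theorem counit_lact (F : Q →ₗ[k] X) : lact ε F = F := by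
  ext x
  rw [lact_apply, sw_counit_left x (fun x => F x) (by fun_prop)]

theorem ract_counit (F : Q →ₗ[k] X) : ract F ε = F := by
  ext x
  rw [ract_apply, sw_counit_right x (fun x => F x) (by fun_prop)]

theorem comp_lact (φ : X →ₗ[k] Y) (f : Q →ₗ[k] k) (F : Q →ₗ[k] X) :
    φ ∘ₗ lact f F = lact f (φ ∘ₗ F) := by
  ext x
  simp only [LinearMap.comp_apply, lact_apply, map_sw, map_smul]

theorem comp_ract (φ : X →ₗ[k] Y) (f : Q →ₗ[k] k) (F : Q →ₗ[k] X) :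
    φ ∘ₗ ract F f = ract (φ ∘ₗ F) f := by
  ext x
  simp only [LinearMap.comp_apply, ract_apply, map_sw, map_smul]

theorem lact_comp (f : Q →ₗ[k] k) (F : Q →ₗ[k] X) (h : P →ₗc[k] Q) :
    lact f F ∘ₗ h.toLinearMap = lact (f ∘ₗ h.toLinearMap) (F ∘ₗ h.toLinearMap) := by
  ext x
  simp only [LinearMap.comp_apply, lact_apply]
  exact sw_comul_map h x (fun a b => f a • F b) (by fun_prop) (by fun_prop)

theorem ract_comp (f : Q →ₗ[k] k) (F : Q →ₗ[k] X) (h : P →ₗc[k] Q) :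
    ract F f ∘ₗ h.toLinearMap = ract (F ∘ₗ h.toLinearMap) (f ∘ₗ h.toLinearMap) := by
  ext x
  simp only [LinearMap.comp_apply, ract_apply]
  exact sw_comul_map h x (fun a b => f b • F a) (by fun_prop) (by fun_prop)

theorem tact_lact (f : Q →ₗ[k] k) (F : Q →ₗ[k] X) (G : Q →ₗ[k] Y) :
    tact (lact f F) G = lact f (tact F G) := by
  ext x
  simp only [lact_apply, tact_apply, smul_sw, sw_tmul, ← TensorProduct.smul_tmul']
  exact sw_coassoc x (fun a b c => f a • F b ⊗ₜ[k] G c) (by fun_prop) (by fun_prop)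
    (by fun_prop)

theorem tact_ract (g : Q →ₗ[k] k) (F : Q →ₗ[k] X) (G : Q →ₗ[k] Y) :
    tact F (ract G g) = ract (tact F G) g := by
  ext x
  simp only [ract_apply, tact_apply, smul_sw, tmul_sw, TensorProduct.tmul_smul]
  exact (sw_coassoc x (fun a b c => g c • F a ⊗ₜ[k] G b) (by fun_prop) (by fun_prop)
    (by fun_prop)).symm

/-- By coassociativity, a functional on the right of the first leg is the same as one on the left of
the second leg. This allows a functional and its inverse to meet between two legs. -/
theorem tact_ract_lact (f : Q →ₗ[k] k) (F : Q →ₗ[k] X) (G : Q →ₗ[k] Y) :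
    tact (ract F f) G = tact F (lact f G) := by
  ext x
  simp only [lact_apply, ract_apply, tact_apply, sw_tmul, tmul_sw, TensorProduct.tmul_smul,
    ← TensorProduct.smul_tmul']
  exact sw_coassoc x (fun a b c => f b • F a ⊗ₜ[k] G c) (by fun_prop) (by fun_prop)
    (by fun_prop)

theorem tact_coalgHom (h : P →ₗc[k] Q) :
    tact h.toLinearMap h.toLinearMap = Coalgebra.comul ∘ₗ h.toLinearMap :=
  h.map_comp_comul

/-- A right convolution inverse of a functional with a left convolution inverse agrees with it. -/
theorem conv_inv_unique {f g g' : Q →ₗ[k] k} (h : lact g f = ε) (h' : lact f g' = ε) :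
    g = g' := by
  have := lact_lact g f g'
  rwa [h, h', counit_lact, ← ract_eq_lact, ract_counit] at this

theorem conv_inv_mul {f g f' g' : Q →ₗ[k] k} (h : lact f g = ε) (h' : lact f' g' = ε) :
    lact (lact f f') (lact g' g) = ε := by
  rw [← lact_lact, lact_lact f', h', counit_lact, h]

section Tensor

theorem sw_comul_tmul (x : Q) (y : P) (F : Q ⊗[k] P → Q ⊗[k] P → Z)
    (h₁ : ∀ b, Lin k (fun a => F a b)) (h₂ : ∀ a, Lin k (fun b => F a b)) :
    sw (Δ (x ⊗ₜ[k] y)) F = sw (Δ x) fun x₁ x₂ => sw (Δ y) fun y₁ y₂ =>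
      F (x₁ ⊗ₜ[k] y₁) (x₂ ⊗ₜ[k] y₂) := by
  rw [TensorProduct.comul_tmul, TensorProduct.AlgebraTensorModule.tensorTensorTensorComm_eq]
  conv_lhs => rw [← sw_tmul_eq (Δ x), ← sw_tmul_eq (Δ y)]
  simp (disch := fun_prop) only [sw_tmul, tmul_sw, equiv_sw, sw_sw,
    TensorProduct.tensorTensorTensorComm_tmul, sw_pure]
  rw [sw_comm]

theorem counit_tmul (x : Q) (y : P) : ε (x ⊗ₜ[k] y) = ε x * ε y := by
  rw [TensorProduct.counit_tmul, smul_eq_mul, mul_comm]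

/-- The functional `x ⊗ y ↦ f(x) g(y)`. -/
def outer {Q P : Type*} [AddCommGroup Q] [Module k Q] [AddCommGroup P] [Module k P] (f : Q →ₗ[k] k) (g : P →ₗ[k] k) : Q ⊗[k] P →ₗ[k] k :=
  ofBilin (fun x y => f x • g y) (by fun_prop) (by fun_prop)

theorem outer_tmul {Q P : Type*} [AddCommGroup Q] [Module k Q] [AddCommGroup P] [Module k P]
    (f : Q →ₗ[k] k) (g : P →ₗ[k] k) (x : Q) (y : P) :
    outer f g (x ⊗ₜ[k] y) = f x * g y := by
  rw [outer, ofBilin_tmul, smul_eq_mul]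

theorem lact_outer (f : Q →ₗ[k] k) (g : P →ₗ[k] k) (F : Q →ₗ[k] X) (G : P →ₗ[k] Y) :
    lact (outer f g) (TensorProduct.map F G) = TensorProduct.map (lact f F) (lact g G) := by
  refine TensorProduct.ext' fun x y => ?_
  rw [lact_apply, sw_comul_tmul _ _ _ (by fun_prop) (by fun_prop)]
  simp only [lact_apply, outer_tmul, TensorProduct.map_tmul, sw_tmul, tmul_sw,
    TensorProduct.tmul_smul, ← TensorProduct.smul_tmul', smul_sw, smul_smul, mul_comm]
  rw [sw_comm]

theorem ract_outer (f : Q →ₗ[k] k) (g : P →ₗ[k] k) (F : Q →ₗ[k] X) (G : P →ₗ[k] Y) :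
    ract (TensorProduct.map F G) (outer f g) = TensorProduct.map (ract F f) (ract G g) := by
  refine TensorProduct.ext' fun x y => ?_
  rw [ract_apply, sw_comul_tmul _ _ _ (by fun_prop) (by fun_prop)]
  simp only [ract_apply, outer_tmul, TensorProduct.map_tmul, sw_tmul, tmul_sw,
    TensorProduct.tmul_smul, ← TensorProduct.smul_tmul', smul_sw, smul_smul, mul_comm]
  rw [sw_comm]

theorem lact_outer_outer (f f' : Q →ₗ[k] k) (g g' : P →ₗ[k] k) :
    lact (outer f g) (outer f' g') = outer (lact f f') (lact g g') := by
  refine TensorProduct.ext' fun x y => ?_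
  rw [lact_apply, sw_comul_tmul _ _ _ (by fun_prop) (by fun_prop)]
  simp only [lact_apply, outer_tmul, smul_eq_mul, sw_mul, mul_sw, mul_mul_mul_comm]
  rw [sw_comm]

theorem outer_counit : outer (ε : Q →ₗ[k] k) (ε : P →ₗ[k] k) = ε := by
  refine TensorProduct.ext' fun x y => ?_
  rw [outer_tmul, counit_tmul]

end Tensor

end Convolution

/-! ### Cocycle twists of bialgebras -/

section Twist

variable {k : Type*} [CommRing k]

local notation "Δ" => Coalgebra.comul (R := k)
local notation "ε" => Coalgebra.counit (R := k)

/-- A normalized convolution-invertible 2-cocycle on a bialgebra. -/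
structure Cocycle (k K : Type*) [CommRing k] [Ring K] [Bialgebra k K] where
  toFun : K ⊗[k] K →ₗ[k] k
  inv : K ⊗[k] K →ₗ[k] k
  lact_inv : lact toFun inv = Coalgebra.counit
  inv_lact : lact inv toFun = Coalgebra.counit
  one_tmul : ∀ x, toFun (1 ⊗ₜ[k] x) = Coalgebra.counit (R := k) x
  tmul_one : ∀ x, toFun (x ⊗ₜ[k] 1) = Coalgebra.counit (R := k) x
  cocycle : lact (outer toFun Coalgebra.counit)
      (toFun ∘ₗ LinearMap.rTensor K (LinearMap.mul' k K)) =
    lact (outer Coalgebra.counit toFun ∘ₗ (TensorProduct.assoc k K K K).toLinearMap)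
      (toFun ∘ₗ LinearMap.lTensor K (LinearMap.mul' k K) ∘ₗ
        (TensorProduct.assoc k K K K).toLinearMap)

namespace Cocycle

variable {K : Type*} [Ring K] [Bialgebra k K] (σ : Cocycle k K)

/-- The twisted product `x ⊗ y ↦ σ(x₁ ⊗ y₁) x₂ y₂ σ⁻¹(x₃ ⊗ y₃)`. -/
def mul : K ⊗[k] K →ₗ[k] K := lact σ.toFun (ract (LinearMap.mul' k K) σ.inv)

/-- In the tensor product of two twisted products the factors `σ⁻¹` of the first leg and `σ` of the
second are adjacent and cancel. Only the outer `σ` and `σ⁻¹` survive, around the untwisted product,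
which is a coalgebra map. -/
theorem comul_mul : Coalgebra.comul ∘ₗ σ.mul = TensorProduct.map σ.mul σ.mul ∘ₗ Coalgebra.comul := by
  change _ = tact σ.mul σ.mul
  have h : tact σ.mul σ.mul = tact (lact σ.toFun (ract (LinearMap.mul' k K) σ.inv))
      (ract (lact σ.toFun (LinearMap.mul' k K)) σ.inv) := by
    rw [ract_lact]; rfl
  rw [h, tact_lact, tact_ract, tact_ract_lact, lact_lact, σ.inv_lact, counit_lact, mul, comp_lact,
    comp_ract]
  exact congrArg (fun F => lact σ.toFun (ract F σ.inv))
    (tact_coalgHom (Bialgebra.mulCoalgHom k K)).symm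

theorem counit_mul : Coalgebra.counit ∘ₗ σ.mul = Coalgebra.counit := by
  rw [mul, comp_lact, comp_ract]
  have : (ε : K →ₗ[k] k) ∘ₗ LinearMap.mul' k K = ε :=
    (Bialgebra.mulCoalgHom k K).counit_comp
  rw [this, ract_eq_lact, counit_lact, σ.lact_inv]

/-- The twisted product as a map of coalgebras. -/
def mulHom : K ⊗[k] K →ₗc[k] K :=
  { σ.mul with
    counit_comp := σ.counit_mul
    map_comp_comul := σ.comul_mul.symm }

/-- Pulling back along a coalgebra map respects convolution. Where `σ` restricts to the counit the
twist is therefore invisible; this yields the unit laws here and the two sub-bialgebras later. -/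
theorem mul_comp_map {P Q : Type*} [AddCommGroup P] [Module k P] [Coalgebra k P]
    [AddCommGroup Q] [Module k Q] [Coalgebra k Q] (φ : P →ₗc[k] K) (ψ : Q →ₗc[k] K)
    (h : ∀ x y, σ.toFun (φ x ⊗ₜ[k] ψ y) = ε x * ε y) (x : P) (y : Q) :
    σ.mul (φ x ⊗ₜ[k] ψ y) = φ x * ψ y := by
  have h₁ : σ.toFun ∘ₗ (Coalgebra.TensorProduct.map φ ψ).toLinearMap = ε :=
    TensorProduct.ext' fun x y => (h x y).trans (counit_tmul x y).symm
  -- The pulled-back inverse is a convolution inverse of the counit, hence the counit.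
  have h₂ : σ.inv ∘ₗ (Coalgebra.TensorProduct.map φ ψ).toLinearMap = ε := by
    have := lact_comp σ.toFun σ.inv (Coalgebra.TensorProduct.map φ ψ)
    rw [σ.lact_inv, h₁, counit_lact] at this
    rw [← this]
    exact (Coalgebra.TensorProduct.map φ ψ).counit_comp
  have := LinearMap.congr_fun (lact_comp σ.toFun (ract (LinearMap.mul' k K) σ.inv)
    (Coalgebra.TensorProduct.map φ ψ)) (x ⊗ₜ[k] y)
  rwa [ract_comp, h₁, h₂, ract_counit, counit_lact] at this

theorem one_mul (x : K) : σ.mul (1 ⊗ₜ[k] x) = x := by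
  -- The unit map `k → K` is a coalgebra map, and normalisation says that `σ` is trivial on its
  -- image.
  have := σ.mul_comp_map (Bialgebra.unitBialgHom k K : k →ₗc[k] K) (CoalgHom.id k K)
    (fun r x => ?_) 1 x
  · simpa using this
  · change σ.toFun (algebraMap k K r ⊗ₜ[k] x) = r * ε x
    rw [Algebra.algebraMap_eq_smul_one, ← TensorProduct.smul_tmul', map_smul, σ.one_tmul,
      smul_eq_mul]

theorem mul_one (x : K) : σ.mul (x ⊗ₜ[k] 1) = x := by
  have := σ.mul_comp_map (CoalgHom.id k K) (Bialgebra.unitBialgHom k K : k →ₗc[k] K)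
    (fun x r => ?_) x 1
  · simpa using this
  · change σ.toFun (x ⊗ₜ[k] algebraMap k K r) = ε x * r
    rw [Algebra.algebraMap_eq_smul_one, TensorProduct.tmul_smul, map_smul, σ.tmul_one,
      smul_eq_mul, mul_comm]

/-- If `h` is `h₀` conjugated by `s` and `t`, the twisted product along `h` is the untwisted product
along `h₀` between `s * (σ ∘ h₀)` and `(σ⁻¹ ∘ h₀) * t`. Both bracketings of a threefold twisted
product have this shape, which reduces associativity to comparing the three factors. -/
theorem mul_comp_coalgHom {P : Type*} [AddCommGroup P] [Module k P] [Coalgebra k P]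
    (h h₀ : P →ₗc[k] K ⊗[k] K) (s t : P →ₗ[k] k)
    (e : h.toLinearMap = lact s (ract h₀.toLinearMap t)) (ht : lact t s = ε) :
    σ.mul ∘ₗ h.toLinearMap = lact (lact s (σ.toFun ∘ₗ h₀.toLinearMap))
      (ract (LinearMap.mul' k K ∘ₗ h₀.toLinearMap) (lact (σ.inv ∘ₗ h₀.toLinearMap) t)) := by
  rw [mul, lact_comp, ract_comp, e]
  simp only [comp_lact, comp_ract, ract_eq_lact, ract_lact, ract_ract, ← lact_lact]
  -- Each of `σ ∘ h`, the product along `h` and `σ⁻¹ ∘ h` is conjugated by `s` and `t`; the product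
  -- `t * s` cancels at the two junctions.
  rw [lact_lact t s, ht, counit_lact, lact_lact t s, ht, counit_lact]

/-- In the factorisation of `mul_comp_coalgHom` the left factors of the two bracketings agree by the
cocycle identity and the middle ones by associativity of `K`. The right factors are convolution
inverses of the left ones, so they agree as well. -/
theorem assoc : σ.mul ∘ₗ LinearMap.rTensor K σ.mul =
    σ.mul ∘ₗ LinearMap.lTensor K σ.mul ∘ₗ (TensorProduct.assoc k K K K).toLinearMap := by
  let α : (K ⊗[k] K) ⊗[k] K →ₗc[k] K ⊗[k] (K ⊗[k] K) :=
    (Coalgebra.TensorProduct.assoc k k K K K : _ →ₗc[k] _)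
  let M := Bialgebra.mulCoalgHom k K
  let h := Coalgebra.TensorProduct.map σ.mulHom (CoalgHom.id k K)
  let h₀ := Coalgebra.TensorProduct.map M (CoalgHom.id k K)
  let g := (Coalgebra.TensorProduct.map (CoalgHom.id k K) σ.mulHom).comp α
  let g₀ := (Coalgebra.TensorProduct.map (CoalgHom.id k K) M).comp α
  have hh := σ.mul_comp_coalgHom h h₀ (outer σ.toFun ε) (outer σ.inv ε) (by
    refine Eq.trans ?_ (congrArg _ (ract_outer σ.inv ε (LinearMap.mul' k K) LinearMap.id).symm)
    rw [lact_outer, ract_counit, counit_lact]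
    rfl) (by rw [lact_outer_outer, σ.inv_lact, counit_lact, outer_counit])
  have hg := σ.mul_comp_coalgHom g g₀ (outer ε σ.toFun ∘ₗ α.toLinearMap)
    (outer ε σ.inv ∘ₗ α.toLinearMap) (by
    have : TensorProduct.map LinearMap.id σ.mul = lact (outer (ε : K →ₗ[k] k) σ.toFun)
        (ract (TensorProduct.map LinearMap.id (LinearMap.mul' k K)) (outer ε σ.inv)) := by
      rw [ract_outer, lact_outer, ract_counit, counit_lact]; rfl
    have := congrArg (fun F => F ∘ₗ α.toLinearMap) this
    beta_reduce at this
    rw [lact_comp, ract_comp] at this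
    exact this) (by
      rw [← lact_comp, lact_outer_outer, σ.inv_lact, counit_lact, outer_counit]
      exact α.counit_comp)
  refine hh.trans (Eq.trans ?_ hg.symm)
  have hL : lact (outer σ.toFun ε) (σ.toFun ∘ₗ h₀.toLinearMap) =
    lact (outer ε σ.toFun ∘ₗ α.toLinearMap) (σ.toFun ∘ₗ g₀.toLinearMap) := σ.cocycle
  have hN : LinearMap.mul' k K ∘ₗ h₀.toLinearMap = LinearMap.mul' k K ∘ₗ g₀.toLinearMap := by
    refine TensorProduct.ext_threefold fun x y z => ?_
    exact mul_assoc x y z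
  -- No separate cocycle identity for `σ⁻¹` is needed: both sides invert the same functional, by
  -- `hL`.
  have hR : lact (σ.inv ∘ₗ h₀.toLinearMap) (outer σ.inv ε) =
      lact (σ.inv ∘ₗ g₀.toLinearMap) (outer ε σ.inv ∘ₗ α.toLinearMap) := by
    refine conv_inv_unique (f := lact (outer σ.toFun ε) (σ.toFun ∘ₗ h₀.toLinearMap)) ?_ ?_
    · refine conv_inv_mul ?_ ?_
      · rw [← lact_comp, σ.inv_lact]; exact h₀.counit_comp
      · rw [lact_outer_outer, σ.inv_lact, counit_lact, outer_counit]
    · rw [hL]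
      refine conv_inv_mul ?_ ?_
      · rw [← lact_comp, lact_outer_outer, σ.lact_inv, counit_lact, outer_counit]
        exact α.counit_comp
      · rw [← lact_comp, σ.lact_inv]; exact g₀.counit_comp
  rw [hL, hN, hR]

end Cocycle

/-- The twist of a bialgebra by a cocycle. -/
def Twisted {K : Type*} [Ring K] [Bialgebra k K] (_ : Cocycle k K) : Type _ := K

namespace Twisted

variable {K : Type*} [Ring K] [Bialgebra k K] (σ : Cocycle k K)

instance : AddCommGroup (Twisted σ) := inferInstanceAs (AddCommGroup K)

instance : Module k (Twisted σ) := inferInstanceAs (Module k K)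

instance : Coalgebra k (Twisted σ) := inferInstanceAs (Coalgebra k K)

instance : Mul (Twisted σ) := ⟨fun x y => σ.mul (x ⊗ₜ[k] y)⟩

instance : One (Twisted σ) := ⟨(1 : K)⟩

/-- The identity map, as an equivalence of coalgebras. -/
def equiv : K ≃ₗc[k] Twisted σ := CoalgEquiv.refl k K

instance : Ring (Twisted σ) :=
  { (inferInstance : AddCommGroup (Twisted σ)), (inferInstance : Mul (Twisted σ)),
    (inferInstance : One (Twisted σ)) with
    mul_assoc := fun x y z => LinearMap.congr_fun σ.assoc ((x ⊗ₜ[k] y) ⊗ₜ[k] z)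
    one_mul := σ.one_mul
    mul_one := σ.mul_one
    zero_mul := fun x => (congrArg σ.mul (TensorProduct.zero_tmul K x)).trans (map_zero σ.mul)
    mul_zero := fun x => (congrArg σ.mul (TensorProduct.tmul_zero K x)).trans (map_zero σ.mul)
    left_distrib := fun x y z =>
      (congrArg σ.mul (TensorProduct.tmul_add (R := k) (M := K) (N := K) x y z)).trans
        (map_add σ.mul _ _)
    right_distrib := fun x y z =>
      (congrArg σ.mul (TensorProduct.add_tmul (R := k) (M := K) (N := K) x y z)).trans
        (map_add σ.mul _ _) }

instance : Algebra k (Twisted σ) :=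
  Algebra.ofModule
    (fun r x y => (congrArg σ.mul (TensorProduct.smul_tmul' (R := k) (M := K) (N := K) r x y).symm).trans
      (map_smul σ.mul r _))
    (fun r x y => (congrArg σ.mul (TensorProduct.tmul_smul (R := k) (M := K) (N := K) r x y)).trans
      (map_smul σ.mul r _))

instance : Bialgebra k (Twisted σ) :=
  Bialgebra.mk' k (Twisted σ) (Bialgebra.counit_one (R := k) (A := K))
    (fun {a b} => (LinearMap.congr_fun σ.counit_mul (a ⊗ₜ[k] b)).trans
      (counit_tmul (k := k) (Q := K) (P := K) a b))
    (Bialgebra.comul_one (R := k) (A := K))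
    (fun {a b} => by
      refine (LinearMap.congr_fun σ.comul_mul (a ⊗ₜ[k] b)).trans ?_
      refine (tact_apply σ.mul σ.mul (a ⊗ₜ[k] b)).trans ?_
      refine (sw_comul_tmul (k := k) (Q := K) (P := K) a b
        (fun u v => σ.mul u ⊗ₜ[k] σ.mul v) (by fun_prop) (by fun_prop)).trans ?_
      conv_rhs => rw [← sw_tmul_eq (Δ a), ← sw_tmul_eq (Δ b)]
      simp only [sw_mul, mul_sw, Algebra.TensorProduct.tmul_mul_tmul]
      rw [sw_comm]
      rfl)

end Twisted

end Twist

/-! ### Hopf algebras as structure maps -/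

section Transport

variable {k V W : Type*} [CommRing k] [AddCommGroup V] [Module k V] [Ring W] [HopfAlgebra k W]

local notation "Δ" => Coalgebra.comul (R := k)
local notation "ε" => Coalgebra.counit (R := k)

/-- The structure maps `s` correspond to those of the Hopf algebra `W` under `e`. -/
structure HopfData.Corresponds (s : HopfData k V) (e : V ≃ₗ[k] W) : Prop where
  mul : ∀ x y, e (s.mul (x ⊗ₜ[k] y)) = e x * e y
  one : e s.one = 1
  comul : ∀ x, TensorProduct.map e.toLinearMap e.toLinearMap (s.comul x) = Δ (e x)
  counit : ∀ x, s.counit x = ε (e x)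
  antipode : ∀ x, e (s.antipode x) = HopfAlgebra.antipode k (e x)

/-- The structure maps of the Hopf algebra `W`, transported along `e`. -/
def HopfData.ofEquiv (e : V ≃ₗ[k] W) : HopfData k V where
  mul := e.symm.toLinearMap ∘ₗ LinearMap.mul' k W ∘ₗ
    TensorProduct.map e.toLinearMap e.toLinearMap
  one := e.symm 1
  comul := TensorProduct.map e.symm.toLinearMap e.symm.toLinearMap ∘ₗ Coalgebra.comul ∘ₗ
    e.toLinearMap
  counit := Coalgebra.counit ∘ₗ e.toLinearMap
  antipode := e.symm.toLinearMap ∘ₗ HopfAlgebra.antipode k ∘ₗ e.toLinearMap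

theorem HopfData.corresponds_ofEquiv (e : V ≃ₗ[k] W) : (HopfData.ofEquiv e).Corresponds e where
  mul x y := by simp [HopfData.ofEquiv]
  one := by simp [HopfData.ofEquiv]
  comul x := by
    simp only [HopfData.ofEquiv, LinearMap.comp_apply, LinearEquiv.coe_coe]
    rw [← LinearMap.comp_apply, ← TensorProduct.map_comp, LinearEquiv.comp_symm,
      TensorProduct.map_id, LinearMap.id_apply]
  counit x := rfl
  antipode x := by simp [HopfData.ofEquiv]

theorem HopfData.Corresponds.unique {s t : HopfData k V} {e : V ≃ₗ[k] W} (hs : s.Corresponds e)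
    (ht : t.Corresponds e) : s = t := by
  refine HopfData.ext ?_ ?_ ?_ ?_ ?_
  · exact TensorProduct.ext' fun x y => e.injective (by rw [hs.mul, ht.mul])
  · exact e.injective (by rw [hs.one, ht.one])
  · exact LinearMap.ext fun x => (TensorProduct.congr e e).injective
      ((hs.comul x).trans (ht.comul x).symm)
  · exact LinearMap.ext fun x => by rw [hs.counit, ht.counit]
  · exact LinearMap.ext fun x => e.injective (by rw [hs.antipode, ht.antipode])

/-- A left convolution inverse of a coalgebra map is its composition with the antipode. -/
theorem eq_antipode_of_conv {U : Type*} [AddCommGroup U] [Module k U] [Coalgebra k U]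
    (φ : U →ₗc[k] W) (f : U →ₗ[k] W)
    (hf : ∀ y, sw (Δ y) (fun a b => f a * φ b) = ε y • (1 : W)) (y : U) :
    f y = HopfAlgebra.antipode k (φ y) := by
  -- The convolution `f * φ * (S ∘ φ)` is evaluated in both bracketings: one gives `S ∘ φ`, the
  -- other `f`.
  have h := sw_coassoc (k := k) y (fun a b c => f a * (φ b * HopfAlgebra.antipode k (φ c)))
    (by fun_prop) (by fun_prop) (by fun_prop)
  simp only [← mul_assoc, ← sw_mul, hf, smul_mul_assoc, one_mul] at h
  rw [sw_counit_left y (fun b => HopfAlgebra.antipode k (φ b)) (by fun_prop)] at h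
  rw [h, ← sw_counit_right (k := k) y (fun a => f a) (by fun_prop)]
  refine sw_congr fun a b => ?_
  simp only [mul_assoc]
  rw [← sw_comul_map φ b (fun b c => f a * (b * HopfAlgebra.antipode k c)) (by fun_prop)
    (by fun_prop), sw_hopf_right (φ b) (fun x => f a * x) (by fun_prop), mul_one,
    CoalgHomClass.counit_comp_apply]

/-- Coproducts that correspond under a linear equivalence, in Sweedler notation. -/
theorem sw_comul_equiv {X : Type*} [AddCommGroup X] [Module k X] {δ : V →ₗ[k] V ⊗[k] V}
    {e : V ≃ₗ[k] W}
    (comul : ∀ x, TensorProduct.map e.toLinearMap e.toLinearMap (δ x) = Δ (e x)) (x : V)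
    (F : W → W → X) (h₁ : ∀ w, Lin k (fun v => F v w)) (h₂ : ∀ v, Lin k (fun w => F v w)) :
    sw (δ x) (fun a b => F (e a) (e b)) = sw (Δ (e x)) F := by
  rw [← comul]
  conv_rhs => rw [← sw_tmul_eq (δ x)]
  simp (disch := fun_prop) only [map_sw, TensorProduct.map_tmul, sw_sw, sw_pure,
    LinearEquiv.coe_coe]

/-- Structure maps that correspond to those of a Hopf algebra under a linear equivalence satisfy
the axioms. -/
theorem HopfData.Corresponds.isHopf {s : HopfData k V} {e : V ≃ₗ[k] W} (h : s.Corresponds e) :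
    s.IsHopf where
  mul_assoc x y z := e.injective (by simp only [h.mul, _root_.mul_assoc])
  one_mul x := e.injective (by simp only [h.mul, h.one, _root_.one_mul])
  mul_one x := e.injective (by simp only [h.mul, h.one, _root_.mul_one])
  coassoc x := by
    apply (TensorProduct.congr e (TensorProduct.congr e e)).injective
    have h₁ : ∀ v w, TensorProduct.congr e (TensorProduct.congr e e)
        (TensorProduct.assoc k V V V (s.comul v ⊗ₜ[k] w)) =
          TensorProduct.assoc k W W W (Δ (e v) ⊗ₜ[k] e w) := fun v w => by
      rw [← h.comul]
      conv_lhs => rw [← sw_tmul_eq (s.comul v)]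
      conv_rhs => rw [← sw_tmul_eq (s.comul v)]
      simp only [sw_tmul, map_sw, equiv_sw, TensorProduct.assoc_tmul, TensorProduct.congr_tmul,
        TensorProduct.map_tmul, LinearEquiv.coe_coe]
    have h₂ : ∀ v, TensorProduct.congr e e (s.comul v) = Δ (e v) := h.comul
    have h₃ := Coalgebra.coassoc_apply (R := k) (e x)
    rw [← sw_tmul_eq (Δ (e x))] at h₃
    simp only [map_sw, equiv_sw, LinearMap.rTensor_tmul, LinearMap.lTensor_tmul] at h₃
    conv_lhs => rw [← sw_tmul_eq (s.comul x)]
    conv_rhs => rw [← sw_tmul_eq (s.comul x)]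
    simp only [map_sw, equiv_sw, LinearMap.rTensor_tmul, LinearMap.lTensor_tmul,
      TensorProduct.congr_tmul, h₁, h₂]
    rw [sw_comul_equiv h.comul x (fun a b => a ⊗ₜ[k] Δ b) (by fun_prop) (by fun_prop), ← h₃]
    exact sw_comul_equiv h.comul x (fun a b => TensorProduct.assoc k W W W (Δ a ⊗ₜ[k] b))
      (by fun_prop) (by fun_prop)
  counit_comul x := by
    apply (TensorProduct.congr (LinearEquiv.refl k k) e).injective
    conv_lhs => rw [← sw_tmul_eq (s.comul x)]
    have hs : ∀ (r : k) (w : W), r ⊗ₜ[k] w = r • ((1 : k) ⊗ₜ[k] w) := fun r w => by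
      rw [TensorProduct.smul_tmul', smul_eq_mul, _root_.mul_one]
    simp only [map_sw, equiv_sw, LinearMap.rTensor_tmul, TensorProduct.congr_tmul, h.counit,
      LinearEquiv.refl_apply, hs (ε _)]
    refine (sw_comul_equiv h.comul x (fun a b => ε a • ((1 : k) ⊗ₜ[k] b)) (by fun_prop)
      (by fun_prop)).trans ?_
    exact sw_counit_left (e x) (fun b => (1 : k) ⊗ₜ[k] b) (by fun_prop)
  comul_counit x := by
    apply (TensorProduct.congr e (LinearEquiv.refl k k)).injective
    conv_lhs => rw [← sw_tmul_eq (s.comul x)]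
    have hs : ∀ (r : k) (w : W), w ⊗ₜ[k] r = r • (w ⊗ₜ[k] (1 : k)) := fun r w => by
      rw [← TensorProduct.tmul_smul, smul_eq_mul, _root_.mul_one]
    simp only [map_sw, equiv_sw, LinearMap.lTensor_tmul, TensorProduct.congr_tmul, h.counit,
      LinearEquiv.refl_apply, hs (ε _)]
    refine (sw_comul_equiv h.comul x (fun a b => ε b • (a ⊗ₜ[k] (1 : k))) (by fun_prop)
      (by fun_prop)).trans ?_
    exact sw_counit_right (e x) (fun b => b ⊗ₜ[k] (1 : k)) (by fun_prop)
  comul_one := by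
    apply (TensorProduct.congr e e).injective
    refine (h.comul s.one).trans ?_
    rw [h.one, Bialgebra.comul_one, TensorProduct.congr_tmul, h.one]
    rfl
  comul_mul x y := by
    apply (TensorProduct.congr e e).injective
    refine (h.comul _).trans ?_
    rw [h.mul, Bialgebra.comul_mul, ← h.comul, ← h.comul]
    conv_rhs => rw [← sw_tmul_eq (s.comul x), ← sw_tmul_eq (s.comul y)]
    conv_lhs => rw [← sw_tmul_eq (s.comul x), ← sw_tmul_eq (s.comul y)]
    simp only [sw_mul, mul_sw, sw_tmul, tmul_sw, map_sw, equiv_sw, LinearEquiv.coe_coe,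
      TensorProduct.tensorTensorTensorComm_tmul, TensorProduct.map_tmul,
      TensorProduct.congr_tmul, h.mul, Algebra.TensorProduct.tmul_mul_tmul]
  counit_one := by rw [h.counit, h.one, Bialgebra.counit_one]
  counit_mul x y := by simp only [h.counit, h.mul, Bialgebra.counit_mul]
  antipode_left x := by
    apply e.injective
    conv_lhs => rw [← sw_tmul_eq (s.comul x)]
    simp only [map_sw, equiv_sw, LinearMap.rTensor_tmul, h.mul, h.antipode, map_smul, h.one,
      h.counit]
    refine (sw_comul_equiv h.comul x (fun a b => HopfAlgebra.antipode k a * b) (by fun_prop)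
      (by fun_prop)).trans ?_
    exact sw_hopf_left (e x) (fun a => a) (by fun_prop)
  antipode_right x := by
    apply e.injective
    conv_lhs => rw [← sw_tmul_eq (s.comul x)]
    simp only [map_sw, equiv_sw, LinearMap.lTensor_tmul, h.mul, h.antipode, map_smul, h.one,
      h.counit]
    refine (sw_comul_equiv h.comul x (fun a b => a * HopfAlgebra.antipode k b) (by fun_prop)
      (by fun_prop)).trans ?_
    exact sw_hopf_right (e x) (fun a => a) (by fun_prop)

/-- The antipode requires no hypothesis: transported to `W`, it is a left convolution inverse of the
identity, hence the antipode of `W`. -/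
theorem HopfData.IsHopf.corresponds {s : HopfData k V} (h : s.IsHopf) {e : V ≃ₗ[k] W}
    (mul : ∀ x y, e (s.mul (x ⊗ₜ[k] y)) = e x * e y) (one : e s.one = 1)
    (comul : ∀ x, TensorProduct.map e.toLinearMap e.toLinearMap (s.comul x) = Δ (e x))
    (counit : ∀ x, s.counit x = ε (e x)) : s.Corresponds e where
  mul := mul
  one := one
  comul := comul
  counit := counit
  antipode x := by
    have := eq_antipode_of_conv (CoalgHom.id k W)
      (e.toLinearMap ∘ₗ s.antipode ∘ₗ e.symm.toLinearMap) (fun y => ?_) (e x)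
    · simpa using this
    · obtain ⟨y, rfl⟩ := e.surjective y
      rw [← sw_comul_equiv comul y (fun a b => (e.toLinearMap ∘ₗ s.antipode ∘ₗ
        e.symm.toLinearMap) a * CoalgHom.id k W b) (by fun_prop) (by fun_prop)]
      have h₁ := congrArg e (h.antipode_left y)
      rw [← sw_tmul_eq (s.comul y)] at h₁
      simpa only [map_sw, equiv_sw, LinearMap.rTensor_tmul, mul, map_smul, one, counit,
        LinearMap.comp_apply, LinearEquiv.coe_coe, LinearEquiv.symm_apply_apply,
        CoalgHom.id_apply] using h₁

/-- Applying `φ` to `S(x₁) x₂ = ε(x)` shows that `φ ∘ S` is a left convolution inverse of `φ`. -/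
theorem bialgHom_antipode {W' : Type*} [Ring W'] [HopfAlgebra k W'] (φ : W' →ₐc[k] W) (x : W') :
    φ (HopfAlgebra.antipode k x) = HopfAlgebra.antipode k (φ x) := by
  refine eq_antipode_of_conv (φ : W' →ₗc[k] W)
    ((φ : W' →ₗ[k] W) ∘ₗ HopfAlgebra.antipode k) (fun y => ?_) x
  have := sw_hopf_left (k := k) y (fun x => φ x) (by fun_prop)
  simp only [map_mul, map_one] at this
  exact this

theorem HopfData.Corresponds.isSubHopf {V' W' : Type*} [AddCommGroup V'] [Module k V'] [Ring W']
    [HopfAlgebra k W'] {t : HopfData k V'} {e' : V' ≃ₗ[k] W'} (ht : t.Corresponds e')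
    {s : HopfData k V} {e : V ≃ₗ[k] W} (hs : s.Corresponds e) (φ : W' →ₐc[k] W)
    (i : V' →ₗ[k] V) (hi : ∀ x, e (i x) = φ (e' x)) (hinj : Function.Injective i) :
    t.IsSubHopf s i where
  isHopf := ht.isHopf
  injective := hinj
  map_mul x y := e.injective (by rw [hi, ht.mul, map_mul, hs.mul, hi, hi])
  map_one := e.injective (by rw [hi, ht.one, map_one, hs.one])
  map_comul x := by
    apply (TensorProduct.congr e e).injective
    refine Eq.trans ?_ (hs.comul (i x)).symm
    rw [hi, ← CoalgHomClass.map_comp_comul_apply, ← ht.comul]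
    conv_lhs => rw [← sw_tmul_eq (t.comul x)]
    conv_rhs => rw [← sw_tmul_eq (t.comul x)]
    simp only [map_sw, equiv_sw, TensorProduct.map_tmul, TensorProduct.congr_tmul, hi,
      LinearEquiv.coe_coe]
    rfl
  map_counit x := by rw [hs.counit, hi, ht.counit, CoalgHomClass.counit_comp_apply]
  map_antipode x := by
    apply e.injective
    rw [hs.antipode, hi, hi, ht.antipode, bialgHom_antipode]

end Transport

/-! ### The biproduct data correspond to the Hopf algebras constructed from them -/

section Biproducts

variable {k H B C : Type*} [Field k] [Ring H] [HopfAlgebra k H] [Ring B] [Algebra k B]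
  [Coalgebra k B] [Ring C] [Algebra k C] [Coalgebra k C]

local notation "Δ" => Coalgebra.comul (R := k)
local notation "ε" => Coalgebra.counit (R := k)

namespace RightBi

variable (𝓑 : RightBraidedGroup k H B)

theorem equiv_mul (x y : H ⊗[k] B) :
    equiv 𝓑 ((rightBiproduct 𝓑).mul (x ⊗ₜ[k] y)) = equiv 𝓑 x * equiv 𝓑 y := rfl

theorem equiv_one : equiv 𝓑 (rightBiproduct 𝓑).one = 1 := rfl

theorem equiv_comul (x : H ⊗[k] B) : TensorProduct.map (equiv 𝓑).toLinearMap (equiv 𝓑).toLinearMap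
    ((rightBiproduct 𝓑).comul x) = Δ (equiv 𝓑 x) := (comulAlg_eq 𝓑 (equiv 𝓑 x)).symm

theorem equiv_counit (x : H ⊗[k] B) : (rightBiproduct 𝓑).counit x = ε (equiv 𝓑 x) := by
  induction x with
  | zero => simp only [map_zero]
  | add x y hx hy => simp only [map_add, hx, hy]
  | tmul h b => exact (counit_mk 𝓑 h b).symm

theorem equiv_antipode (x : H ⊗[k] B) :
    equiv 𝓑 ((rightBiproduct 𝓑).antipode x) = HopfAlgebra.antipode k (equiv 𝓑 x) := rfl

end RightBi

theorem rightBiproduct_corresponds (𝓑 : RightBraidedGroup k H B) :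
    (rightBiproduct 𝓑).Corresponds (RightBi.equiv 𝓑) :=
  ⟨RightBi.equiv_mul 𝓑, RightBi.equiv_one 𝓑, RightBi.equiv_comul 𝓑, RightBi.equiv_counit 𝓑,
    RightBi.equiv_antipode 𝓑⟩

namespace LeftBi

variable (𝓒 : LeftBraidedGroup k H C)

theorem equiv_mul (x y : C ⊗[k] H) :
    equiv 𝓒 ((leftBiproduct 𝓒).mul (x ⊗ₜ[k] y)) = equiv 𝓒 x * equiv 𝓒 y := rfl

theorem equiv_one : equiv 𝓒 (leftBiproduct 𝓒).one = 1 := rfl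

theorem equiv_comul (x : C ⊗[k] H) : TensorProduct.map (equiv 𝓒).toLinearMap (equiv 𝓒).toLinearMap
    ((leftBiproduct 𝓒).comul x) = Δ (equiv 𝓒 x) := (comulAlg_eq 𝓒 (equiv 𝓒 x)).symm

theorem equiv_counit (x : C ⊗[k] H) : (leftBiproduct 𝓒).counit x = ε (equiv 𝓒 x) := by
  induction x with
  | zero => simp only [map_zero]
  | add x y hx hy => simp only [map_add, hx, hy]
  | tmul c h => exact (counit_mk 𝓒 c h).symm

theorem equiv_antipode (x : C ⊗[k] H) :
    equiv 𝓒 ((leftBiproduct 𝓒).antipode x) = HopfAlgebra.antipode k (equiv 𝓒 x) := rfl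

end LeftBi

theorem leftBiproduct_corresponds (𝓒 : LeftBraidedGroup k H C) :
    (leftBiproduct 𝓒).Corresponds (LeftBi.equiv 𝓒) :=
  ⟨LeftBi.equiv_mul 𝓒, LeftBi.equiv_one 𝓒, LeftBi.equiv_comul 𝓒, LeftBi.equiv_counit 𝓒,
    LeftBi.equiv_antipode 𝓒⟩

end Biproducts

section Ambient

variable {k H B C X : Type*} [Field k] [Ring H] [HopfAlgebra k H] [Ring B] [Algebra k B]
  [Coalgebra k B] [Ring C] [Algebra k C] [Coalgebra k C] [AddCommGroup X] [Module k X]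
  {𝓑 : RightBraidedGroup k H B} {𝓒 : LeftBraidedGroup k H C}

local notation "Δ" => Coalgebra.comul (R := k)
local notation "ε" => Coalgebra.counit (R := k)

/-! ### The untwisted double biproduct -/

/-- The braided group `C` over the right biproduct. -/
def ambient (hcomp : Compatible 𝓑 𝓒) : LeftBraidedGroup k (RightBi 𝓑) C :=
  𝓒.extend (RightBi.incl 𝓑) (RightBi.proj 𝓑) hcomp.isCrossedAlong (RightBi.proj_incl 𝓑)

/-- The untwisted double biproduct, in which `B` and `C` commute. -/
abbrev Ambient (hcomp : Compatible 𝓑 𝓒) : Type _ := LeftBi (ambient hcomp)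

namespace Ambient

variable (hcomp : Compatible 𝓑 𝓒)

theorem ambient_act (a : RightBi 𝓑) (c : C) :
    (ambient hcomp).act (a ⊗ₜ[k] c) = 𝓒.act (RightBi.proj 𝓑 a ⊗ₜ[k] c) := rfl

theorem sw_ambient_coact (c : C) (F : RightBi 𝓑 → C → X)
    (h₁ : ∀ b, Lin k (fun a => F a b)) (h₂ : ∀ a, Lin k (fun b => F a b)) :
    sw ((ambient hcomp).coact c) F = sw (𝓒.coact c) fun g u => F (RightBi.inlH 𝓑 g) u :=
  𝓒.toLeftCrossedModule.sw_extend_coact _ _ hcomp.isCrossedAlong c F h₁ h₂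

/-- The inclusion of the right biproduct. -/
def inclRight : RightBi 𝓑 →ₐc[k] Ambient hcomp := LeftBi.incl (ambient hcomp)

/-- The inclusion of `C`. -/
def inlC : C →ₐ[k] Ambient hcomp := LeftBi.inlC (ambient hcomp)

theorem inlC_apply (c : C) : inlC hcomp c = LeftBi.inlC (ambient hcomp) c := rfl

theorem inclRight_apply (a : RightBi 𝓑) : inclRight hcomp a = LeftBi.inrH (ambient hcomp) a := rfl

theorem mk_eq (c : C) (a : RightBi 𝓑) :
    LeftBi.mk (ambient hcomp) c a = inlC hcomp c * inclRight hcomp a :=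
  LeftBi.mk_eq (ambient hcomp) c a

theorem inclRight_eq_mk (a : RightBi 𝓑) :
    inclRight hcomp a = LeftBi.mk (ambient hcomp) 1 a := rfl

theorem inlC_eq_mk (c : C) : inlC hcomp c = LeftBi.mk (ambient hcomp) c 1 := rfl

theorem inclRight_inlH_mul_inlC (h : H) (c : C) :
    inclRight hcomp (RightBi.inlH 𝓑 h) * inlC hcomp c = sw (Δ h) fun h₁ h₂ =>
      inlC hcomp (𝓒.act (h₁ ⊗ₜ[k] c)) * inclRight hcomp (RightBi.inlH 𝓑 h₂) := by
  refine (LeftBi.inrH_mul_inlC (ambient hcomp) _ _).trans ?_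
  simp only [ambient_act]
  refine (sw_comul_map (RightBi.incl 𝓑) h (fun a₁ a₂ => inlC hcomp (𝓒.act
    (RightBi.proj 𝓑 a₁ ⊗ₜ[k] c)) * inclRight hcomp a₂) (by fun_prop) (by fun_prop)).trans ?_
  simp only [RightBi.incl_apply, RightBi.proj_incl]

/-- The algebra `H ⋉ B` acts on `C` through the projection to `H`, which sends `b` to `ε(b)`.
Straightening `b c` thus acts trivially on `c`: before the twist `B` and `C` commute. -/
theorem inclRight_inrB_mul_inlC (b : B) (c : C) :
    inclRight hcomp (RightBi.inrB 𝓑 b) * inlC hcomp c =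
      inlC hcomp c * inclRight hcomp (RightBi.inrB 𝓑 b) := by
  refine (LeftBi.inrH_mul_inlC (ambient hcomp) _ _).trans ?_
  simp only [ambient_act, RightBi.comul_inrB]
  refine Eq.trans (b := sw (Δ b) fun b₁ b₂ => sw (𝓑.coact b₁) fun u g => ε u •
    (inlC hcomp c * inclRight hcomp (RightBi.inlH 𝓑 g * RightBi.inrB 𝓑 b₂))) ?_ ?_
  · have h : ∀ u, RightBi.proj 𝓑 (RightBi.inrB 𝓑 u) = ε u • 1 := RightBi.projAlg_inrB 𝓑
    have := fun F h₁ h₂ => sw_sw (X := Ambient hcomp) (Δ b) (fun b₁ b₂ => sw (𝓑.coact b₁)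
      fun u g => RightBi.inrB 𝓑 u ⊗ₜ[k] (RightBi.inlH 𝓑 g * RightBi.inrB 𝓑 b₂)) F h₁ h₂
    refine (this _ (by fun_prop) (by fun_prop)).trans (sw_congr fun b₁ b₂ => ?_)
    simp (disch := fun_prop) only [sw_sw, sw_pure, h, ← TensorProduct.smul_tmul', map_smul,
      𝓒.one_act, smul_mul_assoc]
    rfl
  · simp (disch := fun_prop) only [𝓑.sw_coact_counit', map_one, one_mul]
    exact sw_counit_left b (fun b => inlC hcomp c * inclRight hcomp (RightBi.inrB 𝓑 b))
      (by fun_prop)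

theorem comul_inlC (c : C) : Δ (inlC hcomp c) = sw (Δ c) fun c₁ c₂ => sw (𝓒.coact c₂) fun g u =>
    (inlC hcomp c₁ * inclRight hcomp (RightBi.inlH 𝓑 g)) ⊗ₜ[k] inlC hcomp u := by
  simp only [inlC_apply, inclRight_apply]
  rw [LeftBi.comul_inlC]
  refine sw_congr fun c₁ c₂ => ?_
  rw [sw_ambient_coact hcomp c₂ (fun a u => (LeftBi.inlC (ambient hcomp) c₁ *
    LeftBi.inrH (ambient hcomp) a) ⊗ₜ[k] LeftBi.inlC (ambient hcomp) u) (by fun_prop) (by fun_prop)]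

/-- The inclusion of the left biproduct, as a map of algebras. -/
def inclLeftAlg : LeftBi 𝓒 →ₐ[k] Ambient hcomp :=
  LeftBi.lift 𝓒 (inlC hcomp)
    ((inclRight hcomp : RightBi 𝓑 →ₐ[k] Ambient hcomp).comp (RightBi.inlH 𝓑))
    (inclRight_inlH_mul_inlC hcomp)

theorem inclLeftAlg_mk (c : C) (h : H) : inclLeftAlg hcomp (LeftBi.mk 𝓒 c h) =
    inlC hcomp c * inclRight hcomp (RightBi.inlH 𝓑 h) := LeftBi.lift_mk ..

theorem inclLeftAlg_inlC (c : C) : inclLeftAlg hcomp (LeftBi.inlC 𝓒 c) = inlC hcomp c := by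
  rw [LeftBi.inlC_apply, inclLeftAlg_mk, map_one, map_one, mul_one]

theorem inclLeftAlg_inrH (h : H) :
    inclLeftAlg hcomp (LeftBi.inrH 𝓒 h) = inclRight hcomp (RightBi.inlH 𝓑 h) := by
  rw [LeftBi.inrH_apply, inclLeftAlg_mk, map_one, one_mul]

/-- The inclusion of the left biproduct, as a map of bialgebras. -/
def inclLeft : LeftBi 𝓒 →ₐc[k] Ambient hcomp :=
  BialgHom.ofAlgHom (inclLeftAlg hcomp)
    (LeftBi.algHom_ext
      (fun c => by
        simp only [AlgHom.comp_apply, Bialgebra.counitAlgHom_apply, inclLeftAlg_inlC,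
          LeftBi.counit_inlC]
        exact LeftBi.counit_inlC (ambient hcomp) c)
      (fun h => by
        simp only [AlgHom.comp_apply, Bialgebra.counitAlgHom_apply, inclLeftAlg_inrH,
          LeftBi.counit_inrH]
        exact (LeftBi.counit_inrH (ambient hcomp) _).trans (RightBi.counit_inlH 𝓑 h)))
    (LeftBi.algHom_ext
      (fun c => by
        simp only [AlgHom.comp_apply, Bialgebra.comulAlgHom_apply, inclLeftAlg_inlC,
          LeftBi.comul_inlC, algHom_sw, Algebra.TensorProduct.map_tmul, map_mul,
          inclLeftAlg_inrH, comul_inlC])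
      (fun h => by
        simp only [AlgHom.comp_apply, Bialgebra.comulAlgHom_apply, inclLeftAlg_inrH,
          LeftBi.comul_inrH, algHom_sw, Algebra.TensorProduct.map_tmul]
        rw [← CoalgHomClass.map_comp_comul_apply (inclRight hcomp), RightBi.comul_inlH, map_sw]
        rfl))

theorem inclLeft_mk (c : C) (h : H) : inclLeft hcomp (LeftBi.mk 𝓒 c h) =
    inlC hcomp c * inclRight hcomp (RightBi.inlH 𝓑 h) := inclLeftAlg_mk hcomp c h

theorem inclLeft_inlC (c : C) : inclLeft hcomp (LeftBi.inlC 𝓒 c) = inlC hcomp c :=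
  inclLeftAlg_inlC hcomp c

theorem inclLeft_inrH (h : H) :
    inclLeft hcomp (LeftBi.inrH 𝓒 h) = inclRight hcomp (RightBi.inlH 𝓑 h) :=
  inclLeftAlg_inrH hcomp h

/-- The projection to `B`. -/
def toB : Ambient hcomp →ₗc[k] B :=
  (RightBi.projB 𝓑).comp (LeftBi.proj (ambient hcomp) : Ambient hcomp →ₗc[k] RightBi 𝓑)

/-- The projection to `C`. -/
def toC : Ambient hcomp →ₗc[k] C := LeftBi.projC (ambient hcomp)

theorem toB_mk (c : C) (a : RightBi 𝓑) :
    toB hcomp (LeftBi.mk (ambient hcomp) c a) = ε c • RightBi.projB 𝓑 a := by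
  change RightBi.projB 𝓑 (LeftBi.proj (ambient hcomp) (LeftBi.mk (ambient hcomp) c a)) = _
  rw [LeftBi.proj_mk, map_smul]

theorem toC_mk (c : C) (a : RightBi 𝓑) :
    toC hcomp (LeftBi.mk (ambient hcomp) c a) = ε a • c := LeftBi.projC_mk _ c a

theorem toB_inclRight (a : RightBi 𝓑) : toB hcomp (inclRight hcomp a) = RightBi.projB 𝓑 a := by
  rw [inclRight_eq_mk, toB_mk, 𝓒.counit_one, one_smul]

theorem toC_inclRight (a : RightBi 𝓑) : toC hcomp (inclRight hcomp a) = ε a • 1 := by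
  rw [inclRight_eq_mk, toC_mk]

theorem toB_inclLeft (d : LeftBi 𝓒) : toB hcomp (inclLeft hcomp d) = ε d • 1 := by
  induction d using LeftBi.induction with
  | ha x y hx hy => simp only [map_add, add_smul, hx, hy]
  | hm c h =>
    rw [inclLeft_mk, ← mk_eq, toB_mk, RightBi.inlH_apply, RightBi.projB_mk, smul_smul,
      LeftBi.counit_mk]

theorem toC_mk_mul (c : C) (a : RightBi 𝓑) (z : Ambient hcomp) :
    toC hcomp (LeftBi.mk (ambient hcomp) c a * z) =
      c * 𝓒.act (RightBi.proj 𝓑 a ⊗ₜ[k] toC hcomp z) :=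
  LeftBi.projC_mk_mul (ambient hcomp) c a z

theorem comul_mk (c : C) (a : RightBi 𝓑) : Δ (LeftBi.mk (ambient hcomp) c a) =
    sw (Δ c) fun c₁ c₂ => sw (Δ a) fun a₁ a₂ => sw (𝓒.coact c₂) fun g u =>
      LeftBi.mk (ambient hcomp) c₁ (RightBi.inlH 𝓑 g * a₁) ⊗ₜ[k]
        LeftBi.mk (ambient hcomp) u a₂ := by
  rw [LeftBi.comul_mk]
  refine sw_congr fun c₁ c₂ => sw_congr fun a₁ a₂ => ?_
  rw [sw_ambient_coact hcomp c₂ (fun a u => LeftBi.mk (ambient hcomp) c₁ (a * a₁) ⊗ₜ[k]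
    LeftBi.mk (ambient hcomp) u a₂) (by fun_prop) (by fun_prop)]

end Ambient

end Ambient

/-! ### The cocycle of a braided skew-pairing -/

section Pairing

variable {k H B C X : Type*} [Field k] [Ring H] [HopfAlgebra k H] [Ring B] [Algebra k B]
  [Coalgebra k B] [Ring C] [Algebra k C] [Coalgebra k C] [AddCommGroup X] [Module k X]
  {𝓑 : RightBraidedGroup k H B} {𝓒 : LeftBraidedGroup k H C} {p : C ⊗[k] B →ₗ[k] k}

local notation "Δ" => Coalgebra.comul (R := k)
local notation "ε" => Coalgebra.counit (R := k)

namespace IsBraidedSkewPairing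

theorem pair_mul_sw (hp : IsBraidedSkewPairing 𝓑 𝓒 p) (c : C) (a b : B) :
    p (c ⊗ₜ[k] (a * b)) = sw (𝓑.coact b) fun u g => sw (Δ c) fun c₁ c₂ =>
      p (c₁ ⊗ₜ[k] u) * p (c₂ ⊗ₜ[k] 𝓑.act (a ⊗ₜ[k] g)) := by
  rw [hp.pair_mul]
  conv_lhs => rw [← sw_tmul_eq (Δ c)]
  simp only [pairTwo, rightBraiding, LinearMap.comp_apply, LinearMap.lTensor_tmul,
    LinearEquiv.coe_coe]
  conv_lhs => rw [← sw_tmul_eq (𝓑.coact b)]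
  simp only [sw_tmul, tmul_sw, map_sw, equiv_sw, TensorProduct.leftComm_tmul,
    LinearMap.lTensor_tmul, TensorProduct.tensorTensorTensorComm_tmul, TensorProduct.map_tmul,
    LinearMap.mul'_apply]

theorem mul_pair_sw (hp : IsBraidedSkewPairing 𝓑 𝓒 p) (c d : C) (b : B) :
    p ((c * d) ⊗ₜ[k] b) = sw (Δ b) fun b₁ b₂ => p (c ⊗ₜ[k] b₁) * p (d ⊗ₜ[k] b₂) := by
  rw [hp.mul_pair]
  conv_lhs => rw [← sw_tmul_eq (Δ b)]
  simp only [pairTwo, LinearMap.comp_apply, LinearEquiv.coe_coe, tmul_sw, map_sw,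
    TensorProduct.tensorTensorTensorComm_tmul, TensorProduct.map_tmul, LinearMap.mul'_apply]

end IsBraidedSkewPairing

/-- The pairing, as a functional on `B ⊗ C`. -/
def pairForm {B C : Type*} [Ring B] [Algebra k B] [Ring C] [Algebra k C]
    (p : C ⊗[k] B →ₗ[k] k) : B ⊗[k] C →ₗ[k] k := p ∘ₗ (TensorProduct.comm k B C).toLinearMap

/-- The convolution inverse of the pairing, as a functional on `B ⊗ C`. -/
def pairFormInv {B : Type*} [Ring B] [Algebra k B] (𝓒 : LeftBraidedGroup k H C)
    (p : C ⊗[k] B →ₗ[k] k) : B ⊗[k] C →ₗ[k] k :=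
  p ∘ₗ LinearMap.rTensor B 𝓒.antipode ∘ₗ (TensorProduct.comm k B C).toLinearMap

theorem pairForm_tmul {B C : Type*} [Ring B] [Algebra k B] [Ring C] [Algebra k C]
    (p : C ⊗[k] B →ₗ[k] k) (b : B) (c : C) : pairForm p (b ⊗ₜ[k] c) = p (c ⊗ₜ[k] b) := rfl

theorem pairFormInv_tmul {B : Type*} [Ring B] [Algebra k B] (𝓒 : LeftBraidedGroup k H C)
    (p : C ⊗[k] B →ₗ[k] k) (b : B) (c : C) :
    pairFormInv 𝓒 p (b ⊗ₜ[k] c) = p (𝓒.antipode c ⊗ₜ[k] b) := rfl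

/-- Multiplicativity `⟨c d, b⟩ = ⟨c, b₁⟩ ⟨d, b₂⟩` turns the convolution into `⟨c₁ S(c₂), b⟩`, which
the braided antipode of `C` evaluates to `ε(c) ε(b)`. -/
theorem pairForm_lact_inv (hp : IsBraidedSkewPairing 𝓑 𝓒 p) :
    lact (pairForm p) (pairFormInv 𝓒 p) = ε := by
  refine TensorProduct.ext' fun b c => ?_
  rw [lact_apply, sw_comul_tmul _ _ _ (by fun_prop) (by fun_prop), sw_comm]
  simp only [pairForm_tmul, pairFormInv_tmul, smul_eq_mul, ← hp.mul_pair_sw]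
  rw [𝓒.sw_antipode_right c (fun x => p (x ⊗ₜ[k] b)) (by fun_prop), hp.one_pair, counit_tmul,
    smul_eq_mul, mul_comm]

theorem pairForm_inv_lact (hp : IsBraidedSkewPairing 𝓑 𝓒 p) :
    lact (pairFormInv 𝓒 p) (pairForm p) = ε := by
  refine TensorProduct.ext' fun b c => ?_
  rw [lact_apply, sw_comul_tmul _ _ _ (by fun_prop) (by fun_prop), sw_comm]
  simp only [pairForm_tmul, pairFormInv_tmul, smul_eq_mul, ← hp.mul_pair_sw]
  rw [𝓒.sw_antipode_left c (fun x => p (x ⊗ₜ[k] b)) (by fun_prop), hp.one_pair, counit_tmul,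
    smul_eq_mul, mul_comm]

namespace Ambient

variable (hcomp : Compatible 𝓑 𝓒)

/-- The projections to `B` and `C` on the two factors, as a map of coalgebras. -/
def toBC : Ambient hcomp ⊗[k] Ambient hcomp →ₗc[k] B ⊗[k] C :=
  Coalgebra.TensorProduct.map (toB hcomp) (toC hcomp)

variable (p) in
/-- The functional `x ⊗ y ↦ ⟨y_C, x_B⟩`. -/
def form : Ambient hcomp ⊗[k] Ambient hcomp →ₗ[k] k := pairForm p ∘ₗ (toBC hcomp).toLinearMap

variable (p) in
/-- The functional `x ⊗ y ↦ ⟨S y_C, x_B⟩`. -/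
def formInv : Ambient hcomp ⊗[k] Ambient hcomp →ₗ[k] k :=
  pairFormInv 𝓒 p ∘ₗ (toBC hcomp).toLinearMap

variable (p) in
theorem form_tmul (x y : Ambient hcomp) :
    form p hcomp (x ⊗ₜ[k] y) = p (toC hcomp y ⊗ₜ[k] toB hcomp x) := rfl

variable (p) in
theorem formInv_tmul (x y : Ambient hcomp) :
    formInv p hcomp (x ⊗ₜ[k] y) = p (𝓒.antipode (toC hcomp y) ⊗ₜ[k] toB hcomp x) := rfl

theorem toB_one : toB hcomp 1 = 1 := by
  rw [LeftBi.one_eq, toB_mk, 𝓒.counit_one, one_smul, RightBi.one_eq, RightBi.projB_mk,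
    Bialgebra.counit_one, one_smul]

theorem toC_one : toC hcomp 1 = 1 := by
  rw [LeftBi.one_eq, toC_mk, Bialgebra.counit_one, one_smul]

/-- The coproduct of `c ⊗ a`, projected to `C` and the right biproduct. -/
theorem sw_comul_toC_proj (c : C) (a : RightBi 𝓑) (F : C → RightBi 𝓑 → X)
    (h₁ : ∀ b, Lin k (fun a => F a b)) (h₂ : ∀ a, Lin k (fun b => F a b)) :
    (sw (Δ (LeftBi.mk (ambient hcomp) c a)) fun y₁ y₂ =>
      F (toC hcomp y₁) (LeftBi.proj (ambient hcomp) y₂)) = F c a := by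
  rw [comul_mk]
  simp (disch := fun_prop) only [sw_sw, sw_pure, toC_mk, LeftBi.proj_mk, Bialgebra.counit_mul,
    RightBi.counit_inlH, (h₁ _).smul, (h₂ _).smul, mul_smul, 𝓒.sw_coact_counit, sw_counit_left,
    sw_counit_right]

/-- The coproduct of `c ⊗ h ⊗ b`, projected to `B` on the left. -/
theorem sw_comul_toB (c : C) (h : H) (b : B) (z : Ambient hcomp) (F : B → C → X)
    (h₁ : ∀ y, Lin k (fun x => F x y)) (h₂ : ∀ x, Lin k (fun y => F x y)) :
    (sw (Δ (LeftBi.mk (ambient hcomp) c (RightBi.mk 𝓑 h b))) fun y₁ y₂ =>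
      F (toB hcomp y₁) (toC hcomp (y₂ * z))) =
    sw (𝓑.coact b) fun u g => F u (c * 𝓒.act ((h * g) ⊗ₜ[k] toC hcomp z)) := by
  have hι : ∀ g x u, RightBi.inlH 𝓑 g * RightBi.mk 𝓑 x u = RightBi.mk 𝓑 (g * x) u :=
    fun g x u => by rw [RightBi.mk_eq, RightBi.mk_eq, map_mul, mul_assoc]
  rw [comul_mk]
  simp (disch := fun_prop) only [RightBi.comul_mk, sw_sw, sw_pure, toB_mk, toC_mk_mul, hι,
    RightBi.projB_mk, RightBi.proj_mk, Bialgebra.counit_mul, mul_smul, (h₁ _).smul,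
    ← TensorProduct.smul_tmul', map_smul, mul_smul_comm, (h₂ _).smul, ← smul_sw,
    𝓒.sw_coact_counit, sw_counit_left, sw_counit_right]

-- STEP-free form of the identity: for `y = c h b`, and with `x`, `z` standing for their projections
-- to `B` and `C`, both sides equal `⟨z₁, b⁽¹⁾⟩ ⟨c, x₁⟩ ⟨(h b⁽²⁾) ▷ z₂, x₂⟩`. The left side is `⟨c,
-- x₁⟩ ⟨z, (x₂ ◁ h) b⟩`, expanded by the product rule in `B` and the invariance of the pairing. The
-- right side is `⟨z₁, b⁽¹⁾⟩ ⟨c ((h b⁽²⁾) ▷ z₂), x⟩`, expanded by the product rule in `C`.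
variable {hcomp} in
theorem form_cocycle (hp : IsBraidedSkewPairing 𝓑 𝓒 p) :
    lact (outer (form p hcomp) ε)
      (form p hcomp ∘ₗ LinearMap.rTensor _ (LinearMap.mul' k (Ambient hcomp))) =
    lact (outer ε (form p hcomp) ∘ₗ (TensorProduct.assoc k _ _ _).toLinearMap)
      (form p hcomp ∘ₗ LinearMap.lTensor _ (LinearMap.mul' k (Ambient hcomp)) ∘ₗ
        (TensorProduct.assoc k _ _ _).toLinearMap) := by
  refine TensorProduct.ext_threefold fun x y z => ?_
  induction y using LeftBi.induction with
  | ha y y' hy hy' => simp only [TensorProduct.tmul_add, TensorProduct.add_tmul, map_add, hy, hy']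
  | hm c a =>
  induction a using RightBi.induction with
  | ha a a' ha ha' =>
    simp only [(LeftBi.lin_mk_right (k := k) (ambient hcomp) c).add, TensorProduct.tmul_add,
      TensorProduct.add_tmul, map_add, ha, ha']
  | hm h b =>
  -- Here `y₁` is seen only through `C` and `y₂` only through `H ⋉ B`, and under these projections
  -- the coproduct of `c h b` is just `c ⊗ h b`.
  have hL : ∀ x₁ x₂, (sw (Δ (LeftBi.mk (ambient hcomp) c (RightBi.mk 𝓑 h b))) fun y₁ y₂ =>
      p (toC hcomp y₁ ⊗ₜ[k] toB hcomp x₁) • p (toC hcomp z ⊗ₜ[k] toB hcomp (x₂ * y₂))) =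
        p (c ⊗ₜ[k] toB hcomp x₁) •
          p (toC hcomp z ⊗ₜ[k] (𝓑.act (toB hcomp x₂ ⊗ₜ[k] h) * b)) := fun x₁ x₂ => by
    have := sw_comul_toC_proj hcomp c (RightBi.mk 𝓑 h b) (fun c a =>
      p (c ⊗ₜ[k] toB hcomp x₁) • p (toC hcomp z ⊗ₜ[k]
        RightBi.projB 𝓑 (LeftBi.proj (ambient hcomp) x₂ * a))) (by fun_prop) (by fun_prop)
    rw [RightBi.projB_mul_mk] at this
    rw [show toB hcomp x₂ = RightBi.projB 𝓑 (LeftBi.proj (ambient hcomp) x₂) from rfl, ← this]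
    refine sw_congr fun y₁ y₂ => ?_
    rw [← map_mul]
    rfl
  -- Here `y₁` is seen only through `B`, which leaves `b⁽¹⁾`, while `y₂` retains `c`, `h` and
  -- `b⁽²⁾`, acting on the projection of `z₂`.
  have hR : ∀ z₁ z₂, (sw (Δ (LeftBi.mk (ambient hcomp) c (RightBi.mk 𝓑 h b))) fun y₁ y₂ =>
      p (toC hcomp z₁ ⊗ₜ[k] toB hcomp y₁) • p (toC hcomp (y₂ * z₂) ⊗ₜ[k] toB hcomp x)) =
        sw (𝓑.coact b) fun u g => p (toC hcomp z₁ ⊗ₜ[k] u) •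
          p ((c * 𝓒.act ((h * g) ⊗ₜ[k] toC hcomp z₂)) ⊗ₜ[k] toB hcomp x) := fun z₁ z₂ =>
    sw_comul_toB hcomp c h b z₂ (fun u c => p (toC hcomp z₁ ⊗ₜ[k] u) •
      p (c ⊗ₜ[k] toB hcomp x)) (by fun_prop) (by fun_prop)
  simp only [lact_apply]
  simp (disch := fun_prop) only [sw_comul_tmul, outer_tmul, LinearMap.comp_apply,
    LinearEquiv.coe_coe, TensorProduct.assoc_tmul, LinearMap.rTensor_tmul, LinearMap.lTensor_tmul,
    LinearMap.mul'_apply, form_tmul]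
  calc _ = sw (Δ x) fun x₁ x₂ => p (c ⊗ₜ[k] toB hcomp x₁) •
          p (toC hcomp z ⊗ₜ[k] (𝓑.act (toB hcomp x₂ ⊗ₜ[k] h) * b)) := by
        simp (disch := fun_prop) only [mul_smul, ← smul_sw, sw_counit_left]
        exact sw_congr hL
    _ = sw (Δ (toB hcomp x)) fun x₁ x₂ => sw (𝓑.coact b) fun u g =>
          sw (Δ (toC hcomp z)) fun z₁ z₂ => p (z₁ ⊗ₜ[k] u) •
          p (c ⊗ₜ[k] x₁) • p (𝓒.act ((h * g) ⊗ₜ[k] z₂) ⊗ₜ[k] x₂) := by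
        rw [← sw_comul_map (toB hcomp) x (fun x₁ x₂ => p (c ⊗ₜ[k] x₁) •
          p (toC hcomp z ⊗ₜ[k] (𝓑.act (x₂ ⊗ₜ[k] h) * b))) (by fun_prop) (by fun_prop)]
        simp only [hp.pair_mul_sw, mul_sw, hp.act, 𝓑.act_mul, smul_eq_mul, mul_left_comm]
    _ = sw (Δ z) fun z₁ z₂ => sw (𝓑.coact b) fun u g => p (toC hcomp z₁ ⊗ₜ[k] u) •
          p ((c * 𝓒.act ((h * g) ⊗ₜ[k] toC hcomp z₂)) ⊗ₜ[k] toB hcomp x) := by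
        rw [← sw_comul_map (toC hcomp) z (fun z₁ z₂ => sw (𝓑.coact b) fun u g =>
          p (z₁ ⊗ₜ[k] u) • p ((c * 𝓒.act ((h * g) ⊗ₜ[k] z₂)) ⊗ₜ[k] toB hcomp x))
          (by fun_prop) (by fun_prop)]
        simp only [hp.mul_pair_sw, mul_sw, smul_eq_mul]
        rw [sw_comm, sw_comm (Δ (toC hcomp z))]
        refine sw_congr fun u g => ?_
        rw [sw_comm]
    _ = _ := by
        simp only [← hR, mul_smul]
        simp (disch := fun_prop) only [sw_comm (Δ x), sw_counit_left]
        rw [sw_comm]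

variable {hcomp} in
/-- The cocycle defined by a braided skew-pairing. -/
def cocycle (hp : IsBraidedSkewPairing 𝓑 𝓒 p) : Cocycle k (Ambient hcomp) where
  toFun := form p hcomp
  inv := formInv p hcomp
  lact_inv := by
    rw [form, formInv, ← lact_comp, pairForm_lact_inv hp]
    exact (toBC hcomp).counit_comp
  inv_lact := by
    rw [form, formInv, ← lact_comp, pairForm_inv_lact hp]
    exact (toBC hcomp).counit_comp
  one_tmul x := by
    rw [form_tmul, toB_one, hp.pair_one]
    exact CoalgHomClass.counit_comp_apply (toC hcomp) x
  tmul_one x := by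
    rw [form_tmul, toC_one, hp.one_pair]
    exact CoalgHomClass.counit_comp_apply (toB hcomp) x
  cocycle := form_cocycle hp

end Ambient

end Pairing

/-! ### The double biproduct -/

section Double

variable {k H B C X : Type*} [Field k] [Ring H] [HopfAlgebra k H] [Ring B] [Algebra k B]
  [Coalgebra k B] [Ring C] [Algebra k C] [Coalgebra k C] [AddCommGroup X] [Module k X]
  {𝓑 : RightBraidedGroup k H B} {𝓒 : LeftBraidedGroup k H C} {p : C ⊗[k] B →ₗ[k] k}

local notation "Δ" => Coalgebra.comul (R := k)
local notation "ε" => Coalgebra.counit (R := k)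

namespace Ambient

variable {hcomp : Compatible 𝓑 𝓒}

/-- The projection to `B` is the counit on `C ⋊ H`, so the cocycle is trivial there. Left
multiplication by `C ⋊ H` is therefore not changed by the twist. -/
theorem form_inclLeft_tmul (hp : IsBraidedSkewPairing 𝓑 𝓒 p) (d : LeftBi 𝓒) (y : Ambient hcomp) :
    form p hcomp (inclLeft hcomp d ⊗ₜ[k] y) = ε d * ε y := by
  rw [form_tmul, toB_inclLeft, TensorProduct.tmul_smul, map_smul, hp.pair_one, smul_eq_mul,
    CoalgHomClass.counit_comp_apply]

/-- The projection to `C` is the counit on `H ⋉ B`, so right multiplication by `H ⋉ B` is not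
changed by the twist. -/
theorem form_tmul_inclRight (hp : IsBraidedSkewPairing 𝓑 𝓒 p) (x : Ambient hcomp) (a : RightBi 𝓑) :
    form p hcomp (x ⊗ₜ[k] inclRight hcomp a) = ε x * ε a := by
  rw [form_tmul, toC_inclRight, ← TensorProduct.smul_tmul', map_smul, hp.one_pair, smul_eq_mul,
    CoalgHomClass.counit_comp_apply, mul_comm]

end Ambient

/-- The double biproduct: the twist of `Ambient` by the cocycle of the pairing. -/
abbrev Double (hcomp : Compatible 𝓑 𝓒) (hp : IsBraidedSkewPairing 𝓑 𝓒 p) : Type _ :=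
  Twisted (Ambient.cocycle (hcomp := hcomp) hp)

namespace Double

variable (hcomp : Compatible 𝓑 𝓒) (hp : IsBraidedSkewPairing 𝓑 𝓒 p)

/-- The identity map from `Ambient`. -/
def of : Ambient hcomp ≃ₗc[k] Double hcomp hp := Twisted.equiv _

@[fun_prop]
theorem lin_of : Lin k (fun x => of hcomp hp x) := ⟨map_add _, map_smul (of hcomp hp)⟩

theorem of_mul_of (x y : Ambient hcomp) : of hcomp hp x * of hcomp hp y =
    of hcomp hp ((Ambient.cocycle hp).mul (x ⊗ₜ[k] y)) := rfl

theorem of_one : of hcomp hp 1 = 1 := rfl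

theorem of_inclLeft_mul (d : LeftBi 𝓒) (y : Ambient hcomp) :
    of hcomp hp (Ambient.inclLeft hcomp d) * of hcomp hp y =
      of hcomp hp (Ambient.inclLeft hcomp d * y) := by
  have h : (Ambient.cocycle hp).mul (Ambient.inclLeft hcomp d ⊗ₜ[k] y) =
      Ambient.inclLeft hcomp d * y :=
    (Ambient.cocycle hp).mul_comp_map (Ambient.inclLeft hcomp : LeftBi 𝓒 →ₗc[k] Ambient hcomp)
      (CoalgHom.id k (Ambient hcomp)) (Ambient.form_inclLeft_tmul hp) d y
  rw [of_mul_of, h]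

theorem of_mul_inclRight (x : Ambient hcomp) (a : RightBi 𝓑) :
    of hcomp hp x * of hcomp hp (Ambient.inclRight hcomp a) =
      of hcomp hp (x * Ambient.inclRight hcomp a) := by
  have h : (Ambient.cocycle hp).mul (x ⊗ₜ[k] Ambient.inclRight hcomp a) =
      x * Ambient.inclRight hcomp a :=
    (Ambient.cocycle hp).mul_comp_map (CoalgHom.id k (Ambient hcomp))
      (Ambient.inclRight hcomp : RightBi 𝓑 →ₗc[k] Ambient hcomp)
      (Ambient.form_tmul_inclRight hp) x a
  rw [of_mul_of, h]

/-- The inclusion of the right biproduct. -/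
def inclRight : RightBi 𝓑 →ₐc[k] Double hcomp hp :=
  { ((of hcomp hp : Ambient hcomp →ₗc[k] Double hcomp hp).comp
      (Ambient.inclRight hcomp : _ →ₗc[k] _)) with
    map_one' := by
      change of hcomp hp (Ambient.inclRight hcomp 1) = 1
      rw [map_one, of_one]
    map_mul' := fun x y => by
      change of hcomp hp (Ambient.inclRight hcomp (x * y)) =
        of hcomp hp (Ambient.inclRight hcomp x) * of hcomp hp (Ambient.inclRight hcomp y)
      rw [of_mul_inclRight, map_mul] }

theorem inclRight_apply (a : RightBi 𝓑) :
    inclRight hcomp hp a = of hcomp hp (Ambient.inclRight hcomp a) := rfl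

/-- The inclusion of the left biproduct. -/
def inclLeft : LeftBi 𝓒 →ₐc[k] Double hcomp hp :=
  { ((of hcomp hp : Ambient hcomp →ₗc[k] Double hcomp hp).comp
      (Ambient.inclLeft hcomp : _ →ₗc[k] _)) with
    map_one' := by
      change of hcomp hp (Ambient.inclLeft hcomp 1) = 1
      rw [map_one, of_one]
    map_mul' := fun x y => by
      change of hcomp hp (Ambient.inclLeft hcomp (x * y)) =
        of hcomp hp (Ambient.inclLeft hcomp x) * of hcomp hp (Ambient.inclLeft hcomp y)
      rw [of_inclLeft_mul, map_mul] }

theorem inclLeft_apply (d : LeftBi 𝓒) :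
    inclLeft hcomp hp d = of hcomp hp (Ambient.inclLeft hcomp d) := rfl

theorem inclLeft_inrH (h : H) :
    inclLeft hcomp hp (LeftBi.inrH 𝓒 h) = inclRight hcomp hp (RightBi.inlH 𝓑 h) := by
  rw [inclLeft_apply, inclRight_apply, Ambient.inclLeft_inrH]

theorem inclLeft_mul_inclRight (d : LeftBi 𝓒) (a : RightBi 𝓑) :
    inclLeft hcomp hp d * inclRight hcomp hp a =
      of hcomp hp (Ambient.inclLeft hcomp d * Ambient.inclRight hcomp a) := by
  rw [inclLeft_apply, inclRight_apply, of_inclLeft_mul]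

theorem of_mk (c : C) (a : RightBi 𝓑) : of hcomp hp (LeftBi.mk (ambient hcomp) c a) =
    inclLeft hcomp hp (LeftBi.inlC 𝓒 c) * inclRight hcomp hp a := by
  rw [inclLeft_mul_inclRight, Ambient.mk_eq, Ambient.inclLeft_inlC]

theorem induction {P : Double hcomp hp → Prop}
    (hm : ∀ c a, P (inclLeft hcomp hp (LeftBi.inlC 𝓒 c) * inclRight hcomp hp a))
    (ha : ∀ x y, P x → P y → P (x + y)) (x : Double hcomp hp) : P x := by
  obtain ⟨x, rfl⟩ : ∃ y, of hcomp hp y = x := ⟨x, rfl⟩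
  induction x using LeftBi.induction with
  | ha x y hx hy => rw [map_add]; exact ha _ _ hx hy
  | hm c a => rw [of_mk]; exact hm c a

/-- The antipode of the double biproduct. -/
def antipodeAux : Double hcomp hp →ₗ[k] Double hcomp hp :=
  ofBilin (fun c a => inclRight hcomp hp (HopfAlgebra.antipode k a) *
      inclLeft hcomp hp (HopfAlgebra.antipode k (LeftBi.inlC 𝓒 c))) (by fun_prop) (by fun_prop) ∘ₗ
    (LeftBi.equiv (ambient hcomp)).symm.toLinearMap ∘ₗ
      (of hcomp hp).symm.toLinearEquiv.toLinearMap

theorem antipodeAux_inlC (c : C) (a : RightBi 𝓑) :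
    antipodeAux hcomp hp (inclLeft hcomp hp (LeftBi.inlC 𝓒 c) * inclRight hcomp hp a) =
      inclRight hcomp hp (HopfAlgebra.antipode k a) *
        inclLeft hcomp hp (HopfAlgebra.antipode k (LeftBi.inlC 𝓒 c)) := by
  rw [← of_mk]
  change ofBilin (fun c a => inclRight hcomp hp (HopfAlgebra.antipode k a) *
      inclLeft hcomp hp (HopfAlgebra.antipode k (LeftBi.inlC 𝓒 c))) (by fun_prop) (by fun_prop)
      (c ⊗ₜ[k] a) = _
  rw [ofBilin_tmul]

/-- The definition splits off only a factor from `C`. The formula for all of `C ⋊ H` means that an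
element of `H` may be counted in either factor: antipodes are antimultiplicative, and those of both
biproducts agree on `H`. -/
theorem antipodeAux_mul (d : LeftBi 𝓒) (a : RightBi 𝓑) :
    antipodeAux hcomp hp (inclLeft hcomp hp d * inclRight hcomp hp a) =
      inclRight hcomp hp (HopfAlgebra.antipode k a) *
        inclLeft hcomp hp (HopfAlgebra.antipode k d) := by
  induction d using LeftBi.induction with
  | ha x y hx hy => simp only [map_add, add_mul, mul_add, hx, hy]
  | hm c h =>
    have hR : inclLeft hcomp hp (HopfAlgebra.antipode k (LeftBi.inrH 𝓒 h)) =
        inclRight hcomp hp (HopfAlgebra.antipode k (RightBi.inlH 𝓑 h)) := by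
      have h₁ := bialgHom_antipode (LeftBi.incl 𝓒) h
      have h₂ := bialgHom_antipode (RightBi.incl 𝓑) h
      rw [LeftBi.incl_apply, LeftBi.incl_apply] at h₁
      rw [RightBi.incl_apply, RightBi.incl_apply] at h₂
      rw [← h₁, ← h₂, inclLeft_inrH]
    rw [LeftBi.mk_eq, map_mul (inclLeft hcomp hp), mul_assoc, inclLeft_inrH,
      ← map_mul (inclRight hcomp hp), antipodeAux_inlC,
      HopfAlgebra.antipode_mul_antidistrib, HopfAlgebra.antipode_mul_antidistrib, map_mul, map_mul,
      hR, mul_assoc]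

theorem comul_mul_eq (d : LeftBi 𝓒) (a : RightBi 𝓑) :
    Δ (inclLeft hcomp hp d * inclRight hcomp hp a) =
      sw (Δ d) fun d₁ d₂ => sw (Δ a) fun a₁ a₂ =>
        (inclLeft hcomp hp d₁ * inclRight hcomp hp a₁) ⊗ₜ[k]
          (inclLeft hcomp hp d₂ * inclRight hcomp hp a₂) := by
  rw [Bialgebra.comul_mul, ← CoalgHomClass.map_comp_comul_apply (inclLeft hcomp hp),
    ← CoalgHomClass.map_comp_comul_apply (inclRight hcomp hp)]
  conv_lhs => rw [← sw_tmul_eq (Δ d), ← sw_tmul_eq (Δ a)]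
  simp only [map_sw, sw_mul, mul_sw, TensorProduct.map_tmul]
  rw [sw_comm]
  simp only [Algebra.TensorProduct.tmul_mul_tmul]
  rfl

/-- The expression `S(a₁) S(d₁) d₂ a₂` telescopes: the antipode of `C ⋊ H` acts inside, then that of
`H ⋉ B` outside. -/
theorem antipode_left (x : Double hcomp hp) :
    LinearMap.mul' k _ (LinearMap.rTensor _ (antipodeAux hcomp hp) (Δ x)) = ε x • 1 := by
  induction x using induction with
  | ha x y hx hy => simp only [map_add, hx, hy, add_smul]
  | hm c a =>
    generalize LeftBi.inlC 𝓒 c = d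
    rw [comul_mul_eq]
    simp only [map_sw, LinearMap.rTensor_tmul, LinearMap.mul'_apply, antipodeAux_mul]
    calc _ = sw (Δ d) fun d₁ d₂ => sw (Δ a) fun a₁ a₂ =>
          inclRight hcomp hp (HopfAlgebra.antipode k a₁) *
            (inclLeft hcomp hp (HopfAlgebra.antipode k d₁ * d₂) * inclRight hcomp hp a₂) := by
          simp only [map_mul, mul_assoc]
      _ = sw (Δ a) fun a₁ a₂ => ε d • inclRight hcomp hp (HopfAlgebra.antipode k a₁ * a₂) := by
          rw [sw_comm]
          refine sw_congr fun a₁ a₂ => ?_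
          rw [sw_hopf_left d (fun d => inclRight hcomp hp (HopfAlgebra.antipode k a₁) *
            (inclLeft hcomp hp d * inclRight hcomp hp a₂)) (by fun_prop), map_one, one_mul,
            map_mul]
      _ = _ := by
          rw [sw_hopf_left a (fun a => ε d • inclRight hcomp hp a) (by fun_prop), map_one,
            Bialgebra.counit_mul, CoalgHomClass.counit_comp_apply,
            CoalgHomClass.counit_comp_apply, smul_smul, mul_comm]

/-- The expression `d₁ a₁ S(a₂) S(d₂)` telescopes with the two biproducts in the opposite order. -/
theorem antipode_right (x : Double hcomp hp) :
    LinearMap.mul' k _ (LinearMap.lTensor _ (antipodeAux hcomp hp) (Δ x)) = ε x • 1 := by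
  induction x using induction with
  | ha x y hx hy => simp only [map_add, hx, hy, add_smul]
  | hm c a =>
    generalize LeftBi.inlC 𝓒 c = d
    rw [comul_mul_eq]
    simp only [map_sw, LinearMap.lTensor_tmul, LinearMap.mul'_apply, antipodeAux_mul]
    calc _ = sw (Δ d) fun d₁ d₂ => sw (Δ a) fun a₁ a₂ =>
          inclLeft hcomp hp d₁ * (inclRight hcomp hp (a₁ * HopfAlgebra.antipode k a₂) *
            inclLeft hcomp hp (HopfAlgebra.antipode k d₂)) := by
          simp only [map_mul, mul_assoc]
      _ = sw (Δ d) fun d₁ d₂ => ε a • inclLeft hcomp hp (d₁ * HopfAlgebra.antipode k d₂) := by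
          refine sw_congr fun d₁ d₂ => ?_
          rw [sw_hopf_right a (fun a => inclLeft hcomp hp d₁ * (inclRight hcomp hp a *
            inclLeft hcomp hp (HopfAlgebra.antipode k d₂))) (by fun_prop), map_one, one_mul,
            map_mul]
      _ = _ := by
          rw [sw_hopf_right d (fun d => ε a • inclLeft hcomp hp d) (by fun_prop), map_one,
            Bialgebra.counit_mul, CoalgHomClass.counit_comp_apply,
            CoalgHomClass.counit_comp_apply, smul_smul]

instance : HopfAlgebra k (Double hcomp hp) where
  antipode := antipodeAux hcomp hp
  mul_antipode_rTensor_comul := by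
    ext x
    refine (antipode_left hcomp hp x).trans ?_
    rw [← Algebra.algebraMap_eq_smul_one]
    rfl
  mul_antipode_lTensor_comul := by
    ext x
    refine (antipode_right hcomp hp x).trans ?_
    rw [← Algebra.algebraMap_eq_smul_one]
    rfl

end Double

end Double

section Cross

variable {k H B C X : Type*} [Field k] [Ring H] [HopfAlgebra k H] [Ring B] [Algebra k B]
  [Coalgebra k B] [Ring C] [Algebra k C] [Coalgebra k C] [AddCommGroup X] [Module k X]
  {𝓑 : RightBraidedGroup k H B} {𝓒 : LeftBraidedGroup k H C} {p : C ⊗[k] B →ₗ[k] k}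

local notation "Δ" => Coalgebra.comul (R := k)
local notation "ε" => Coalgebra.counit (R := k)

/-! ### The cross relations -/

/-- The cross product in Sweedler notation. -/
theorem crossProduct_eq (𝓑 : RightBraidedGroup k H B) (𝓒 : LeftBraidedGroup k H C)
    (p : C ⊗[k] B →ₗ[k] k) (s : HopfData k (C ⊗[k] (H ⊗[k] B))) (b : B) (c : C) :
    crossProduct 𝓑 𝓒 p s b c = sw (Δ b) fun b₁ b' => sw (𝓑.coact b₁) fun u g =>
      sw (Δ b') fun b₂ b₃ => sw (Δ c) fun c' c₃ => sw (Δ c') fun c₁ c₂ =>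
        sw (𝓒.coact c₃) fun h w => p (c₁ ⊗ₜ[k] u) • p (𝓒.antipode w ⊗ₜ[k] b₃) •
          s.mul (s.mul (inclH k H B C g ⊗ₜ[k] inclC k H B C c₂) ⊗ₜ[k]
            s.mul (inclB k H B C b₂ ⊗ₜ[k] inclH k H B C h)) := by
  have hL : ∀ u g c₁ c₂, crossLeft p s ((u ⊗ₜ[k] g) ⊗ₜ[k] (c₁ ⊗ₜ[k] c₂)) =
      p (c₁ ⊗ₜ[k] u) • s.mul (inclH k H B C g ⊗ₜ[k] inclC k H B C c₂) := fun u g c₁ c₂ => rfl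
  have hR : ∀ b₂ b₃ h w, crossRight 𝓒 p s ((b₂ ⊗ₜ[k] b₃) ⊗ₜ[k] (h ⊗ₜ[k] w)) =
      p (𝓒.antipode w ⊗ₜ[k] b₃) • s.mul (inclB k H B C b₂ ⊗ₜ[k] inclH k H B C h) :=
    fun b₂ b₃ h w => rfl
  have key : ∀ b₁ b' c' c₃, s.mul (crossLeft p s (𝓑.coact b₁ ⊗ₜ[k] Δ c') ⊗ₜ[k]
      crossRight 𝓒 p s (Δ b' ⊗ₜ[k] 𝓒.coact c₃)) =
        sw (𝓑.coact b₁) fun u g => sw (Δ b') fun b₂ b₃ => sw (Δ c') fun c₁ c₂ =>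
        sw (𝓒.coact c₃) fun h w => p (c₁ ⊗ₜ[k] u) • p (𝓒.antipode w ⊗ₜ[k] b₃) •
          s.mul (s.mul (inclH k H B C g ⊗ₜ[k] inclC k H B C c₂) ⊗ₜ[k]
            s.mul (inclB k H B C b₂ ⊗ₜ[k] inclH k H B C h)) := fun b₁ b' c' c₃ => by
    conv_lhs => rw [← sw_tmul_eq (𝓑.coact b₁), ← sw_tmul_eq (Δ c'), ← sw_tmul_eq (Δ b'),
      ← sw_tmul_eq (𝓒.coact c₃)]
    simp only [sw_tmul, tmul_sw, map_sw, hL, hR, smul_sw,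
      ← TensorProduct.smul_tmul', TensorProduct.tmul_smul, map_smul]
    simp only [sw_comm (𝓒.coact c₃)]
    conv_rhs => rw [sw_comm (𝓑.coact b₁)]
    refine sw_congr fun b₂ b₃ => ?_
    conv_rhs => rw [sw_comm (𝓑.coact b₁)]
    refine sw_congr fun c₁ c₂ => ?_
    refine sw_congr fun u g => ?_
    refine sw_congr fun h w => ?_
    rw [smul_comm]
  rw [crossProduct]
  conv_lhs => rw [← sw_tmul_eq (Δ b), ← sw_tmul_eq (Δ c)]
  simp only [sw_tmul, tmul_sw, map_sw, TensorProduct.map_tmul, LinearEquiv.coe_coe, flipMid,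
    TensorProduct.tensorTensorTensorComm_tmul, key]
  rw [sw_comm]
  simp only [sw_comm (Δ c)]

namespace Ambient

variable (hcomp : Compatible 𝓑 𝓒)

/-- With its outer legs projected to `B`, the threefold coproduct of `b` is `b₁⁽¹⁾ ⊗ b₁⁽²⁾ b₂ ⊗ b₃`:
the `H`-factors that reach the last leg, among them the coaction of `b₂`, are killed by the counit.
-/
theorem sw_comul_inclRight_inrB (b : B) (F : B → Ambient hcomp → B → X)
    (h₁ : ∀ y z, Lin k (fun x => F x y z)) (h₂ : ∀ x z, Lin k (fun y => F x y z))
    (h₃ : ∀ x y, Lin k (fun z => F x y z)) :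
    (sw (Δ (inclRight hcomp (RightBi.inrB 𝓑 b))) fun x₁ x => sw (Δ x) fun x₂ x₃ =>
      F (toB hcomp x₁) x₂ (toB hcomp x₃)) =
    sw (Δ b) fun b₁ b' => sw (𝓑.coact b₁) fun u g => sw (Δ b') fun b₂ b₃ =>
      F u (inclRight hcomp (RightBi.inlH 𝓑 g) * inclRight hcomp (RightBi.inrB 𝓑 b₂)) b₃ := by
  rw [sw_comul_map (inclRight hcomp) _ _ (by fun_prop) (by fun_prop)]
  simp only [← map_mul (inclRight hcomp), RightBi.comul_inrB, ← RightBi.mk_eq]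
  simp (disch := fun_prop) only [sw_sw, sw_pure, sw_comul_map (inclRight hcomp), toB_inclRight,
    RightBi.comul_mk, RightBi.projB_mk, RightBi.inrB_apply, Bialgebra.counit_one, one_smul,
    Bialgebra.counit_mul, mul_smul, (h₃ _ _).smul, ← smul_sw]
  refine sw_congr fun b₁ b' => sw_congr fun u g => ?_
  simp (disch := fun_prop) only [𝓑.sw_coact_counit, sw_counit_right]

/-- With its outer legs projected to `C`, the threefold coproduct of `c` is `c₁ ⊗ c₂ c₃⁽¹⁾ ⊗ c₃⁽²⁾`,
because the `H`-factor in the first leg is killed by the counit. -/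
theorem sw_comul_inlC (c : C) (F : C → Ambient hcomp → C → X)
    (h₁ : ∀ y z, Lin k (fun x => F x y z)) (h₂ : ∀ x z, Lin k (fun y => F x y z))
    (h₃ : ∀ x y, Lin k (fun z => F x y z)) :
    (sw (Δ (inlC hcomp c)) fun y₁ y => sw (Δ y) fun y₂ y₃ =>
      F (toC hcomp y₁) y₂ (toC hcomp y₃)) =
    sw (Δ c) fun c₁ c' => sw (Δ c') fun c₂ c₃ => sw (𝓒.coact c₃) fun h w =>
      F c₁ (inlC hcomp c₂ * inclRight hcomp (RightBi.inlH 𝓑 h)) w := by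
  have hC : ∀ w, toC hcomp (inlC hcomp w) = w := fun w => by
    rw [inlC_eq_mk, toC_mk, Bialgebra.counit_one, one_smul]
  have hCH : ∀ w g, toC hcomp (inlC hcomp w * inclRight hcomp (RightBi.inlH 𝓑 g)) = ε g • w :=
    fun w g => by rw [← mk_eq, toC_mk, RightBi.counit_inlH]
  simp (disch := fun_prop) only [comul_inlC, sw_sw, sw_pure, hC, hCH, (h₁ _ _).smul, ← smul_sw,
    𝓒.sw_coact_counit]

end Ambient

namespace Double

variable (hcomp : Compatible 𝓑 𝓒) (hp : IsBraidedSkewPairing 𝓑 𝓒 p)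

theorem of_mul_of_eq (x y : Ambient hcomp) : of hcomp hp x * of hcomp hp y =
    sw (Δ x) fun x₁ x' => sw (Δ x') fun x₂ x₃ => sw (Δ y) fun y₁ y' => sw (Δ y') fun y₂ y₃ =>
      p (Ambient.toC hcomp y₁ ⊗ₜ[k] Ambient.toB hcomp x₁) •
        p (𝓒.antipode (Ambient.toC hcomp y₃) ⊗ₜ[k] Ambient.toB hcomp x₃) •
          of hcomp hp (x₂ * y₂) := by
  have h : (Ambient.cocycle (hcomp := hcomp) hp).mul = lact (Ambient.form p hcomp)
    (ract (LinearMap.mul' k _) (Ambient.formInv p hcomp)) := rfl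
  rw [of_mul_of, h, lact_apply, sw_comul_tmul _ _ _ (by fun_prop) (by fun_prop),
    lin_sw (k := k) _ (lin_of hcomp hp)]
  refine sw_congr fun x₁ x' => ?_
  rw [lin_sw (k := k) _ (lin_of hcomp hp)]
  simp (disch := fun_prop) only [ract_apply, sw_comul_tmul, Ambient.form_tmul,
    Ambient.formInv_tmul, (lin_of hcomp hp).smul, lin_sw _ (lin_of hcomp hp),
    LinearMap.mul'_apply, smul_sw]
  simp only [sw_comm (Δ y)]

theorem inclRight_mul_inclLeft (g : H) (c : C) :
    inclRight hcomp hp (RightBi.inlH 𝓑 g) * inclLeft hcomp hp (LeftBi.inlC 𝓒 c) =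
      inclLeft hcomp hp (LeftBi.inrH 𝓒 g * LeftBi.inlC 𝓒 c) := by
  rw [map_mul, inclLeft_inrH]

/-- The twisted product of `b` and `c` is `⟨c₁, b₁⁽¹⁾⟩ b₁⁽²⁾ b₂ c₂ c₃⁽¹⁾ ⟨S c₃⁽²⁾, b₃⟩`, with the
middle product taken in the untwisted algebra. There `b₂ c₂ = c₂ b₂`, and the product of `b₁⁽²⁾ c₂`
with `b₂ c₃⁽¹⁾` is the same in both algebras. -/
theorem cross (b : B) (c : C) :
    inclRight hcomp hp (RightBi.inrB 𝓑 b) * inclLeft hcomp hp (LeftBi.inlC 𝓒 c) =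
      sw (Δ b) fun b₁ b' => sw (𝓑.coact b₁) fun u g =>
      sw (Δ b') fun b₂ b₃ => sw (Δ c) fun c' c₃ => sw (Δ c') fun c₁ c₂ =>
        sw (𝓒.coact c₃) fun h w => p (c₁ ⊗ₜ[k] u) • p (𝓒.antipode w ⊗ₜ[k] b₃) •
          ((inclRight hcomp hp (RightBi.inlH 𝓑 g) * inclLeft hcomp hp (LeftBi.inlC 𝓒 c₂)) *
            (inclRight hcomp hp (RightBi.inrB 𝓑 b₂) *
              inclRight hcomp hp (RightBi.inlH 𝓑 h))) := by
  rw [inclRight_apply, inclLeft_apply, Ambient.inclLeft_inlC, of_mul_of_eq]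
  rw [Ambient.sw_comul_inclRight_inrB hcomp b (fun u x b₃ =>
    sw (Δ (Ambient.inlC hcomp c)) fun y₁ y' => sw (Δ y') fun y₂ y₃ =>
      p (Ambient.toC hcomp y₁ ⊗ₜ[k] u) •
        p (𝓒.antipode (Ambient.toC hcomp y₃) ⊗ₜ[k] b₃) •
          of hcomp hp (x * y₂)) (by fun_prop) (by fun_prop) (by fun_prop)]
  refine sw_congr fun b₁ b' => sw_congr fun u g => sw_congr fun b₂ b₃ => ?_
  refine (Ambient.sw_comul_inlC hcomp c (fun c₁ y w => p (c₁ ⊗ₜ[k] u) •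
    p (𝓒.antipode w ⊗ₜ[k] b₃) • of hcomp hp (Ambient.inclRight hcomp (RightBi.inlH 𝓑 g) *
      Ambient.inclRight hcomp (RightBi.inrB 𝓑 b₂) * y))
      (by fun_prop) (by fun_prop) (by fun_prop)).trans ?_
  refine (sw_coassoc c (fun c₁ c₂ c₃ => sw (𝓒.coact c₃) fun h w => p (c₁ ⊗ₜ[k] u) •
    p (𝓒.antipode w ⊗ₜ[k] b₃) • of hcomp hp (Ambient.inclRight hcomp (RightBi.inlH 𝓑 g) *
      Ambient.inclRight hcomp (RightBi.inrB 𝓑 b₂) * (Ambient.inlC hcomp c₂ *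
        Ambient.inclRight hcomp (RightBi.inlH 𝓑 h))))
      (by fun_prop) (by fun_prop) (by fun_prop)).symm.trans ?_
  refine sw_congr fun c' c₃ => sw_congr fun c₁ c₂ => sw_congr fun h w => ?_
  -- The factor `g c₂` lies in `C ⋊ H` and `b₂ h` in `H ⋉ B`, so their twisted product is the
  -- untwisted one.
  rw [inclRight_mul_inclLeft, ← map_mul (inclRight hcomp hp), inclLeft_mul_inclRight,
    map_mul (Ambient.inclLeft hcomp), map_mul (Ambient.inclRight hcomp), Ambient.inclLeft_inrH,
    Ambient.inclLeft_inlC]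
  refine congrArg (fun y => p (c₁ ⊗ₜ[k] u) • p (𝓒.antipode w ⊗ₜ[k] b₃) • of hcomp hp y) ?_
  rw [mul_assoc, mul_assoc, ← mul_assoc (Ambient.inclRight hcomp (RightBi.inrB 𝓑 b₂)),
    Ambient.inclRight_inrB_mul_inlC, mul_assoc]

end Double

end Cross

section Recognition

variable {k V V' W W' : Type*} [CommRing k] [AddCommGroup V] [Module k V] [AddCommGroup V']
  [Module k V'] [Ring W] [HopfAlgebra k W] [Ring W'] [HopfAlgebra k W']
  {s : HopfData k V} {t : HopfData k V'} {e : V ≃ₗ[k] W} {e' : V' ≃ₗ[k] W'}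

local notation "Δ" => Coalgebra.comul (R := k)
local notation "ε" => Coalgebra.counit (R := k)

/-! ### Recognising a Hopf algebra structure -/

/-- The product of `x` and `y` in `s` corresponds to the one in `W`. -/
def HopfData.MulAt (s : HopfData k V) (e : V ≃ₗ[k] W) (x y : V) : Prop :=
  e (s.mul (x ⊗ₜ[k] y)) = e x * e y

/-- Associativity on both sides: if `x y`, `y z` and `(x y) z` are already the products of `W`, then
so is `x (y z)`. With `mulAt_left`, this spreads agreement from the generating subspaces to all
products. -/
theorem HopfData.IsHopf.mulAt_right (h : s.IsHopf) {x y z : V} (hxy : s.MulAt e x y)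
    (hyz : s.MulAt e y z) (hz : s.MulAt e (s.mul (x ⊗ₜ[k] y)) z) :
    s.MulAt e x (s.mul (y ⊗ₜ[k] z)) := by
  rw [HopfData.MulAt] at *
  rw [← h.mul_assoc, hz, hxy, hyz, _root_.mul_assoc]

theorem HopfData.IsHopf.mulAt_left (h : s.IsHopf) {x y z : V} (hxy : s.MulAt e x y)
    (hyz : s.MulAt e y z) (hx : s.MulAt e x (s.mul (y ⊗ₜ[k] z))) :
    s.MulAt e (s.mul (x ⊗ₜ[k] y)) z := by
  rw [HopfData.MulAt] at *
  rw [h.mul_assoc, hx, hxy, hyz, _root_.mul_assoc]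

theorem HopfData.MulAt.add_left {x x' y : V} (h : s.MulAt e x y) (h' : s.MulAt e x' y) :
    s.MulAt e (x + x') y := by
  rw [HopfData.MulAt] at *
  rw [TensorProduct.add_tmul, map_add, map_add, map_add, h, h', add_mul]

theorem HopfData.MulAt.add_right {x y y' : V} (h : s.MulAt e x y) (h' : s.MulAt e x y') :
    s.MulAt e x (y + y') := by
  rw [HopfData.MulAt] at *
  rw [TensorProduct.tmul_add, map_add, map_add, map_add, h, h', mul_add]

theorem HopfData.MulAt.zero_left (y : V) : s.MulAt e 0 y := by
  rw [HopfData.MulAt, TensorProduct.zero_tmul, map_zero, map_zero, zero_mul]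

theorem HopfData.MulAt.zero_right (x : V) : s.MulAt e x 0 := by
  rw [HopfData.MulAt, TensorProduct.tmul_zero, map_zero, map_zero, mul_zero]

theorem HopfData.IsSubHopf.mulAt {i : V' →ₗ[k] V} (h : t.IsSubHopf s i) (ht : t.Corresponds e')
    (φ : W' →ₐc[k] W) (hi : ∀ x, e (i x) = φ (e' x)) (x y : V') : s.MulAt e (i x) (i y) := by
  rw [HopfData.MulAt, ← h.map_mul, hi, ht.mul, _root_.map_mul, hi, hi]

theorem HopfData.IsSubHopf.comul_eq {i : V' →ₗ[k] V} (h : t.IsSubHopf s i)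
    (ht : t.Corresponds e') (φ : W' →ₐc[k] W) (hi : ∀ x, e (i x) = φ (e' x)) (x : V') :
    TensorProduct.map e.toLinearMap e.toLinearMap (s.comul (i x)) = Δ (e (i x)) := by
  rw [← h.map_comul, hi, ← CoalgHomClass.map_comp_comul_apply, ← ht.comul]
  conv_lhs => rw [← sw_tmul_eq (t.comul x)]
  conv_rhs => rw [← sw_tmul_eq (t.comul x)]
  simp only [map_sw, TensorProduct.map_tmul, hi, LinearEquiv.coe_coe]
  rfl

theorem HopfData.IsSubHopf.counit_eq {i : V' →ₗ[k] V} (h : t.IsSubHopf s i)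
    (ht : t.Corresponds e') (φ : W' →ₐc[k] W) (hi : ∀ x, e (i x) = φ (e' x)) (x : V') :
    s.counit (i x) = ε (e (i x)) := by
  rw [h.map_counit, ht.counit, hi, CoalgHomClass.counit_comp_apply φ]

theorem HopfData.IsHopf.comul_mul_eq (h : s.IsHopf) (hm : ∀ x y, s.MulAt e x y) {x y : V}
    (hx : TensorProduct.map e.toLinearMap e.toLinearMap (s.comul x) = Δ (e x))
    (hy : TensorProduct.map e.toLinearMap e.toLinearMap (s.comul y) = Δ (e y)) :
    TensorProduct.map e.toLinearMap e.toLinearMap (s.comul (s.mul (x ⊗ₜ[k] y))) =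
      Δ (e (s.mul (x ⊗ₜ[k] y))) := by
  have hm' : ∀ x y, e (s.mul (x ⊗ₜ[k] y)) = e x * e y := hm
  rw [hm', Bialgebra.comul_mul, ← hx, ← hy, h.comul_mul]
  conv_rhs => rw [← sw_tmul_eq (s.comul x), ← sw_tmul_eq (s.comul y)]
  conv_lhs => rw [← sw_tmul_eq (s.comul x), ← sw_tmul_eq (s.comul y)]
  simp only [sw_mul, mul_sw, sw_tmul, tmul_sw, map_sw, LinearEquiv.coe_coe,
    TensorProduct.tensorTensorTensorComm_tmul, TensorProduct.map_tmul, hm',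
    Algebra.TensorProduct.tmul_mul_tmul]

end Recognition

theorem inclHB_injective {k H B C : Type*} [Field k] [Ring H] [HopfAlgebra k H] [Ring B]
    [Algebra k B] [Ring C] [Algebra k C] [Coalgebra k C] (𝓒 : LeftBraidedGroup k H C) :
    Function.Injective (inclHB k H B C) := by
  refine Function.LeftInverse.injective
    (g := (TensorProduct.lid k _).toLinearMap ∘ₗ LinearMap.rTensor _ (Coalgebra.counit (R := k)))
    fun x => ?_
  change TensorProduct.lid k _ (LinearMap.rTensor _ (Coalgebra.counit (R := k))
    ((1 : C) ⊗ₜ[k] x)) = x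
  rw [LinearMap.rTensor_tmul, 𝓒.counit_one, TensorProduct.lid_tmul, one_smul]

theorem inclCH_injective {k H B C : Type*} [Field k] [Ring H] [HopfAlgebra k H] [Ring B]
    [Algebra k B] [Coalgebra k B] [Ring C] [Algebra k C] (𝓑 : RightBraidedGroup k H B) :
    Function.Injective (inclCH k H B C) := by
  refine Function.LeftInverse.injective
    (g := LinearMap.lTensor C ((TensorProduct.rid k H).toLinearMap ∘ₗ
      LinearMap.lTensor H (Coalgebra.counit (R := k)))) fun x => ?_
  induction x with
  | zero => simp only [map_zero]
  | add x y hx hy => simp only [map_add, hx, hy]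
  | tmul c h =>
    change c ⊗ₜ[k] (TensorProduct.rid k H (LinearMap.lTensor H (Coalgebra.counit (R := k))
      (h ⊗ₜ[k] (1 : B)))) = _
    rw [LinearMap.lTensor_tmul, 𝓑.counit_one, TensorProduct.rid_tmul, one_smul]

/-! ### Existence and uniqueness on `C ⊗ H ⊗ B` -/

section Main

variable {k H B C X : Type*} [Field k] [Ring H] [HopfAlgebra k H] [Ring B] [Algebra k B]
  [Coalgebra k B] [Ring C] [Algebra k C] [Coalgebra k C]
  {𝓑 : RightBraidedGroup k H B} {𝓒 : LeftBraidedGroup k H C} {p : C ⊗[k] B →ₗ[k] k}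

local notation "Δ" => Coalgebra.comul (R := k)
local notation "ε" => Coalgebra.counit (R := k)

namespace Double

variable (hcomp : Compatible 𝓑 𝓒) (hp : IsBraidedSkewPairing 𝓑 𝓒 p)

/-- The double biproduct as a vector space is `C ⊗ H ⊗ B`. -/
def equiv : C ⊗[k] (H ⊗[k] B) ≃ₗ[k] Double hcomp hp :=
  (TensorProduct.congr (LinearEquiv.refl k C) (RightBi.equiv 𝓑) ≪≫ₗ
    LeftBi.equiv (ambient hcomp)) ≪≫ₗ (of hcomp hp).toLinearEquiv

theorem equiv_tmul (c : C) (a : H ⊗[k] B) : equiv hcomp hp (c ⊗ₜ[k] a) =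
    inclLeft hcomp hp (LeftBi.inlC 𝓒 c) * inclRight hcomp hp (RightBi.equiv 𝓑 a) :=
  of_mk hcomp hp c (RightBi.equiv 𝓑 a)

theorem equiv_inclHB (a : H ⊗[k] B) :
    equiv hcomp hp (inclHB k H B C a) = inclRight hcomp hp (RightBi.equiv 𝓑 a) := by
  change equiv hcomp hp (1 ⊗ₜ[k] a) = _
  rw [equiv_tmul, map_one, map_one, one_mul]

theorem equiv_inclCH (d : C ⊗[k] H) :
    equiv hcomp hp (inclCH k H B C d) = inclLeft hcomp hp (LeftBi.equiv 𝓒 d) := by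
  induction d with
  | zero => simp only [map_zero]
  | add x y hx hy => simp only [map_add, hx, hy]
  | tmul c h =>
    change equiv hcomp hp (c ⊗ₜ[k] (h ⊗ₜ[k] 1)) = _
    rw [equiv_tmul]
    change _ * inclRight hcomp hp (RightBi.inlH 𝓑 h) = inclLeft hcomp hp (LeftBi.mk 𝓒 c h)
    rw [LeftBi.mk_eq, map_mul, inclLeft_inrH]

theorem equiv_inclB (b : B) :
    equiv hcomp hp (inclB k H B C b) = inclRight hcomp hp (RightBi.inrB 𝓑 b) :=
  equiv_inclHB hcomp hp (1 ⊗ₜ[k] b)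

theorem equiv_inclH (h : H) :
    equiv hcomp hp (inclH k H B C h) = inclRight hcomp hp (RightBi.inlH 𝓑 h) :=
  equiv_inclHB hcomp hp (h ⊗ₜ[k] 1)

theorem equiv_inclC (c : C) :
    equiv hcomp hp (inclC k H B C c) = inclLeft hcomp hp (LeftBi.inlC 𝓒 c) :=
  equiv_inclCH hcomp hp (c ⊗ₜ[k] 1)

end Double

theorem isDoubleBiproduct_of_corresponds {hcomp : Compatible 𝓑 𝓒}
    {hp : IsBraidedSkewPairing 𝓑 𝓒 p} {s : HopfData k (C ⊗[k] (H ⊗[k] B))}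
    (hs : s.Corresponds (Double.equiv hcomp hp)) : IsDoubleBiproduct 𝓑 𝓒 p s where
  isHopf := hs.isHopf
  right_sub := (rightBiproduct_corresponds 𝓑).isSubHopf hs (Double.inclRight hcomp hp) _
    (Double.equiv_inclHB hcomp hp) (inclHB_injective 𝓒)
  left_sub := (leftBiproduct_corresponds 𝓒).isSubHopf hs (Double.inclLeft hcomp hp) _
    (Double.equiv_inclCH hcomp hp) (inclCH_injective 𝓑)
  triangular c h b := (Double.equiv hcomp hp).injective (by
    rw [hs.mul, hs.mul, Double.equiv_inclB, Double.equiv_inclC, Double.equiv_inclH,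
      Double.equiv_tmul, mul_assoc, ← map_mul, ← RightBi.mk_eq]
    rfl)
  cross b c := (Double.equiv hcomp hp).injective (by
    rw [hs.mul, Double.equiv_inclB, Double.equiv_inclC, Double.cross, crossProduct_eq]
    simp only [equiv_sw, map_smul, hs.mul, Double.equiv_inclB, Double.equiv_inclC,
      Double.equiv_inclH])

namespace IsDoubleBiproduct

variable (hcomp : Compatible 𝓑 𝓒) (hp : IsBraidedSkewPairing 𝓑 𝓒 p)
  {s : HopfData k (C ⊗[k] (H ⊗[k] B))}

theorem mulAt_inclCH_inclCH (hs : IsDoubleBiproduct 𝓑 𝓒 p s) (d d' : C ⊗[k] H) :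
    s.MulAt (Double.equiv hcomp hp) (inclCH k H B C d) (inclCH k H B C d') :=
  hs.left_sub.mulAt (leftBiproduct_corresponds 𝓒) (Double.inclLeft hcomp hp)
    (Double.equiv_inclCH hcomp hp) d d'

theorem mulAt_inclHB_inclHB (hs : IsDoubleBiproduct 𝓑 𝓒 p s) (a a' : H ⊗[k] B) :
    s.MulAt (Double.equiv hcomp hp) (inclHB k H B C a) (inclHB k H B C a') :=
  hs.right_sub.mulAt (rightBiproduct_corresponds 𝓑) (Double.inclRight hcomp hp)
    (Double.equiv_inclHB hcomp hp) a a'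

theorem mul_inclC_inclH (hs : IsDoubleBiproduct 𝓑 𝓒 p s) (c : C) (h : H) :
    s.mul (inclC k H B C c ⊗ₜ[k] inclH k H B C h) = inclCH k H B C (c ⊗ₜ[k] h) := by
  have h₁ := hs.left_sub.map_mul (c ⊗ₜ[k] 1) (1 ⊗ₜ[k] h)
  have h₂ : (leftBiproduct 𝓒).mul ((c ⊗ₜ[k] 1) ⊗ₜ[k] (1 ⊗ₜ[k] h)) = c ⊗ₜ[k] h :=
    (LeftBi.equiv 𝓒).injective (LeftBi.mk_eq 𝓒 c h).symm
  rw [h₂] at h₁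
  exact h₁.symm

theorem mul_inclCH_inclB (hs : IsDoubleBiproduct 𝓑 𝓒 p s) (c : C) (h : H) (b : B) :
    s.mul (inclCH k H B C (c ⊗ₜ[k] h) ⊗ₜ[k] inclB k H B C b) = c ⊗ₜ[k] (h ⊗ₜ[k] b) := by
  rw [← hs.mul_inclC_inclH, hs.triangular]

/-- The case `c = 1` of the factorisation, in which `inclCH` of `1 ⊗ h` is `inclH h`. -/
theorem mul_inclH_inclB (hs : IsDoubleBiproduct 𝓑 𝓒 p s) (h : H) (b : B) :
    s.mul (inclH k H B C h ⊗ₜ[k] inclB k H B C b) = inclHB k H B C (h ⊗ₜ[k] b) :=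
  hs.mul_inclCH_inclB 1 h b

theorem mulAt_inclCH_inclB (hs : IsDoubleBiproduct 𝓑 𝓒 p s) (d : C ⊗[k] H) (b : B) :
    s.MulAt (Double.equiv hcomp hp) (inclCH k H B C d) (inclB k H B C b) := by
  induction d with
  | zero => rw [map_zero]; exact .zero_left _
  | add x y hx hy => rw [map_add]; exact hx.add_left hy
  | tmul c h =>
    rw [HopfData.MulAt, hs.mul_inclCH_inclB, Double.equiv_inclCH, Double.equiv_inclB,
      Double.equiv_tmul]
    change _ * Double.inclRight hcomp hp (RightBi.mk 𝓑 h b) =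
      Double.inclLeft hcomp hp (LeftBi.mk 𝓒 c h) * _
    rw [LeftBi.mk_eq, RightBi.mk_eq, map_mul, map_mul, Double.inclLeft_inrH, mul_assoc]

/-- For `a = h b`, `d (h b) = (d h) b`, where `d h` stays in `C ⋊ H` and its product with `b` is
fixed by the factorisation `c h b`. -/
theorem mulAt_inclCH_inclHB (hs : IsDoubleBiproduct 𝓑 𝓒 p s) (d : C ⊗[k] H) (a : H ⊗[k] B) :
    s.MulAt (Double.equiv hcomp hp) (inclCH k H B C d) (inclHB k H B C a) := by
  induction a with
  | zero => rw [map_zero]; exact .zero_right _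
  | add x y hx hy => rw [map_add]; exact hx.add_right hy
  | tmul h b =>
    rw [← hs.mul_inclH_inclB]
    refine hs.isHopf.mulAt_right (hs.mulAt_inclCH_inclCH hcomp hp d (1 ⊗ₜ[k] h))
      (hs.mulAt_inclHB_inclHB hcomp hp (h ⊗ₜ[k] 1) (1 ⊗ₜ[k] b)) ?_
    have h₁ := hs.left_sub.map_mul d (1 ⊗ₜ[k] h)
    have h₂ := hs.mulAt_inclCH_inclB hcomp hp ((leftBiproduct 𝓒).mul (d ⊗ₜ[k] (1 ⊗ₜ[k] h))) b
    rw [h₁] at h₂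
    exact h₂

theorem mul_inclC_inclHB (hs : IsDoubleBiproduct 𝓑 𝓒 p s) (c : C) (h : H) (b : B) :
    s.mul (inclC k H B C c ⊗ₜ[k] inclHB k H B C (h ⊗ₜ[k] b)) = c ⊗ₜ[k] (h ⊗ₜ[k] b) := by
  rw [← hs.mul_inclH_inclB, ← hs.isHopf.mul_assoc, hs.triangular]

/-- The right-hand side of the cross relation contains only products of an element of `C ⋊ H` with
one of `H ⋉ B`. These are already known, and `Double` satisfies the same relation. -/
theorem mulAt_inclB_inclC (hs : IsDoubleBiproduct 𝓑 𝓒 p s) (b : B) (c : C) :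
    s.MulAt (Double.equiv hcomp hp) (inclB k H B C b) (inclC k H B C c) := by
  have h₁ : ∀ g c₂ b₂ h, Double.equiv hcomp hp
      (s.mul (s.mul (inclH k H B C g ⊗ₜ[k] inclC k H B C c₂) ⊗ₜ[k]
        s.mul (inclB k H B C b₂ ⊗ₜ[k] inclH k H B C h))) =
      Double.equiv hcomp hp (inclH k H B C g) * Double.equiv hcomp hp (inclC k H B C c₂) *
        (Double.equiv hcomp hp (inclB k H B C b₂) *
          Double.equiv hcomp hp (inclH k H B C h)) := fun g c₂ b₂ h => by
    have hl := hs.left_sub.map_mul (1 ⊗ₜ[k] g) (c₂ ⊗ₜ[k] 1)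
    have hr := hs.right_sub.map_mul (1 ⊗ₜ[k] b₂) (h ⊗ₜ[k] 1)
    have h₂ := hs.mulAt_inclCH_inclHB hcomp hp
      ((leftBiproduct 𝓒).mul ((1 ⊗ₜ[k] g) ⊗ₜ[k] (c₂ ⊗ₜ[k] 1)))
      ((rightBiproduct 𝓑).mul ((1 ⊗ₜ[k] b₂) ⊗ₜ[k] (h ⊗ₜ[k] 1)))
    rw [hl, hr] at h₂
    exact h₂.trans (congrArg₂ (· * ·)
      (hs.mulAt_inclCH_inclCH hcomp hp (1 ⊗ₜ[k] g) (c₂ ⊗ₜ[k] 1))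
      (hs.mulAt_inclHB_inclHB hcomp hp (1 ⊗ₜ[k] b₂) (h ⊗ₜ[k] 1)))
  rw [HopfData.MulAt, hs.cross, crossProduct_eq, Double.equiv_inclB, Double.equiv_inclC,
    Double.cross]
  simp only [equiv_sw, map_smul, h₁, Double.equiv_inclB, Double.equiv_inclC, Double.equiv_inclH]

theorem induction_inclCH_inclB (hs : IsDoubleBiproduct 𝓑 𝓒 p s)
    {P : C ⊗[k] (H ⊗[k] B) → Prop} (zero : P 0)
    (mul : ∀ d b, P (s.mul (inclCH k H B C d ⊗ₜ[k] inclB k H B C b)))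
    (add : ∀ x y, P x → P y → P (x + y)) (x : C ⊗[k] (H ⊗[k] B)) : P x := by
  induction x with
  | zero => exact zero
  | add x y hx hy => exact add x y hx hy
  | tmul c a =>
    induction a with
    | zero => rw [TensorProduct.tmul_zero]; exact zero
    | add x y hx hy => rw [TensorProduct.tmul_add]; exact add _ _ hx hy
    | tmul h b => rw [← hs.mul_inclCH_inclB]; exact mul _ _

theorem induction_inclC_inclHB (hs : IsDoubleBiproduct 𝓑 𝓒 p s)
    {P : C ⊗[k] (H ⊗[k] B) → Prop} (zero : P 0)
    (mul : ∀ c a, P (s.mul (inclC k H B C c ⊗ₜ[k] inclHB k H B C a)))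
    (add : ∀ x y, P x → P y → P (x + y)) (x : C ⊗[k] (H ⊗[k] B)) : P x := by
  induction x with
  | zero => exact zero
  | add x y hx hy => exact add x y hx hy
  | tmul c a =>
    induction a with
    | zero => rw [TensorProduct.tmul_zero]; exact zero
    | add x y hx hy => rw [TensorProduct.tmul_add]; exact add _ _ hx hy
    | tmul h b => rw [← hs.mul_inclC_inclHB]; exact mul _ _

/-- Elements are sums of products `d b` with `d ∈ C ⋊ H`, and `(d b) a = d (b a)` with `b a ∈ H ⋉
B`. -/
theorem mulAt_inclHB (hs : IsDoubleBiproduct 𝓑 𝓒 p s) (x : C ⊗[k] (H ⊗[k] B)) (a : H ⊗[k] B) :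
    s.MulAt (Double.equiv hcomp hp) x (inclHB k H B C a) := by
  induction x using hs.induction_inclCH_inclB with
  | zero => exact .zero_left _
  | add x y hx hy => exact hx.add_left hy
  | mul d b =>
    refine hs.isHopf.mulAt_left (hs.mulAt_inclCH_inclB hcomp hp d b)
      (hs.mulAt_inclHB_inclHB hcomp hp (1 ⊗ₜ[k] b) a) ?_
    have h₁ := hs.right_sub.map_mul (1 ⊗ₜ[k] b) a
    have h₂ := hs.mulAt_inclCH_inclHB hcomp hp d ((rightBiproduct 𝓑).mul ((1 ⊗ₜ[k] b) ⊗ₜ[k] a))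
    rw [h₁] at h₂
    exact h₂

/-- On products, `d (d' b) = (d d') b` with `d d' ∈ C ⋊ H`. -/
theorem mulAt_inclCH (hs : IsDoubleBiproduct 𝓑 𝓒 p s) (d : C ⊗[k] H) (y : C ⊗[k] (H ⊗[k] B)) :
    s.MulAt (Double.equiv hcomp hp) (inclCH k H B C d) y := by
  induction y using hs.induction_inclCH_inclB with
  | zero => exact .zero_right _
  | add x y hx hy => exact hx.add_right hy
  | mul d' b =>
    refine hs.isHopf.mulAt_right (hs.mulAt_inclCH_inclCH hcomp hp d d')
      (hs.mulAt_inclCH_inclB hcomp hp d' b) ?_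
    rw [← hs.left_sub.map_mul]
    exact hs.mulAt_inclCH_inclB hcomp hp _ b

/-- Elements are also sums of products `c a` with `a ∈ H ⋉ B`, and `b (c a) = (b c) a`; the product
`b c` is known from the cross relation. -/
theorem mulAt_inclB (hs : IsDoubleBiproduct 𝓑 𝓒 p s) (b : B) (y : C ⊗[k] (H ⊗[k] B)) :
    s.MulAt (Double.equiv hcomp hp) (inclB k H B C b) y := by
  induction y using hs.induction_inclC_inclHB with
  | zero => exact .zero_right _
  | add x y hx hy => exact hx.add_right hy
  | mul c a =>
    exact hs.isHopf.mulAt_right (hs.mulAt_inclB_inclC hcomp hp b c)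
      (hs.mulAt_inclCH_inclHB hcomp hp (c ⊗ₜ[k] 1) a) (hs.mulAt_inclHB hcomp hp _ a)

/-- Finally `(d b) y = d (b y)`, so left multiplication by `C ⋊ H` and by `B` determines the whole
product. -/
theorem mulAt (hs : IsDoubleBiproduct 𝓑 𝓒 p s) (x y : C ⊗[k] (H ⊗[k] B)) :
    s.MulAt (Double.equiv hcomp hp) x y := by
  induction x using hs.induction_inclCH_inclB with
  | zero => exact .zero_left _
  | add x y hx hy => exact hx.add_left hy
  | mul d b =>
    exact hs.isHopf.mulAt_left (hs.mulAt_inclCH_inclB hcomp hp d b)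
      (hs.mulAt_inclB hcomp hp b y) (hs.mulAt_inclCH hcomp hp d _)

/-- Every double biproduct structure is the one of `Double`. -/
theorem corresponds (hs : IsDoubleBiproduct 𝓑 𝓒 p s) : s.Corresponds (Double.equiv hcomp hp) := by
  refine hs.isHopf.corresponds (hs.mulAt hcomp hp) ?_ (fun x => ?_) (fun x => ?_)
  · rw [← hs.right_sub.map_one, Double.equiv_inclHB, (rightBiproduct_corresponds 𝓑).one, map_one]
  · induction x using hs.induction_inclC_inclHB with
    | zero => simp only [map_zero]
    | add x y hx hy => simp only [map_add, hx, hy]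
    | mul c a =>
      -- Both coproducts are multiplicative and agree on the two sub-Hopf algebras, whose products
      -- `c a` span the space.
      exact hs.isHopf.comul_mul_eq (hs.mulAt hcomp hp)
        (hs.left_sub.comul_eq (leftBiproduct_corresponds 𝓒) (Double.inclLeft hcomp hp)
          (Double.equiv_inclCH hcomp hp) (c ⊗ₜ[k] 1))
        (hs.right_sub.comul_eq (rightBiproduct_corresponds 𝓑) (Double.inclRight hcomp hp)
          (Double.equiv_inclHB hcomp hp) a)
  · induction x using hs.induction_inclC_inclHB with
    | zero => simp only [map_zero]
    | add x y hx hy => simp only [map_add, hx, hy]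
    | mul c a =>
      have hc := hs.left_sub.counit_eq (leftBiproduct_corresponds 𝓒) (Double.inclLeft hcomp hp)
          (Double.equiv_inclCH hcomp hp) (c ⊗ₜ[k] 1)
      have ha := hs.right_sub.counit_eq (rightBiproduct_corresponds 𝓑)
          (Double.inclRight hcomp hp) (Double.equiv_inclHB hcomp hp) a
      have hm := hs.mulAt hcomp hp (inclC k H B C c) (inclHB k H B C a)
      rw [HopfData.MulAt] at hm
      rw [hm, Bialgebra.counit_mul, hs.isHopf.counit_mul, ← ha]
      exact congrArg (· * _) hc

end IsDoubleBiproduct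

end Main

end DoubleBiproduct

end

theorem theoremB1 {k H B C : Type*} [Field k] [Ring H] [HopfAlgebra k H]
    [Ring B] [Algebra k B] [Coalgebra k B] [Ring C] [Algebra k C] [Coalgebra k C]
    (hH : Function.Bijective (HopfAlgebra.antipode k (A := H)))
    (𝓑 : DoubleBiproduct.RightBraidedGroup k H B)
    (𝓒 : DoubleBiproduct.LeftBraidedGroup k H C)
    (hcomp : DoubleBiproduct.Compatible 𝓑 𝓒)
    (p : C ⊗[k] B →ₗ[k] k)
    (hp : DoubleBiproduct.IsBraidedSkewPairing 𝓑 𝓒 p) :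
    ∃! s : DoubleBiproduct.HopfData k (C ⊗[k] (H ⊗[k] B)),
      DoubleBiproduct.IsDoubleBiproduct 𝓑 𝓒 p s := by
  refine ⟨DoubleBiproduct.HopfData.ofEquiv (DoubleBiproduct.Double.equiv hcomp hp),
    DoubleBiproduct.isDoubleBiproduct_of_corresponds
      (DoubleBiproduct.HopfData.corresponds_ofEquiv _), fun s hs => ?_⟩
  exact (hs.corresponds hcomp hp).unique (DoubleBiproduct.HopfData.corresponds_ofEquiv _)
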